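/- Let $\mu$ be a $\sigma$-finite non-atomic measure on a measurable space $(X,\mathcal X)$ (every measurable set of positive measure has a measurable subset of strictly smaller positive measure), and let $\mu_W$ be a white noise with reference measure $\mu$ on a probability space $(\Omega,P)$, i.e. a family of jointly Gaussian random variables $\mu_W(B)$, indexed by the sets $B\in\mathcal X$ with $\mu(B)<\infty$, such that $E\mu_W(B)=0$ and $E\mu_W(A)\mu_W(B)=\mu(A\cap B)$. Let $k\ge 2$ and let $f(x_1,\dots,x_k)$ be a real measurable function on $X^k$ with $$V_1(f)^2=\int f^2(x_1,\dots,x_k)\,\mu(dx_1)\dots\mu(dx_k)<\infty .$$ The $k$-fold Wiener–Itô integral is $$I_k(f)=\frac1{k!}\int f(x_1,\dots,x_k)\,\mu_W(dx_1)\dots\mu_W(dx_k),$$ where the integral of an elementary function $\sum_i c_i 1_{A_{i,1}\times\dots\times A_{i,k}}$ (a finite sum, with $A_{i,1},\dots,A_{i,k}$ pairwise disjoint of finite measure for each $i$) is $\sum_i c_i\,\mu_W(A_{i,1})\cdots\mu_W(A_{i,k})$, and the integral of a general $f$ is the limit in $L_2(P)$ of the integrals of elementary functions converging to $f$ in $L_2(\mu^k)$.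 For a partition $Q=\{A_1,\dots,A_s\}$ of $\{1,\dots,k\}$ into non-empty sets put $$V_Q(f)=\sup\int f(x_1,\dots,x_k)\prod_{r=1}^s g_r(x_j,\,j\in A_r)\,\mu(dx_1)\dots\mu(dx_k),$$ the supremum being over all measurable functions $g_1,\dots,g_s$ with $\int g_r^2(x_j,\,j\in A_r)\prod_{j\in A_r}\mu(dx_j)\le 1$ for all $1\le r\le s$; and for $2\le s\le k$ let $V_s(f)$ be the supremum of $V_Q(f)$ over all partitions $Q$ into exactly $s$ sets. Then there exist constants $C,C_1,C_2>0$ depending only on $k$ such that, for all such $X,\mu,\mu_W,f$, the integral $I_k(f)$ exists and satisfies $$E(k!I_k(f))^{2M}\le C^M V_1(f)^{2M}\max\Bigl(M,\;M^k\max_{2\le s\le k}\Bigl(\frac{V_s(f)}{V_1(f)}\Bigr)^{2/(s-1)}\Bigr)^M\qquad\text{for all } M=1,2,\dots,$$ (in particular these moments are finite), and $$P(|k!I_k(f)|>x)\le C_1\exp\Bigl\{-C_2\min\Bigl(\frac{x^2}{V_1(f)^2},\;\min_{2\le s\le k}\Bigl(\frac{x}{V_1(f)^{(s-2)/(s-1)}\,V_s(f)^{1/(s-1)}}\Bigr)^{2/k}\Bigr)\Bigr\}\qquad\text{for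 all } x>0 .$$ (If $V_1(f)=0$, quotients with denominator $0$ are read as $0$; the first bound then says that $I_k(f)=0$ almost surely.) -/

import Mathlib

open MeasureTheory ProbabilityTheory Filter Topology

open scoped Nat

noncomputable section

namespace WienerIto

/-- A measure is non-atomic if every measurable set of positive measure has a measurable subset
of strictly smaller positive measure.  On a general measurable space this is stronger than the
vanishing of the measure on singletons. -/
def IsNonatomic {X : Type*} [MeasurableSpace X] (μ : Measure X) : Prop :=
  ∀ A : Set X, MeasurableSet A → 0 < μ A → ∃ B ⊆ A, MeasurableSet B ∧ 0 < μ B ∧ μ B < μ A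

/-- The measurable sets of finite measure, the index set of a white noise. -/
abbrev FinMeasSet {X : Type*} [MeasurableSpace X] (μ : Measure X) : Type _ :=
  {B : Set X // MeasurableSet B ∧ μ B < ⊤}

/-- `W` is a white noise on the probability space `(Ω, P)` with reference measure `μ`: a family
of jointly Gaussian random variables with mean zero and covariance `E W(A) W(B) = μ(A ∩ B)`. -/
structure IsWhiteNoise {X Ω : Type*} [MeasurableSpace X] [MeasurableSpace Ω] (μ : Measure X)
    (P : Measure Ω) (W : FinMeasSet μ → Ω → ℝ) : Prop where
  isGaussianProcess : IsGaussianProcess W P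
  mean_eq_zero : ∀ A : FinMeasSet μ, ∫ ω, W A ω ∂P = 0
  covariance : ∀ A B : FinMeasSet μ, ∫ ω, W A ω * W B ω ∂P = μ.real (A.1 ∩ B.1)

/-- The linear space of pairs `(F, J)`, where
`F = ∑ c_i 1_{A_{i,1} × ⋯ × A_{i,k}}` is an elementary function (for each `i` the sets
`A_{i,1}, …, A_{i,k}` have finite measure and are pairwise disjoint) and
`J = ∑ c_i W(A_{i,1}) ⋯ W(A_{i,k})` is its `k`-fold stochastic integral. -/
def elementaryIntegrals {X Ω : Type*} [MeasurableSpace X] {μ : Measure X}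
    (W : FinMeasSet μ → Ω → ℝ) (k : ℕ) : Submodule ℝ (((Fin k → X) → ℝ) × (Ω → ℝ)) :=
  Submodule.span ℝ
    {p | ∃ A : Fin k → FinMeasSet μ, Pairwise (fun i j => Disjoint (A i).1 (A j).1) ∧
      p = (Set.indicator (Set.univ.pi fun j => (A j).1) (fun _ => (1 : ℝ)),
        fun ω => ∏ j, W (A j) ω)}

/-- `J = ∫ f(x₁, …, x_k) μ_W(dx₁) ⋯ μ_W(dx_k)`: the random variable `J` is the limit in `L²(P)`
of the stochastic integrals of elementary functions which converge to `f` in `L²(μ^k)`. -/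
def IsMultipleIntegral {X Ω : Type*} [MeasurableSpace X] [MeasurableSpace Ω] {μ : Measure X}
    (P : Measure Ω) (W : FinMeasSet μ → Ω → ℝ) {k : ℕ} (f : (Fin k → X) → ℝ) (J : Ω → ℝ) : Prop :=
  AEStronglyMeasurable J P ∧
  ∃ p : ℕ → ((Fin k → X) → ℝ) × (Ω → ℝ),
    (∀ n, p n ∈ elementaryIntegrals W k) ∧
    Tendsto (fun n => eLpNorm ((p n).1 - f) 2 (Measure.pi fun _ : Fin k => μ)) atTop (𝓝 0) ∧
    Tendsto (fun n => eLpNorm ((p n).2 - J) 2 P) atTop (𝓝 0)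

/-- `I` is (a version of) the `k`-fold Wiener–Itô integral
`I_k(f) = (1 / k!) ∫ f(x₁, …, x_k) μ_W(dx₁) ⋯ μ_W(dx_k)`. -/
def IsWienerItoIntegral {X Ω : Type*} [MeasurableSpace X] [MeasurableSpace Ω] {μ : Measure X}
    (P : Measure Ω) (W : FinMeasSet μ → Ω → ℝ) {k : ℕ} (f : (Fin k → X) → ℝ) (I : Ω → ℝ) : Prop :=
  IsMultipleIntegral P W f (fun ω => (k ! : ℝ) * I ω)

/-- `V₁(f)`, the norm of `f` in `L²(μ^K)`. -/
def V₁ {X K : Type*} [MeasurableSpace X] [Fintype K] (μ : Measure X) (f : (K → X) → ℝ) : ℝ :=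
  Real.sqrt (∫ x, f x ^ 2 ∂(Measure.pi fun _ : K => μ))

/-- The class `𝓕_Q` of a partition `Q = {A_1, …, A_s}` of `K`: families of functions
`g_A(x_j, j ∈ A)`, `A ∈ Q`, with `L²`-norm at most one (only the values `g A` at blocks `A` of
`Q` matter). -/
def unitFamilies {X K : Type*} [MeasurableSpace X] [Fintype K] [DecidableEq K] (μ : Measure X)
    (Q : Finpartition (Finset.univ : Finset K)) : Set ((A : Finset K) → (A → X) → ℝ) :=
  {g | ∀ A ∈ Q.parts, MemLp (g A) 2 (Measure.pi fun _ : A => μ) ∧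
    ∫ y, g A y ^ 2 ∂(Measure.pi fun _ : A => μ) ≤ 1}

/-- `V_Q(f) = sup_{g ∈ 𝓕_Q} ∫ f(x_j, j ∈ K) ∏_{A ∈ Q} g_A(x_j, j ∈ A) ∏_{j ∈ K} μ(dx_j)`. -/
def VPart {X K : Type*} [MeasurableSpace X] [Fintype K] [DecidableEq K] (μ : Measure X)
    (f : (K → X) → ℝ) (Q : Finpartition (Finset.univ : Finset K)) : ℝ :=
  sSup ((fun g : (A : Finset K) → (A → X) → ℝ =>
    ∫ x, f x * ∏ A ∈ Q.parts, g A (fun j => x j) ∂(Measure.pi fun _ : K => μ)) ''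
      unitFamilies μ Q)

/-- `V_s(f)`, the supremum of `V_Q(f)` over the partitions `Q` of `K` into exactly `s` blocks. -/
def V {X K : Type*} [MeasurableSpace X] [Fintype K] [DecidableEq K] (μ : Measure X) (s : ℕ)
    (f : (K → X) → ℝ) : ℝ :=
  sSup (VPart μ f '' {Q : Finpartition (Finset.univ : Finset K) | Q.parts.card = s})

end WienerIto

end

/-! By the diagram formula, the moment of order T = 2M of the integral of an elementary function is
a sum over the pairings of the T·k arguments of T copies of f. Elementary functions vanish on the
diagonals, so only pairings that join different copies contribute. Such a pairing is a closed
network with the copies as vertices and the pairs as edges; its value is the product of the copies,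
summed over all edge variables.

Assume V_Q(f) ≤ v α^(|Q|-1) for all partitions Q. Remove a vertex u from a connected closed network
with n vertices. The rest splits into r connected parts, all joined to u, and the edges from u to
these parts divide the arguments of u into r blocks. The assumption bounds the value by v α^(r-1)
times the product of the L² norms of the parts, each seen as a function of its open edges. The same
removal, with the open edges at u as one more block, shows by induction that a connected part with m
vertices and some open edge has norm at most v^m α^(m-1) (`marg_contr_sq_le`). So a connected closed
network is at most v^n α^(n-2) (`abs_contr_le`), and a pairing with c components at most v^T
α^(T-2c) (`abs_sum_prod_le`).

It remains to count pairings with a weight α^(-2) for each component. Each further component removes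
much of the freedom in choosing partners, and if α^(-2) ≤ T^(k-1) the weighted number is still at
most (const · √T^k)^T, the order of the number of all pairings (`abs_diagSum_univ_le`,
`abs_diagSum_le`). The moment bound follows with α² the larger of max_s (V_s/V₁)^(2/(s-1)) and
T^(-(k-1)).

For general f, non-atomicity makes the elementary functions dense in L²
(`isElementaryLimit_of_memLp`), the case T = 2 makes the integral continuous there, and since V_Q is
Lipschitz in L² the moment bound passes to the limit by Fatou's lemma. The tail bound is Markov's
inequality with M proportional to the minimum in the exponent. -/

namespace WienerIto

/-! ### Partial sums over finitely many variables. -/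

section PartialSums

variable {E K ι : Type*}

/-- The function `F` of the variables `y e`, `e ∈ E`, depends only on those with `e ∈ s`. -/
def Dep (F : (E → K) → ℝ) (s : Finset E) : Prop :=
  ∀ x y : E → K, (∀ e ∈ s, x e = y e) → F x = F y

theorem Dep.mono {F : (E → K) → ℝ} {s t : Finset E} (h : Dep F s) (hst : s ⊆ t) : Dep F t :=
  fun x y hxy => h x y fun e he => hxy e (hst he)

theorem Dep.pow {F : (E → K) → ℝ} {s : Finset E} (h : Dep F s) (n : ℕ) :
    Dep (fun y => F y ^ n) s := fun x y hxy => by simp only [h x y hxy]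

theorem Dep.prod {P : Finset ι} {h : ι → (E → K) → ℝ} {s : Finset E}
    (hh : ∀ r ∈ P, Dep (h r) s) : Dep (fun y => ∏ r ∈ P, h r y) s :=
  fun x y hxy => Finset.prod_congr rfl fun r hr => hh r hr x y hxy

variable [Fintype E] [DecidableEq E] [Fintype K] [DecidableEq K]

/-- The sum of `F` over the variables with index in `s`. -/
def marg (s : Finset E) (F : (E → K) → ℝ) (y : E → K) : ℝ :=
  ∑ z with (∀ e ∉ s, z e = y e), F z

theorem marg_empty (F : (E → K) → ℝ) : marg ∅ F = F := by
  ext y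
  have : (Finset.univ.filter fun z : E → K => ∀ e ∉ (∅ : Finset E), z e = y e) = {y} := by
    ext z; simp [funext_iff]
  rw [marg, this, Finset.sum_singleton]

theorem marg_univ (F : (E → K) → ℝ) (y : E → K) : marg Finset.univ F y = ∑ z, F z := by
  simp [marg]

theorem marg_congr {s : Finset E} {F G : (E → K) → ℝ} (y : E → K)
    (h : ∀ z, (∀ e ∉ s, z e = y e) → F z = G z) : marg s F y = marg s G y :=
  Finset.sum_congr rfl fun z hz => h z (by simpa using hz)

theorem marg_union {s t : Finset E} (hst : Disjoint s t) (F : (E → K) → ℝ) :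
    marg (s ∪ t) F = marg s (marg t F) := by
  ext y
  unfold marg
  rw [← Finset.sum_fiberwise_of_maps_to
    (t := Finset.univ.filter fun z : E → K => ∀ e ∉ s, z e = y e)
    (g := fun w e => if e ∈ s then w e else y e)]
  · refine Finset.sum_congr rfl fun z hz => Finset.sum_congr ?_ fun _ _ => rfl
    ext w
    simp only [Finset.mem_filter, Finset.mem_univ, true_and, Finset.mem_union, not_or,
      funext_iff] at hz ⊢
    constructor
    · rintro ⟨h1, h2⟩ e he
      have := h2 e
      split_ifs at this with hs
      · exact this
      · rw [h1 e ⟨hs, he⟩, hz e hs]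
    · intro h
      refine ⟨fun e he => by rw [h e he.2, hz e he.1], fun e => ?_⟩
      split_ifs with hs
      · exact h e (Finset.disjoint_left.mp hst hs)
      · exact (hz e hs).symm
  · intro w _
    simp only [Finset.mem_filter, Finset.mem_univ, true_and]
    intro e he
    simp [he]

theorem marg_mul_left {s t : Finset E} {H : (E → K) → ℝ} (hH : Dep H t) (hst : Disjoint t s)
    (F : (E → K) → ℝ) (y : E → K) : marg s (fun z => H z * F z) y = H y * marg s F y := by
  rw [marg, marg, Finset.mul_sum]
  refine Finset.sum_congr rfl fun z hz => ?_
  rw [hH z y fun e he => (by simpa using hz : ∀ e ∉ s, z e = y e) e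
    (Finset.disjoint_left.mp hst he)]

theorem marg_const_mul (s : Finset E) (c : ℝ) (F : (E → K) → ℝ) (y : E → K) :
    marg s (fun z => c * F z) y = c * marg s F y := by
  rw [marg, marg, Finset.mul_sum]

theorem marg_nonneg {s : Finset E} {F : (E → K) → ℝ} (hF : ∀ z, 0 ≤ F z) (y : E → K) :
    0 ≤ marg s F y := Finset.sum_nonneg fun z _ => hF z

theorem marg_mono {s : Finset E} {F G : (E → K) → ℝ} (h : ∀ z, F z ≤ G z) (y : E → K) :
    marg s F y ≤ marg s G y := Finset.sum_le_sum fun z _ => h z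

theorem Dep.marg {F : (E → K) → ℝ} {s : Finset E} (hF : Dep F s) (t : Finset E) :
    Dep (marg t F) (s \ t) := by
  intro x y hxy
  unfold WienerIto.marg
  refine Finset.sum_bij' (fun z _ e => if e ∈ t then z e else y e)
    (fun z _ e => if e ∈ t then z e else x e) ?_ ?_ ?_ ?_ ?_
  · intro z _; simp +contextual
  · intro z _; simp +contextual
  · intro z hz
    simp only [Finset.mem_filter, Finset.mem_univ, true_and] at hz
    ext e
    by_cases he : e ∈ t <;> simp [he, hz]
  · intro z hz
    simp only [Finset.mem_filter, Finset.mem_univ, true_and] at hz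
    ext e
    by_cases he : e ∈ t <;> simp [he, hz]
  · intro z hz
    simp only [Finset.mem_filter, Finset.mem_univ, true_and] at hz
    refine hF _ _ fun e he => ?_
    by_cases het : e ∈ t
    · simp [het]
    · simp [het, hz e het, hxy e (Finset.mem_sdiff.mpr ⟨he, het⟩)]

/-- Fubini for a product: no factor involves the summation variables `D` of another factor, so the
sums can be carried out factor by factor. -/
theorem marg_prod [DecidableEq ι] (P : Finset ι) {D B : ι → Finset E} {h : ι → (E → K) → ℝ}
    (hD : ∀ r ∈ P, ∀ r' ∈ P, r ≠ r' → Disjoint (D r) (D r'))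
    (hB : ∀ r ∈ P, ∀ r' ∈ P, r ≠ r' → Disjoint (B r) (D r'))
    (hh : ∀ r ∈ P, Dep (h r) (B r)) (y : E → K) :
    marg (P.biUnion D) (fun z => ∏ r ∈ P, h r z) y = ∏ r ∈ P, marg (D r) (h r) y := by
  induction P using Finset.induction_on generalizing y with
  | empty => simp [marg_empty]
  | insert r P hr ih =>
    have hne : ∀ r' ∈ P, r ≠ r' := fun r' h' h => hr (h ▸ h')
    have hmem : ∀ r' ∈ P, r' ∈ insert r P := fun r' => Finset.mem_insert_of_mem
    have hrm : r ∈ insert r P := Finset.mem_insert_self r P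
    have ih' := ih (fun a ha b hb => hD a (hmem a ha) b (hmem b hb))
      (fun a ha b hb => hB a (hmem a ha) b (hmem b hb)) (fun a ha => hh a (hmem a ha))
    rw [Finset.biUnion_insert, marg_union, Finset.prod_insert hr]
    · have h1 : marg (P.biUnion D) (fun z => ∏ r ∈ insert r P, h r z) =
          fun z => (∏ r' ∈ P, marg (D r') (h r') z) * h r z := by
        ext z
        simp only [Finset.prod_insert hr]
        rw [marg_mul_left (hh r hrm), ih', mul_comm]
        rw [Finset.disjoint_biUnion_right]
        exact fun r' h' => hB r hrm r' (hmem r' h') (hne r' h')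
      rw [h1, mul_comm, marg_mul_left (t := P.biUnion B)]
      · refine Dep.prod fun r' h' => ?_
        exact ((hh r' (hmem r' h')).marg _).mono
          (Finset.sdiff_subset.trans (Finset.subset_biUnion_of_mem B h'))
      · rw [Finset.disjoint_biUnion_left]
        exact fun r' h' => hB r' (hmem r' h') r hrm (hne r' h').symm
    · rw [Finset.disjoint_biUnion_right]
      exact fun r' h' => hD r hrm r' (hmem r' h') (hne r' h')

/-- Transfers sums over the legs of one vertex, embedded among all edges by `e`, to sums over the
index set `J` of the tensor; the other edges are frozen at `y`. -/
theorem marg_map {J : Type*} [Fintype J] [DecidableEq J] {e : J → E}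
    (he : Function.Injective e) (A : Finset J) (F : (E → K) → ℝ) (y : E → K) :
    marg (A.image e) F y = marg A (fun i => F (Function.extend e i y)) (y ∘ e) := by
  unfold marg
  symm
  refine Finset.sum_bij' (fun i _ => Function.extend e i y) (fun z _ => z ∘ e) ?_ ?_ ?_ ?_ ?_
  · intro i hi
    simp only [Finset.mem_filter, Finset.mem_univ, true_and, Finset.mem_image, not_exists,
      not_and] at hi ⊢
    intro z hz
    by_cases hj : ∃ j, e j = z
    · obtain ⟨j, rfl⟩ := hj
      rw [he.extend_apply, hi j fun hj => hz j hj rfl]; rfl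
    · rw [Function.extend_apply' _ _ _ hj]
  · intro z hz
    simp only [Finset.mem_filter, Finset.mem_univ, true_and, Finset.mem_image, not_exists,
      not_and] at hz ⊢
    intro j hj
    exact hz (e j) fun j' hj' h => hj (he h ▸ hj')
  · intro i _
    ext j
    simp [he.extend_apply]
  · intro z hz
    simp only [Finset.mem_filter, Finset.mem_univ, true_and, Finset.mem_image, not_exists,
      not_and] at hz
    ext w
    by_cases hj : ∃ j, e j = w
    · obtain ⟨j, rfl⟩ := hj
      simp [he.extend_apply]
    · rw [Function.extend_apply' _ _ _ hj, hz w fun j _ h => hj ⟨j, h⟩]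
  · intro i _; rfl

end PartialSums

/-! ### The block bound for a tensor. -/

section BlockBound

variable {K : Type*} [Fintype K] [DecidableEq K]

/-- The tensor `a` satisfies `|∑ a ∏_{A ∈ Q} g_A| ≤ v α^(|Q| - 1) ∏_{A ∈ Q} ‖g_A‖₂` for all
partitions `Q` of its indices. -/
def TensorBound {J : Type*} [Fintype J] [DecidableEq J] (a : (J → K) → ℝ) (v α : ℝ) : Prop :=
  ∀ (Q : Finpartition (Finset.univ : Finset J)) (g : Finset J → (J → K) → ℝ),
    (∀ A ∈ Q.parts, Dep (g A) A) → ∀ y : J → K,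
      |∑ i, a i * ∏ A ∈ Q.parts, g A i| ≤
        v * α ^ (Q.parts.card - 1) * ∏ A ∈ Q.parts, √(marg A (fun i => g A i ^ 2) y)

/-- The form in which the tensor bound is applied at a vertex of a network. The blocks `D r` of
edges pull back to a partition of `J`; the factors may also depend on edges away from the vertex,
since these are kept fixed by the partial sum. -/
theorem TensorBound.marg_le {J E ι : Type*} [Fintype J] [DecidableEq J] [Fintype E]
    [DecidableEq E] [DecidableEq ι] {a : (J → K) → ℝ} {v α : ℝ} (ha : TensorBound a v α)
    {e : J → E} (he : Function.Injective e) (P : Finset ι) {D B : ι → Finset E}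
    {h : ι → (E → K) → ℝ} (hne : ∀ r ∈ P, (D r).Nonempty)
    (hD : ∀ r ∈ P, ∀ r' ∈ P, r ≠ r' → Disjoint (D r) (D r'))
    (hu : P.biUnion D = Finset.univ.image e)
    (hh : ∀ r ∈ P, Dep (h r) (B r)) (hB : ∀ r ∈ P, B r ∩ Finset.univ.image e ⊆ D r)
    (y : E → K) :
    |marg (Finset.univ.image e) (fun z => a (z ∘ e) * ∏ r ∈ P, h r z) y| ≤
      v * α ^ (P.card - 1) * ∏ r ∈ P, √(marg (D r) (fun z => h r z ^ 2) y) := by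
  classical
  set A : ι → Finset J := fun r => Finset.univ.filter fun j => e j ∈ D r with hA
  have hAD : ∀ r ∈ P, (A r).image e = D r := by
    intro r hr
    ext z
    simp only [hA, Finset.mem_image, Finset.mem_filter, Finset.mem_univ, true_and]
    constructor
    · rintro ⟨j, hj, rfl⟩; exact hj
    · intro hz
      have : z ∈ Finset.univ.image e := hu ▸ Finset.mem_biUnion.mpr ⟨r, hr, hz⟩
      obtain ⟨j, _, rfl⟩ := Finset.mem_image.mp this
      exact ⟨j, hz, rfl⟩
  have hAinj : Set.InjOn A P := by
    intro r hr r' hr' hrr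
    by_contra hne'
    have := hD r hr r' hr' hne'
    rw [← hAD r hr, ← hAD r' hr', hrr, hAD r' hr'] at this
    exact (hne r' hr').ne_empty (disjoint_self.mp this)
  have hAdisj : ∀ r ∈ P, ∀ r' ∈ P, r ≠ r' → Disjoint (A r) (A r') := by
    intro r hr r' hr' hn
    rw [Finset.disjoint_left]
    intro j hj hj'
    simp only [hA, Finset.mem_filter, Finset.mem_univ, true_and] at hj hj'
    exact Finset.disjoint_left.mp (hD r hr r' hr' hn) hj hj'
  let Q : Finpartition (Finset.univ : Finset J) :=
    { parts := P.image A
      supIndep := by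
        rw [Finset.supIndep_iff_pairwiseDisjoint]
        intro b hb c hc hbc
        simp only [Finset.coe_image, Set.mem_image, Finset.mem_coe] at hb hc
        obtain ⟨r, hr, rfl⟩ := hb
        obtain ⟨r', hr', rfl⟩ := hc
        exact hAdisj r hr r' hr' fun h => hbc (h ▸ rfl)
      sup_parts := by
        ext j
        simp only [Finset.sup_image, Finset.mem_sup, Finset.mem_univ, iff_true, Function.comp, id]
        have : e j ∈ P.biUnion D := by rw [hu]; simp
        obtain ⟨r, hr, hj⟩ := Finset.mem_biUnion.mp this
        exact ⟨r, hr, by simp [hA, hj]⟩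
      bot_notMem := by
        intro hb
        obtain ⟨r, hr, h0⟩ := Finset.mem_image.mp hb
        have := hAD r hr
        rw [h0] at this
        exact (hne r hr).ne_empty (by simpa using this.symm) }
  rcases P.eq_empty_or_nonempty with hP | ⟨r₀, _⟩
  · have := ha Q (fun _ _ => 1) (fun _ _ _ _ _ => rfl) (y ∘ e)
    subst hP
    rw [marg_map he, marg_univ]
    simpa [Q, he.extend_apply, Function.extend_comp he] using this
  have : Nonempty ι := ⟨r₀⟩
  -- `TensorBound` indexes its factors by blocks; `ρ` recovers the label `r` from the block `A r`.
  set ρ : Finset J → ι := Function.invFunOn A P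
  have hρ : ∀ r ∈ P, ρ (A r) = r := fun r hr => hAinj.leftInvOn_invFunOn hr
  have key := ha Q (fun B i => h (ρ B) (Function.extend e i y)) ?_ (y ∘ e)
  · have hQ : Q.parts = P.image A := rfl
    rw [hQ, Finset.card_image_of_injOn hAinj, Finset.prod_image hAinj] at key
    rw [marg_map he, marg_univ]
    have e1 : ∀ r ∈ P, √(marg (A r) (fun i => h (ρ (A r)) (Function.extend e i y) ^ 2) (y ∘ e)) =
        √(marg (D r) (fun z => h r z ^ 2) y) := by
      intro r hr
      rw [← hAD r hr, marg_map he, hρ r hr]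
    rw [Finset.prod_congr rfl e1] at key
    refine le_of_eq_of_le (congrArg abs (Finset.sum_congr rfl fun i _ => ?_)) key
    rw [Function.extend_comp he, Finset.prod_image hAinj]
    congr 1
    exact Finset.prod_congr rfl fun r hr => by rw [hρ r hr]
  · intro B' hB'
    obtain ⟨r, hr, rfl⟩ := Finset.mem_image.mp hB'
    intro i i' hii
    simp only [hρ r hr]
    refine hh r hr _ _ fun z hz => ?_
    by_cases hj : ∃ j, e j = z
    · obtain ⟨j, rfl⟩ := hj
      rw [he.extend_apply, he.extend_apply]
      refine hii j ?_
      have := hB r hr (Finset.mem_inter.mpr ⟨hz, Finset.mem_image_of_mem e (Finset.mem_univ j)⟩)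
      simpa [hA] using this
    · rw [Function.extend_apply' _ _ _ hj, Function.extend_apply' _ _ _ hj]

end BlockBound

end WienerIto

/-! ### Networks, connected splittings and the removal of a vertex. -/

namespace WienerIto

section Network

variable {V E J K : Type*} [Fintype V] [DecidableEq V] [Fintype E] [DecidableEq E] [Fintype J]
  [DecidableEq J] [Fintype K] [DecidableEq K]

set_option linter.unusedSectionVars false

/-- The edges incident to a set of vertices, where `e v j` is the edge at the `j`-th leg of `v`. -/
def legs (e : V → J → E) (S : Finset V) : Finset E := S.biUnion fun v => Finset.univ.image (e v)

/-- The edges all of whose ends are in `S`. -/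
def inner (e : V → J → E) (S : Finset V) : Finset E := legs e S \ legs e Sᶜ

/-- The edges with ends both inside and outside of `S`. -/
def bdry (e : V → J → E) (S : Finset V) : Finset E := legs e S ∩ legs e Sᶜ

/-- The tensor obtained from copies of `a` at the vertices in `S` by summing over the inner
edges. -/
def contr (e : V → J → E) (a : (J → K) → ℝ) (S : Finset V) : (E → K) → ℝ :=
  marg (inner e S) fun y => ∏ v ∈ S, a (y ∘ e v)

/-- Each edge joins exactly two vertices, and there are no loops. -/
structure IsNetwork (e : V → J → E) : Prop where
  inj : ∀ v, Function.Injective (e v)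
  ends : ∀ z, ∃ v w, v ≠ w ∧ ∀ u, z ∈ Finset.univ.image (e u) ↔ u = v ∨ u = w

/-- The set `S` of vertices cannot be split into two parts without common edges. -/
def Conn (e : V → J → E) (S : Finset V) : Prop :=
  ∀ A ⊆ S, A.Nonempty → A ≠ S → ¬ Disjoint (legs e A) (legs e (S \ A))

/-- `P` is a splitting of `S` into connected parts. -/
structure IsSplitting (e : V → J → E) (P : Finset (Finset V)) (S : Finset V) : Prop where
  nonempty : ∀ C ∈ P, C.Nonempty
  conn : ∀ C ∈ P, Conn e C
  disj : ∀ C ∈ P, ∀ C' ∈ P, C ≠ C' → Disjoint C C'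
  sep : ∀ C ∈ P, ∀ C' ∈ P, C ≠ C' → Disjoint (legs e C) (legs e C')
  union : P.biUnion id = S

variable {e : V → J → E}

theorem mem_legs {S : Finset V} {z : E} :
    z ∈ legs e S ↔ ∃ v ∈ S, z ∈ Finset.univ.image (e v) := by
  simp [legs]

theorem legs_mono {S T : Finset V} (h : S ⊆ T) : legs e S ⊆ legs e T :=
  Finset.biUnion_subset_biUnion_of_subset_left _ h

theorem legs_singleton (v : V) : legs e {v} = Finset.univ.image (e v) := by simp [legs]

theorem IsNetwork.mem_legs (he : IsNetwork e) (z : E) :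
    ∃ v w, v ≠ w ∧ ∀ S, z ∈ legs e S ↔ v ∈ S ∨ w ∈ S := by
  obtain ⟨v, w, hvw, h⟩ := he.ends z
  refine ⟨v, w, hvw, fun S => ?_⟩
  simp only [WienerIto.mem_legs, h]
  constructor
  · rintro ⟨u, hu, rfl | rfl⟩ <;> simp [hu]
  · rintro (h | h)
    · exact ⟨v, h, Or.inl rfl⟩
    · exact ⟨w, h, Or.inr rfl⟩

theorem exists_isSplitting (e : V → J → E) (S : Finset V) : ∃ P, IsSplitting e P S := by
  induction S using Finset.strongInduction with
  | H S ih =>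
    rcases S.eq_empty_or_nonempty with rfl | hS
    · exact ⟨∅, by simp, by simp, by simp, by simp, by simp⟩
    by_cases hc : Conn e S
    · refine ⟨{S}, by simpa, by simpa, ?_, ?_, by simp⟩ <;>
      · intro C hC C' hC' h
        rw [Finset.mem_singleton] at hC hC'
        exact absurd (hC.trans hC'.symm) h
    · unfold Conn at hc
      push Not at hc
      obtain ⟨A, hAS, hA, hne, hd⟩ := hc
      obtain ⟨P, hP⟩ := ih A (hAS.ssubset_of_ne hne)
      obtain ⟨Q, hQ⟩ := ih (S \ A) (Finset.sdiff_ssubset hAS hA)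
      have hPs : ∀ C ∈ P, C ⊆ A := fun C hC => hP.union ▸ Finset.subset_biUnion_of_mem id hC
      have hQs : ∀ C ∈ Q, C ⊆ S \ A := fun C hC => hQ.union ▸ Finset.subset_biUnion_of_mem id hC
      have d1 : ∀ C ∈ P, ∀ C' ∈ Q, Disjoint C C' := fun C hC C' hC' =>
        Finset.disjoint_of_subset_left (hPs C hC)
          (Finset.disjoint_of_subset_right (hQs C' hC') Finset.disjoint_sdiff)
      have d2 : ∀ C ∈ P, ∀ C' ∈ Q, Disjoint (legs e C) (legs e C') := fun C hC C' hC' =>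
        Finset.disjoint_of_subset_left (legs_mono (hPs C hC))
          (Finset.disjoint_of_subset_right (legs_mono (hQs C' hC')) hd)
      refine ⟨P ∪ Q, ?_, ?_, ?_, ?_, ?_⟩
      · intro C hC
        exact (Finset.mem_union.mp hC).elim (hP.nonempty C) (hQ.nonempty C)
      · intro C hC
        exact (Finset.mem_union.mp hC).elim (hP.conn C) (hQ.conn C)
      · intro C hC C' hC' h
        rcases Finset.mem_union.mp hC with hC | hC <;> rcases Finset.mem_union.mp hC' with hC' | hC'
        · exact hP.disj C hC C' hC' h
        · exact d1 C hC C' hC'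
        · exact (d1 C' hC' C hC).symm
        · exact hQ.disj C hC C' hC' h
      · intro C hC C' hC' h
        rcases Finset.mem_union.mp hC with hC | hC <;> rcases Finset.mem_union.mp hC' with hC' | hC'
        · exact hP.sep C hC C' hC' h
        · exact d2 C hC C' hC'
        · exact (d2 C' hC' C hC).symm
        · exact hQ.sep C hC C' hC' h
      · rw [Finset.union_biUnion, hP.union, hQ.union, Finset.union_sdiff_of_subset hAS]

theorem IsSplitting.subset {P : Finset (Finset V)} {S : Finset V} (hP : IsSplitting e P S) :
    ∀ C ∈ P, C ⊆ S := fun _ hC => hP.union ▸ Finset.subset_biUnion_of_mem id hC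

theorem IsSplitting.exists_mem {P : Finset (Finset V)} {S : Finset V} (hP : IsSplitting e P S)
    {v : V} (hv : v ∈ S) : ∃ C ∈ P, v ∈ C := by
  rw [← hP.union] at hv
  simpa using hv

/-- Each part of a splitting of `S \ {u}` has a common edge with `u`, if `S` is connected. -/
theorem IsSplitting.nonempty_inter {P : Finset (Finset V)} {S : Finset V} {u : V} (hu : u ∈ S)
    (hS : Conn e S) (hP : IsSplitting e P (S.erase u)) {C : Finset V} (hC : C ∈ P) :
    (legs e {u} ∩ legs e C).Nonempty := by
  have hCS := hP.subset C hC
  have huC : u ∉ C := fun h => by simpa using hCS h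
  have h := hS C (hCS.trans (Finset.erase_subset _ _)) (hP.nonempty C hC)
    (fun h => huC (h ▸ hu))
  obtain ⟨z, hz, hz'⟩ := Finset.not_disjoint_iff.mp h
  obtain ⟨w, hw, hzw⟩ := WienerIto.mem_legs.mp hz'
  obtain ⟨hwS, hwC⟩ := Finset.mem_sdiff.mp hw
  refine ⟨z, Finset.mem_inter.mpr ⟨?_, hz⟩⟩
  by_cases hwu : w = u
  · subst hwu; rwa [legs_singleton]
  · obtain ⟨C', hC', hwC'⟩ := hP.exists_mem (Finset.mem_erase.mpr ⟨hwu, hwS⟩)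
    exact absurd (WienerIto.mem_legs.mpr ⟨w, hwC', hzw⟩)
      (Finset.disjoint_left.mp (hP.sep C hC C' hC' fun h => hwC (h ▸ hwC')) hz)

theorem IsSplitting.sum_card {P : Finset (Finset V)} {S : Finset V} (hP : IsSplitting e P S) :
    ∑ C ∈ P, C.card = S.card := by
  rw [← hP.union]
  exact (Finset.card_biUnion fun C hC C' hC' h => hP.disj C hC C' hC' h).symm

/-- The bookkeeping of exponents: a part with m vertices has norm at most v^m α^(m-1), so the parts
together give α to the power of the number of vertices minus the number of parts. -/
theorem IsSplitting.sum_card_sub_one {P : Finset (Finset V)} {S : Finset V}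
    (hP : IsSplitting e P S) : ∑ C ∈ P, (C.card - 1) + P.card = S.card := by
  rw [← hP.sum_card, Finset.card_eq_sum_ones, ← Finset.sum_add_distrib]
  refine Finset.sum_congr rfl fun C hC => ?_
  have := (hP.nonempty C hC).card_pos
  omega

theorem dep_vertex (a : (J → K) → ℝ) (v : V) :
    Dep (fun y : E → K => a (y ∘ e v)) (Finset.univ.image (e v)) := by
  intro x y hxy
  have : x ∘ e v = y ∘ e v := by
    ext j; exact hxy _ (Finset.mem_image_of_mem _ (Finset.mem_univ j))
  simp only [this]

theorem dep_prod_vertex (a : (J → K) → ℝ) (S : Finset V) :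
    Dep (fun y : E → K => ∏ v ∈ S, a (y ∘ e v)) (legs e S) :=
  Dep.prod fun v hv => (dep_vertex a v).mono fun _ hz => mem_legs.mpr ⟨v, hv, hz⟩

theorem dep_contr (a : (J → K) → ℝ) (S : Finset V) : Dep (contr e a S) (bdry e S) := by
  refine ((dep_prod_vertex a S).marg (inner e S)).mono fun z hz => ?_
  simp only [inner, bdry, Finset.mem_sdiff, Finset.mem_inter] at hz ⊢
  tauto

section Removal

variable {P : Finset (Finset V)} {S : Finset V} {u : V}

theorem IsSplitting.link_disjoint (hP : IsSplitting e P (S.erase u)) (u' : V) {C C' : Finset V} (hC : C ∈ P)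
    (hC' : C' ∈ P) (h : C ≠ C') :
    Disjoint (legs e {u'} ∩ legs e C) (legs e {u'} ∩ legs e C') :=
  Finset.disjoint_of_subset_left Finset.inter_subset_right
    (Finset.disjoint_of_subset_right Finset.inter_subset_right (hP.sep C hC C' hC' h))

/-- Distinct parts share no edge, so an edge with both ends in `S` either joins `u` to one part or
lies within one part. -/
theorem IsSplitting.inner_eq (he : IsNetwork e) (hu : u ∈ S)
    (hP : IsSplitting e P (S.erase u)) :
    inner e S = (P.biUnion fun C => legs e {u} ∩ legs e C) ∪ P.biUnion (inner e) := by
  ext z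
  obtain ⟨v, w, hvw, h⟩ := he.mem_legs z
  simp only [inner, Finset.mem_sdiff, h, Finset.mem_union, Finset.mem_biUnion, Finset.mem_inter,
    Finset.mem_compl, Finset.mem_singleton]
  constructor
  · rintro ⟨_, h2⟩
    push Not at h2
    obtain ⟨hv, hw⟩ := h2
    by_cases hvu : v = u
    · obtain ⟨C, hC, hwC⟩ := hP.exists_mem
        (Finset.mem_erase.mpr ⟨fun h' => hvw (hvu.trans h'.symm), hw⟩)
      exact Or.inl ⟨C, hC, Or.inl hvu, Or.inr hwC⟩
    · obtain ⟨C, hC, hvC⟩ := hP.exists_mem (Finset.mem_erase.mpr ⟨hvu, hv⟩)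
      by_cases hwu : w = u
      · exact Or.inl ⟨C, hC, Or.inr hwu, Or.inl hvC⟩
      · obtain ⟨C', hC', hwC'⟩ := hP.exists_mem (Finset.mem_erase.mpr ⟨hwu, hw⟩)
        have : C = C' := by
          by_contra hne
          exact Finset.disjoint_left.mp (hP.sep C hC C' hC' hne) ((h C).mpr (Or.inl hvC))
            ((h C').mpr (Or.inr hwC'))
        subst this
        exact Or.inr ⟨C, hC, Or.inl hvC, by tauto⟩
  · have hs : ∀ C ∈ P, ∀ x ∈ C, x ∈ S := fun C hC x hx =>
      Finset.mem_of_mem_erase (hP.subset C hC hx)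
    rintro (⟨C, hC, h1, h2⟩ | ⟨C, hC, h1, h2⟩)
    · have hnu : ∀ x ∈ C, x ≠ u := fun x hx => Finset.ne_of_mem_erase (hP.subset C hC hx)
      rcases h1 with rfl | rfl <;> rcases h2 with h2 | h2
      · exact absurd rfl (hnu _ h2)
      · have := hs C hC _ h2; tauto
      · have := hs C hC _ h2; tauto
      · exact absurd rfl (hnu _ h2)
    · push Not at h2
      have := hs C hC _ h2.1
      have := hs C hC _ h2.2
      tauto

theorem IsSplitting.disjoint_inner (hP : IsSplitting e P (S.erase u)) {C : Finset V} (hC : C ∈ P) :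
    Disjoint (legs e {u}) (inner e C) := by
  rw [Finset.disjoint_left]
  intro z hz hz'
  simp only [inner, Finset.mem_sdiff] at hz'
  refine hz'.2 (legs_mono ?_ hz)
  intro x hx
  rw [Finset.mem_singleton] at hx
  subst hx
  rw [Finset.mem_compl]
  exact fun h => Finset.notMem_erase _ _ (hP.subset C hC h)

/-- The edges inside the parts can be summed first, since neither `u` nor another part meets them;
only the links from `u` to the parts remain. -/
theorem IsSplitting.contr_eq (he : IsNetwork e) (hu : u ∈ S)
    (hP : IsSplitting e P (S.erase u)) (a : (J → K) → ℝ) :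
    contr e a S = marg (P.biUnion fun C => legs e {u} ∩ legs e C)
      fun z => a (z ∘ e u) * ∏ C ∈ P, contr e a C z := by
  rw [contr, hP.inner_eq he hu, marg_union]
  · congr 1
    ext z
    have h1 : ∀ y : E → K, ∏ v ∈ S, a (y ∘ e v) =
        a (y ∘ e u) * ∏ C ∈ P, ∏ v ∈ C, a (y ∘ e v) := by
      intro y
      rw [← Finset.mul_prod_erase S _ hu, ← hP.union, Finset.prod_biUnion]
      · rfl
      · exact fun C hC C' hC' h => hP.disj C hC C' hC' h
    simp only [h1]
    rw [marg_mul_left (dep_vertex a u), marg_prod P (D := inner e) (B := legs e)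
      (h := fun C y => ∏ v ∈ C, a (y ∘ e v))]
    · rfl
    · intro C hC C' hC' h
      exact Finset.disjoint_of_subset_left Finset.sdiff_subset
        (Finset.disjoint_of_subset_right Finset.sdiff_subset (hP.sep C hC C' hC' h))
    · intro C hC C' hC' h
      exact Finset.disjoint_of_subset_right Finset.sdiff_subset (hP.sep C hC C' hC' h)
    · exact fun C _ => dep_prod_vertex a C
    · rw [← legs_singleton, Finset.disjoint_biUnion_right]
      exact fun C hC => hP.disjoint_inner hC
  · rw [Finset.disjoint_biUnion_right]
    intro C hC
    refine Finset.disjoint_of_subset_left ?_ (hP.disjoint_inner hC)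
    exact Finset.biUnion_subset.mpr fun _ _ => Finset.inter_subset_left

theorem IsSplitting.link_subset_bdry (hP : IsSplitting e P (S.erase u)) {C : Finset V} (hC : C ∈ P) :
    legs e {u} ∩ legs e C ⊆ bdry e C := by
  intro z hz
  obtain ⟨h1, h2⟩ := Finset.mem_inter.mp hz
  refine Finset.mem_inter.mpr ⟨h2, legs_mono ?_ h1⟩
  intro x hx
  rw [Finset.mem_singleton] at hx
  subst hx
  rw [Finset.mem_compl]
  exact fun h => Finset.notMem_erase _ _ (hP.subset C hC h)

/-- An open edge of `S` starts either at `u` or in exactly one part; in the second case it is an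
open edge of that part which does not lead to `u`. -/
theorem IsSplitting.bdry_eq (he : IsNetwork e) (hu : u ∈ S)
    (hP : IsSplitting e P (S.erase u)) : bdry e S =
    (P.biUnion fun C => bdry e C \ (legs e {u} ∩ legs e C)) ∪ (legs e {u} ∩ legs e Sᶜ) := by
  have hs : ∀ C ∈ P, ∀ x ∈ C, x ∈ S := fun C hC x hx =>
    Finset.mem_of_mem_erase (hP.subset C hC hx)
  ext z
  obtain ⟨v, w, hvw, h⟩ := he.mem_legs z
  -- Stated for an arbitrary ordering of the two ends, so that it serves whichever end lies in `S`.
  have key : ∀ v w : V, v ∈ S → w ∉ S → (∀ S, z ∈ legs e S ↔ v ∈ S ∨ w ∈ S) →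
      z ∈ (P.biUnion fun C => bdry e C \ (legs e {u} ∩ legs e C)) ∪
        (legs e {u} ∩ legs e Sᶜ) := by
    intro v w hv hw h
    simp only [bdry, Finset.mem_sdiff, h, Finset.mem_union, Finset.mem_biUnion, Finset.mem_inter,
      Finset.mem_compl, Finset.mem_singleton]
    by_cases hvu : v = u
    · tauto
    · obtain ⟨C, hC, hvC⟩ := hP.exists_mem (Finset.mem_erase.mpr ⟨hvu, hv⟩)
      have hwC : w ∉ C := fun h' => hw (hs C hC w h')
      have hwu : w ≠ u := fun h' => hw (h' ▸ hu)
      exact Or.inl ⟨C, hC, by tauto⟩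
  constructor
  · intro hz
    rw [bdry, Finset.mem_inter, h, h, Finset.mem_compl, Finset.mem_compl] at hz
    by_cases hv : v ∈ S
    · exact key v w hv (by tauto) h
    · exact key w v (by tauto) hv fun S => by rw [h, or_comm]
  · simp only [bdry, Finset.mem_sdiff, h, Finset.mem_union, Finset.mem_biUnion, Finset.mem_inter,
      Finset.mem_compl, Finset.mem_singleton]
    rintro (⟨C, hC, ⟨h1, h2⟩, h3⟩ | ⟨rfl | rfl, h2⟩)
    · have sep : ¬ (v ∈ S ∧ w ∈ S) := by
        rintro ⟨hv, hw⟩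
        have hvu : v ≠ u := by rintro rfl; tauto
        have hwu : w ≠ u := by rintro rfl; tauto
        obtain ⟨C1, hC1, hv1⟩ := hP.exists_mem (Finset.mem_erase.mpr ⟨hvu, hv⟩)
        obtain ⟨C2, hC2, hw2⟩ := hP.exists_mem (Finset.mem_erase.mpr ⟨hwu, hw⟩)
        have hm1 := (h C1).mpr (Or.inl hv1)
        have hm2 := (h C2).mpr (Or.inr hw2)
        have hm := (h C).mpr h1
        have e1 : C = C1 := by
          by_contra hne
          exact Finset.disjoint_left.mp (hP.sep C hC C1 hC1 hne) hm hm1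
        have e2 : C = C2 := by
          by_contra hne
          exact Finset.disjoint_left.mp (hP.sep C hC C2 hC2 hne) hm hm2
        subst e1
        rw [← e2] at hw2
        tauto
      have hv := hs C hC v
      have hw := hs C hC w
      tauto
    · tauto
    · tauto

end Removal

end Network

end WienerIto

/-! ### Bounds for contracted networks. -/

namespace WienerIto

section NetworkBound

variable {V E J K : Type*} [Fintype V] [DecidableEq V] [Fintype E] [DecidableEq E] [Fintype J]
  [DecidableEq J] [Fintype K] [DecidableEq K] {e : V → J → E} {a : (J → K) → ℝ} {v α : ℝ}

set_option linter.unusedSectionVars false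

theorem prod_sqrt_le {P : Finset (Finset V)} {S : Finset V} (hP : IsSplitting e P S)
    (hv : 0 ≤ v) (hα : 0 ≤ α) {n : Finset V → ℝ}
    (hn : ∀ C ∈ P, n C ≤ (v ^ C.card * α ^ (C.card - 1)) ^ 2) :
    ∏ C ∈ P, √(n C) ≤ v ^ S.card * α ^ (S.card - P.card) := by
  calc ∏ C ∈ P, √(n C) ≤ ∏ C ∈ P, v ^ C.card * α ^ (C.card - 1) := by
        refine Finset.prod_le_prod (fun _ _ => Real.sqrt_nonneg _) fun C hC => ?_
        exact Real.sqrt_le_iff.mpr ⟨by positivity, hn C hC⟩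
    _ = v ^ S.card * α ^ (S.card - P.card) := by
        rw [Finset.prod_mul_distrib, Finset.prod_pow_eq_pow_sum, Finset.prod_pow_eq_pow_sum,
          hP.sum_card, ← hP.sum_card_sub_one, Nat.add_sub_cancel]

set_option maxHeartbeats 1000000 in
/-- The bound for a part of a network with at least one open edge. -/
theorem marg_contr_sq_le (he : IsNetwork e) (ha : TensorBound a v α) (hv : 0 ≤ v) (hα : 0 ≤ α)
    (S : Finset V) (hS : S.Nonempty) (hc : Conn e S) (hb : (bdry e S).Nonempty) (y : E → K) :
    marg (bdry e S) (fun z => contr e a S z ^ 2) y ≤ (v ^ S.card * α ^ (S.card - 1)) ^ 2 := by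
  induction S using Finset.strongInduction generalizing y with
  | H S ih =>
  obtain ⟨z, hz⟩ := hb
  -- The removed vertex carries an open edge, so that its open legs form a non-empty block.
  obtain ⟨u, hu, hzu⟩ := mem_legs.mp (Finset.mem_inter.mp hz).1
  obtain ⟨P, hP⟩ := exists_isSplitting e (S.erase u)
  set O := legs e {u} ∩ legs e Sᶜ with hO
  set A : Finset V → Finset E := fun C => legs e {u} ∩ legs e C with hA
  have hPS : ∀ C ∈ P, C ⊆ S := fun C hC => (hP.subset C hC).trans (Finset.erase_subset _ _)
  have hON : O.Nonempty :=
    ⟨z, Finset.mem_inter.mpr ⟨by rwa [legs_singleton], (Finset.mem_inter.mp hz).2⟩⟩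
  -- The set `Sᶜ` serves as the label of the block `O` of open legs at `u`. The legs of `u` are thus
  -- split into `P.card + 1` blocks, which gives the power α^|P|.
  have hSP : Sᶜ ∉ P := by
    intro h
    obtain ⟨x, hx⟩ := hP.nonempty _ h
    exact (Finset.mem_compl.mp hx) (hPS _ h hx)
  have hSc : ∀ C ⊆ S, Disjoint C Sᶜ := fun C hC =>
    Finset.disjoint_left.mpr fun x hx hx' => Finset.mem_compl.mp hx' (hC hx)
  have hdisjVert : ∀ C ∈ insert Sᶜ P, ∀ C' ∈ insert Sᶜ P, C ≠ C' → Disjoint C C' := by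
    intro C hC C' hC' h
    rcases Finset.mem_insert.mp hC with rfl | hC <;> rcases Finset.mem_insert.mp hC' with rfl | hC'
    · exact absurd rfl h
    · exact (hSc C' (hPS _ hC')).symm
    · exact hSc C (hPS _ hC)
    · exact hP.disj C hC C' hC' h
  have huC : ∀ C ∈ insert Sᶜ P, u ∉ C := by
    intro C hC
    rcases Finset.mem_insert.mp hC with rfl | hC
    · simpa using hu
    · exact fun h => Finset.notMem_erase _ _ (hP.subset C hC h)
  have hAdisj : ∀ C ∈ insert Sᶜ P, ∀ C' ∈ insert Sᶜ P, C ≠ C' → Disjoint (A C) (A C') := by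
    intro C hC C' hC' h
    rw [Finset.disjoint_left]
    intro x hx hx'
    obtain ⟨p, q, hpq, hx2⟩ := he.mem_legs x
    have h1 := huC C hC
    have h2 := huC C' hC'
    have h3 := Finset.disjoint_left.mp (hdisjVert C hC C' hC' h)
    simp only [hA, Finset.mem_inter, hx2, Finset.mem_singleton] at hx hx'
    rcases hx.1 with rfl | rfl
    · exact h3 (hx.2.resolve_left h1) (hx'.2.resolve_left h2)
    · exact h3 (hx.2.resolve_right h1) (hx'.2.resolve_right h2)
  have hAu : (insert Sᶜ P).biUnion A = Finset.univ.image (e u) := by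
    ext x
    obtain ⟨p, q, hpq, hx2⟩ := he.mem_legs x
    rw [← legs_singleton]
    simp only [Finset.mem_biUnion, hA, Finset.mem_inter]
    constructor
    · rintro ⟨_, _, h, _⟩; exact h
    · intro hx
      have hcov : ∀ w, w ≠ u → ∃ C ∈ insert Sᶜ P, w ∈ C := by
        intro w hw
        by_cases hwS : w ∈ S
        · obtain ⟨C, hC, hwC⟩ := hP.exists_mem (Finset.mem_erase.mpr ⟨hw, hwS⟩)
          exact ⟨C, Finset.mem_insert_of_mem hC, hwC⟩
        · exact ⟨Sᶜ, Finset.mem_insert_self _ _, Finset.mem_compl.mpr hwS⟩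
      have hx' := hx
      simp only [hx2, Finset.mem_singleton] at hx'
      rcases hx' with rfl | rfl
      · obtain ⟨C, hC, hw⟩ := hcov q hpq.symm
        exact ⟨C, hC, hx, (hx2 C).mpr (Or.inr hw)⟩
      · obtain ⟨C, hC, hw⟩ := hcov p hpq
        exact ⟨C, hC, hx, (hx2 C).mpr (Or.inl hw)⟩
  have hbc : bdry e S = bdry e Sᶜ := by
    rw [bdry, bdry, compl_compl, Finset.inter_comm]
  set Φ := contr e a S with hΦ
  have hOA : Disjoint O (P.biUnion A) := by
    rw [Finset.disjoint_biUnion_right]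
    exact fun C hC => hAdisj _ (Finset.mem_insert_self _ _) C (Finset.mem_insert_of_mem hC)
      fun h => hSP (h ▸ hC)
  have hbA : Disjoint (bdry e S) (P.biUnion A) := by
    refine Finset.disjoint_of_subset_right (u := inner e S) ?_ ?_
    · rw [hP.inner_eq he hu]; exact Finset.subset_union_left
    · rw [Finset.disjoint_left]
      intro x hx hx'
      exact (Finset.mem_sdiff.mp hx').2 (Finset.mem_inter.mp hx).2
  have hΦd : Dep Φ (bdry e S) := dep_contr a S
  -- the estimate for fixed values of the open edges that do not meet `u`
  have step : ∀ y : E → K, marg O (fun z => Φ z ^ 2) y ≤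
      (v * α ^ P.card) ^ 2 * ∏ C ∈ P, marg (A C) (fun z => contr e a C z ^ 2) y := by
    intro y
    -- Duality: the contraction `Φ` itself is the test function on the block `O`, and the contracted
    -- parts are the test functions on the other blocks. The left side of the tensor bound becomes
    -- the squared norm of `Φ` over `O`, the right side contains this norm once, and it cancels.
    set h : Finset V → (E → K) → ℝ := fun C => if C = Sᶜ then Φ else contr e a C with hh
    have hP' : ∀ C ∈ P, h C = contr e a C := fun C hC => by
      simp only [hh]; rw [if_neg]; rintro rfl; exact hSP hC
    have h0 : h Sᶜ = Φ := if_pos rfl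
    have key := ha.marg_le (he.inj u) (insert Sᶜ P) (D := A) (B := fun C => bdry e C) (h := h)
      ?_ hAdisj hAu ?_ ?_ y
    · rw [Finset.card_insert_of_notMem hSP, Nat.add_sub_cancel, Finset.prod_insert hSP, h0] at key
      have e1 : marg (Finset.univ.image (e u))
          (fun z => a (z ∘ e u) * ∏ C ∈ insert Sᶜ P, h C z) y = marg O (fun z => Φ z ^ 2) y := by
        rw [← hAu, Finset.biUnion_insert, marg_union (s := A Sᶜ) hOA]
        refine marg_congr _ fun z _ => ?_
        have : ∀ z, a (z ∘ e u) * ∏ C ∈ insert Sᶜ P, h C z =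
            Φ z * (a (z ∘ e u) * ∏ C ∈ P, contr e a C z) := by
          intro z
          rw [Finset.prod_insert hSP, h0,
            Finset.prod_congr rfl fun C hC => congrFun (hP' C hC) z]
          ring
        simp only [this]
        rw [marg_mul_left hΦd hbA, sq]
        congr 1
        rw [hΦ, hP.contr_eq he hu]
      rw [e1] at key
      have e2 : ∏ C ∈ P, √(marg (A C) (fun z => h C z ^ 2) y) =
          ∏ C ∈ P, √(marg (A C) (fun z => contr e a C z ^ 2) y) :=
        Finset.prod_congr rfl fun C hC => by rw [hP' C hC]
      rw [e2] at key
      have n1 : 0 ≤ marg O (fun z => Φ z ^ 2) y := marg_nonneg (fun _ => sq_nonneg _) y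
      rw [abs_of_nonneg n1] at key
      set t := √(marg O (fun z => Φ z ^ 2) y) with ht
      set X := ∏ C ∈ P, √(marg (A C) (fun z => contr e a C z ^ 2) y) with hX
      have hX2 : X ^ 2 = ∏ C ∈ P, marg (A C) (fun z => contr e a C z ^ 2) y := by
        rw [hX, ← Finset.prod_pow]
        exact Finset.prod_congr rfl fun C _ => Real.sq_sqrt (marg_nonneg (fun _ => sq_nonneg _) y)
      have ht2 : marg O (fun z => Φ z ^ 2) y = t ^ 2 := (Real.sq_sqrt n1).symm
      rw [ht2] at key ⊢
      rw [← hX2, ← mul_pow]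
      have ht0 : 0 ≤ t := Real.sqrt_nonneg _
      have hX0 : 0 ≤ X := Finset.prod_nonneg fun _ _ => Real.sqrt_nonneg _
      rcases ht0.eq_or_lt with h0 | hpos
      · rw [← h0, zero_pow two_ne_zero]; exact sq_nonneg _
      · refine pow_le_pow_left₀ ht0 ?_ 2
        have : t * t ≤ t * (v * α ^ P.card * X) := by
          calc t * t = t ^ 2 := (sq t).symm
            _ ≤ _ := key
            _ = _ := by ring
        exact le_of_mul_le_mul_left this hpos
    · intro C hC
      rcases Finset.mem_insert.mp hC with rfl | hC
      · exact hON
      · exact hP.nonempty_inter hu hc hC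
    · intro C hC
      rcases Finset.mem_insert.mp hC with rfl | hC
      · rw [h0, ← hbc]; exact hΦd
      · rw [hP' C hC]; exact dep_contr a C
    · intro C _ x hx
      rw [← legs_singleton] at hx
      simp only [Finset.mem_inter, bdry, hA] at hx ⊢
      tauto
  -- The open edges not at `u` are distributed among the parts. Summing over them extends the norms
  -- over `A C` to norms over all of `bdry e C`, to which the induction hypothesis applies.
  set R : Finset V → Finset E := fun C => bdry e C \ A C with hR
  have hRO : Disjoint (P.biUnion R) O := by
    rw [Finset.disjoint_left]
    intro x hx hxO
    obtain ⟨C, hC, hxC⟩ := Finset.mem_biUnion.mp hx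
    refine (Finset.mem_sdiff.mp hxC).2 (Finset.mem_inter.mpr ⟨(Finset.mem_inter.mp hxO).1, ?_⟩)
    exact (Finset.mem_inter.mp (Finset.mem_sdiff.mp hxC).1).1
  have hRsub : ∀ C, R C ⊆ legs e C := fun C =>
    Finset.sdiff_subset.trans Finset.inter_subset_left
  have hcard : P.card ≤ (S.erase u).card := by
    rw [← hP.sum_card_sub_one]; omega
  have hcS : (S.erase u).card + 1 = S.card := Finset.card_erase_add_one hu
  rw [hP.bdry_eq he hu, marg_union hRO]
  calc marg (P.biUnion R) (marg O fun z => Φ z ^ 2) y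
      ≤ marg (P.biUnion R) (fun y => (v * α ^ P.card) ^ 2 *
          ∏ C ∈ P, marg (A C) (fun z => contr e a C z ^ 2) y) y := marg_mono step y
    _ = (v * α ^ P.card) ^ 2 * ∏ C ∈ P, marg (bdry e C) (fun z => contr e a C z ^ 2) y := by
        rw [marg_const_mul, marg_prod P (D := R) (B := R)
          (h := fun C => marg (A C) (fun z => contr e a C z ^ 2))]
        · congr 1
          refine Finset.prod_congr rfl fun C hC => ?_
          rw [← marg_union Finset.sdiff_disjoint,
            Finset.sdiff_union_of_subset (hP.link_subset_bdry hC)]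
        · intro C hC C' hC' h
          exact Finset.disjoint_of_subset_left (hRsub C)
            (Finset.disjoint_of_subset_right (hRsub C') (hP.sep C hC C' hC' h))
        · intro C hC C' hC' h
          exact Finset.disjoint_of_subset_left (hRsub C)
            (Finset.disjoint_of_subset_right (hRsub C') (hP.sep C hC C' hC' h))
        · exact fun C _ => ((dep_contr a C).pow 2).marg _
    _ = (v * α ^ P.card * ∏ C ∈ P, √(marg (bdry e C) (fun z => contr e a C z ^ 2) y)) ^ 2 := by
        rw [mul_pow _ (∏ C ∈ P, _), ← Finset.prod_pow]
        congr 1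
        exact Finset.prod_congr rfl fun C _ =>
          (Real.sq_sqrt (marg_nonneg (fun _ => sq_nonneg _) y)).symm
    _ ≤ (v * α ^ P.card * (v ^ (S.erase u).card * α ^ ((S.erase u).card - P.card))) ^ 2 := by
        have hprod := prod_sqrt_le hP hv hα
          (n := fun C => marg (bdry e C) (fun z => contr e a C z ^ 2) y) fun C hC => by
            refine ih C ?_ (hP.nonempty C hC) (hP.conn C hC) ?_ y
            · exact Finset.ssubset_of_subset_of_ssubset (hP.subset C hC)
                (Finset.erase_ssubset hu)
            · exact (hP.nonempty_inter hu hc hC).mono (hP.link_subset_bdry hC)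
        gcongr
    _ = (v ^ S.card * α ^ (S.card - 1)) ^ 2 := by
        rw [← hcS, Nat.add_sub_cancel]
        congr 1
        rw [mul_mul_mul_comm, ← pow_succ', ← pow_add]
        congr 2
        omega

/-- The bound for a closed component of a network. -/
theorem abs_contr_le (he : IsNetwork e) (ha : TensorBound a v α) (hv : 0 ≤ v) (hα : 0 ≤ α)
    (S : Finset V) (hS : 2 ≤ S.card) (hc : Conn e S) (hb : bdry e S = ∅) (y : E → K) :
    |contr e a S y| ≤ v ^ S.card * α ^ (S.card - 2) := by
  obtain ⟨u, hu⟩ := Finset.card_pos.mp (by omega : 0 < S.card)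
  obtain ⟨P, hP⟩ := exists_isSplitting e (S.erase u)
  have hcS : (S.erase u).card + 1 = S.card := Finset.card_erase_add_one hu
  have hcard : P.card ≤ (S.erase u).card := by
    rw [← hP.sum_card_sub_one]; omega
  have hPpos : 0 < P.card := by
    rw [Finset.card_pos]
    obtain ⟨w, hw⟩ := Finset.card_pos.mp (by omega : 0 < (S.erase u).card)
    obtain ⟨C, hC, _⟩ := hP.exists_mem hw
    exact ⟨C, hC⟩
  have hb' := hP.bdry_eq he hu
  rw [hb, eq_comm, Finset.union_eq_empty] at hb'
  have hbA : ∀ C ∈ P, bdry e C = legs e {u} ∩ legs e C := by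
    intro C hC
    refine Finset.Subset.antisymm ?_ (hP.link_subset_bdry hC)
    rw [← Finset.sdiff_eq_empty_iff_subset, ← Finset.subset_empty, ← hb'.1]
    exact Finset.subset_biUnion_of_mem (fun C => bdry e C \ (legs e {u} ∩ legs e C)) hC
  have hPu : P.biUnion (fun C => legs e {u} ∩ legs e C) = Finset.univ.image (e u) := by
    rw [← legs_singleton]
    refine Finset.Subset.antisymm (Finset.biUnion_subset.mpr fun _ _ =>
      Finset.inter_subset_left) fun x hx => ?_
    obtain ⟨p, q, hpq, hx2⟩ := he.mem_legs x
    have hxS : x ∉ legs e Sᶜ := fun h => by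
      have : x ∈ legs e {u} ∩ legs e Sᶜ := Finset.mem_inter.mpr ⟨hx, h⟩
      rw [hb'.2] at this
      simp at this
    rw [hx2] at hxS
    simp only [Finset.mem_compl, not_or, not_not] at hxS
    simp only [Finset.mem_biUnion, Finset.mem_inter]
    have hx' := hx
    simp only [hx2, Finset.mem_singleton] at hx'
    rcases hx' with rfl | rfl
    · obtain ⟨C, hC, hw⟩ := hP.exists_mem (Finset.mem_erase.mpr ⟨hpq.symm, hxS.2⟩)
      exact ⟨C, hC, hx, (hx2 C).mpr (Or.inr hw)⟩
    · obtain ⟨C, hC, hw⟩ := hP.exists_mem (Finset.mem_erase.mpr ⟨hpq, hxS.1⟩)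
      exact ⟨C, hC, hx, (hx2 C).mpr (Or.inl hw)⟩
  -- Without open edges the legs of `u` have only `P.card` blocks. The exponent of α is therefore
  -- (|P| - 1) + (|S| - 1 - |P|) = |S| - 2, one less than for an open part.
  have key := ha.marg_le (he.inj u) P (D := fun C => legs e {u} ∩ legs e C)
    (B := fun C => bdry e C) (h := fun C => contr e a C)
    (fun C hC => hP.nonempty_inter hu hc hC)
    (fun C hC C' hC' h => hP.link_disjoint u hC hC' h) hPu (fun C _ => dep_contr a C)
    (fun C hC => by rw [hbA C hC]; exact Finset.inter_subset_left) y
  rw [hP.contr_eq he hu, hPu]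
  refine key.trans ?_
  have hprod := prod_sqrt_le hP hv hα
    (n := fun C => marg (legs e {u} ∩ legs e C) (fun z => contr e a C z ^ 2) y) fun C hC => by
      have hn := hP.nonempty_inter hu hc hC
      rw [← hbA C hC] at hn ⊢
      exact marg_contr_sq_le he ha hv hα C (hP.nonempty C hC) (hP.conn C hC) hn y
  calc _ ≤ v * α ^ (P.card - 1) * (v ^ (S.erase u).card * α ^ ((S.erase u).card - P.card)) := by
        gcongr
    _ = _ := by
        rw [mul_mul_mul_comm, ← pow_succ', ← pow_add, hcS]
        congr 2
        omega

/-- The bound for a closed network that splits into the connected components in `P`. -/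
theorem abs_sum_prod_le (he : IsNetwork e) (ha : TensorBound a v α) (hv : 0 ≤ v) (hα : 0 < α)
    {P : Finset (Finset V)} (hP : IsSplitting e P Finset.univ) (h2 : ∀ C ∈ P, 2 ≤ C.card) :
    |∑ y : E → K, ∏ w, a (y ∘ e w)| ≤
      v ^ Fintype.card V * α ^ Fintype.card V * ((α ^ 2)⁻¹) ^ P.card := by
  rcases isEmpty_or_nonempty (E → K) with hE | ⟨⟨y⟩⟩
  · simp only [Finset.univ_eq_empty, Finset.sum_empty, abs_zero]; positivity
  have hb : ∀ C ∈ P, bdry e C = ∅ := by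
    intro C hC
    rw [Finset.eq_empty_iff_forall_notMem]
    intro x hx
    obtain ⟨h1, h2⟩ := Finset.mem_inter.mp hx
    obtain ⟨w, hw, hxw⟩ := mem_legs.mp h2
    obtain ⟨C', hC', hwC'⟩ := hP.exists_mem (Finset.mem_univ w)
    refine Finset.disjoint_left.mp (hP.sep C hC C' hC' ?_) h1 (mem_legs.mpr ⟨w, hwC', hxw⟩)
    rintro rfl
    exact Finset.mem_compl.mp hw hwC'
  have hin : ∀ C ∈ P, inner e C = legs e C := by
    intro C hC
    rw [inner, Finset.sdiff_eq_self_iff_disjoint, Finset.disjoint_iff_inter_eq_empty]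
    exact hb C hC
  have hu : P.biUnion (inner e) = Finset.univ := by
    rw [Finset.eq_univ_iff_forall]
    intro x
    obtain ⟨p, q, hpq, hx2⟩ := he.mem_legs x
    obtain ⟨C, hC, hw⟩ := hP.exists_mem (Finset.mem_univ p)
    exact Finset.mem_biUnion.mpr ⟨C, hC, by rw [hin C hC, hx2]; exact Or.inl hw⟩
  have e1 : ∑ y : E → K, ∏ w, a (y ∘ e w) = ∏ C ∈ P, contr e a C y := by
    rw [← marg_univ _ y, ← hu]
    have : ∀ z : E → K, ∏ w, a (z ∘ e w) = ∏ C ∈ P, ∏ w ∈ C, a (z ∘ e w) := by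
      intro z
      rw [← hP.union, Finset.prod_biUnion]
      · rfl
      · exact fun C hC C' hC' h => hP.disj C hC C' hC' h
    simp only [this]
    rw [marg_prod P (D := inner e) (B := legs e) (h := fun C y => ∏ v ∈ C, a (y ∘ e v))]
    · rfl
    · intro C hC C' hC' h
      rw [hin C hC, hin C' hC']; exact hP.sep C hC C' hC' h
    · intro C hC C' hC' h
      rw [hin C' hC']; exact hP.sep C hC C' hC' h
    · exact fun C _ => dep_prod_vertex a C
  rw [e1, Finset.abs_prod]
  calc ∏ C ∈ P, |contr e a C y| ≤ ∏ C ∈ P, v ^ C.card * (α ^ C.card * (α ^ 2)⁻¹) := by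
        refine Finset.prod_le_prod (fun _ _ => abs_nonneg _) fun C hC => ?_
        refine (abs_contr_le he ha hv hα.le C (h2 C hC) (hP.conn C hC) (hb C hC) y).trans_eq ?_
        -- Writing α^(n-2) as α^n α^(-2) leaves a dependence on the number of components only.
        rw [pow_sub₀ _ hα.ne' (h2 C hC)]
    _ = _ := by
        rw [Finset.prod_mul_distrib, Finset.prod_mul_distrib, Finset.prod_pow_eq_pow_sum,
          Finset.prod_pow_eq_pow_sum, hP.sum_card, Finset.prod_const, Finset.card_univ, mul_assoc]

end NetworkBound

end WienerIto

/-! ### Wick's formula and the exploration of diagrams. -/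

namespace WienerIto

/-- The moments of the standard normal distribution. -/
def gaussMoment : ℕ → ℝ
  | 0 => 1
  | 1 => 0
  | n + 2 => (n + 1) * gaussMoment n

section Diagrams

variable {V J K : Type*} [Fintype V] [DecidableEq V] [Fintype J] [DecidableEq J] [Fintype K]
  [DecidableEq K]

set_option linter.unusedSectionVars false

/-- The expectation of `∏ p ∈ U, ξ (x p)` for independent standard normal variables `ξ`. -/
def wick {L : Type*} (U : Finset L) (x : L → K) : ℝ :=
  ∏ i, gaussMoment (U.filter fun p => x p = i).card

theorem wick_empty {L : Type*} (x : L → K) : wick ∅ x = 1 := by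
  simp [wick, gaussMoment]

/-- The recursion m_n = (n-1) m_(n-2) for normal moments, applied at the value `x p`: the n - 1
other legs with this value are the possible partners of `p`. -/
theorem wick_eq_sum {L : Type*} [DecidableEq L] {U : Finset L} {p : L} (hp : p ∈ U) (x : L → K) :
    wick U x = ∑ q ∈ U.erase p, if x p = x q then wick ((U.erase p).erase q) x else 0 := by
  set c : K → ℕ := fun i => (U.filter fun q => x q = i).card with hc
  have hother : ∀ q ∈ U.erase p, x p = x q → wick ((U.erase p).erase q) x =
      gaussMoment (c (x p) - 2) * ∏ i ∈ Finset.univ.erase (x p), gaussMoment (c i) := by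
    intro q hq hpq
    rw [wick, ← Finset.mul_prod_erase _ _ (Finset.mem_univ (x p))]
    congr 1
    · congr 1
      rw [Finset.filter_erase, Finset.filter_erase, Finset.card_erase_of_mem,
        Finset.card_erase_of_mem]
      · rfl
      · simp [hp]
      · rw [Finset.mem_erase] at hq
        simp [hq, hpq]
    · refine Finset.prod_congr rfl fun i hi => ?_
      have hi' := Finset.ne_of_mem_erase hi
      rw [Finset.filter_erase, Finset.filter_erase, Finset.erase_eq_of_notMem,
        Finset.erase_eq_of_notMem]
      · simp [hi'.symm]
      · simp [← hpq, hi'.symm]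
  have hcard : ((U.erase p).filter fun q => x p = x q).card = c (x p) - 1 := by
    rw [Finset.filter_erase, Finset.card_erase_of_mem (by simp [hp])]
    simp only [hc, eq_comm]
  rw [← Finset.sum_filter, Finset.sum_congr rfl fun q hq =>
    hother q (Finset.mem_filter.mp hq).1 (Finset.mem_filter.mp hq).2,
    Finset.sum_const, hcard, wick, ← Finset.mul_prod_erase _ _ (Finset.mem_univ (x p)),
    nsmul_eq_mul, ← mul_assoc]
  congr 1
  have hpos : 0 < c (x p) := Finset.card_pos.mpr ⟨p, by simp [hp]⟩
  change gaussMoment (c (x p)) = _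
  match c (x p), hpos with
  | 1, _ => simp [gaussMoment]
  | n + 2, _ => simp [gaussMoment]

/-- The sum over the indices of the legs of a product of tensors, with the pairs in `M`
contracted, and with normal variables at the legs in `U`. -/
def diagSum (a : (J → K) → ℝ) (M : Finset ((V × J) × (V × J))) (U : Finset (V × J)) : ℝ :=
  ∑ x : V × J → K, (∏ v, a fun j => x (v, j)) *
    ((if ∀ b ∈ M, x b.1 = x b.2 then 1 else 0) * wick U x)

/-- One step in generating all pairings: the leg `p` chooses its partner. The freedom to choose `p`
lets the exploration follow the current component. -/
theorem diagSum_eq_sum (a : (J → K) → ℝ) (M : Finset ((V × J) × (V × J)))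
    {U : Finset (V × J)} {p : V × J} (hp : p ∈ U) :
    diagSum a M U = ∑ q ∈ U.erase p, diagSum a (insert (p, q) M) ((U.erase p).erase q) := by
  simp only [diagSum]
  rw [Finset.sum_comm]
  refine Finset.sum_congr rfl fun x _ => ?_
  rw [wick_eq_sum hp, Finset.mul_sum, Finset.mul_sum]
  refine Finset.sum_congr rfl fun q _ => ?_
  congr 1
  simp only [Finset.forall_mem_insert]
  by_cases h1 : x p = x q <;> by_cases h2 : ∀ b ∈ M, x b.1 = x b.2 <;> simp [h1]

/-- A pair within one row forces two equal indices in one copy of `a`, which vanishes on the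
diagonals. -/
theorem diagSum_eq_zero {a : (J → K) → ℝ} (ha : ∀ i, ¬ Function.Injective i → a i = 0)
    {M : Finset ((V × J) × (V × J))} {U : Finset (V × J)} {p q : V × J} (hM : (p, q) ∈ M)
    (hpq : p ≠ q) (hrow : p.1 = q.1) : diagSum a M U = 0 := by
  refine Finset.sum_eq_zero fun x _ => ?_
  by_cases h : ∀ b ∈ M, x b.1 = x b.2
  · rw [Finset.prod_eq_zero (Finset.mem_univ p.1), zero_mul]
    refine ha _ fun hinj => hpq (Prod.ext hrow (hinj ?_))
    have hq : (p.1, q.2) = q := Prod.ext hrow rfl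
    change x p = x (p.1, q.2)
    rw [hq]
    exact h _ hM
  · rw [if_neg h, zero_mul, mul_zero]

/-- The set `C` of rows is connected by the pairs in `M`. -/
def PairConn (M : Finset ((V × J) × (V × J))) (C : Finset V) : Prop :=
  ∀ A ⊆ C, A.Nonempty → A ≠ C → ∃ b ∈ M, (b.1.1 ∈ A ∧ b.2.1 ∈ C \ A) ∨ (b.2.1 ∈ A ∧ b.1.1 ∈ C \ A)

theorem PairConn.mono {M M' : Finset ((V × J) × (V × J))} (h : M ⊆ M') {C : Finset V}
    (hC : PairConn M C) : PairConn M' C := fun A hA hn hne =>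
  let ⟨b, hb, hb'⟩ := hC A hA hn hne
  ⟨b, h hb, hb'⟩

theorem pairConn_singleton (M : Finset ((V × J) × (V × J))) (r : V) : PairConn M {r} := by
  intro A hA hn hne
  exact absurd ((Finset.Nonempty.subset_singleton_iff hn).mp hA) hne

/-- A cut of the enlarged set either cuts `C`, where an old pair crosses it, or separates `q.1` from
`C`, where the new pair crosses it. -/
theorem PairConn.insert {M : Finset ((V × J) × (V × J))} {C : Finset V} (hC : PairConn M C)
    {p q : V × J} (hp : p.1 ∈ C) : PairConn (insert (p, q) M) (insert q.1 C) := by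
  intro A hA hn hne
  by_cases hAC : A ∩ C = C ∨ A ∩ C = ∅
  · refine ⟨(p, q), Finset.mem_insert_self _ _, ?_⟩
    rcases hAC with h | h
    · have hCA : C ⊆ A := Finset.inter_eq_right.mp h
      have : q.1 ∉ A := fun h' => hne (hA.antisymm (Finset.insert_subset h' hCA))
      exact Or.inl ⟨hCA hp, by simp [this]⟩
    · have hnC : ∀ x ∈ A, x ∉ C := fun x hx hx' => by
        have : x ∈ A ∩ C := Finset.mem_inter.mpr ⟨hx, hx'⟩
        simp [h] at this
      obtain ⟨x, hx⟩ := hn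
      have hxq : x = q.1 := (Finset.mem_insert.mp (hA hx)).resolve_right (hnC x hx)
      subst hxq
      exact Or.inr ⟨hx, by simp [hp]; exact fun h' => hnC _ h' hp⟩
  · push Not at hAC
    obtain ⟨b, hb, h⟩ := hC (A ∩ C) Finset.inter_subset_right hAC.2 hAC.1
    refine ⟨b, Finset.mem_insert_of_mem hb, ?_⟩
    simp only [Finset.mem_inter, Finset.mem_sdiff, Finset.mem_insert] at h ⊢
    tauto

/-- A state of the exploration of a diagram: the legs outside of `U` are paired by `M`, the closed
components are in `Q`, the current component is `C`, and the rows in `R` are not yet visited. -/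
structure Explored (M : Finset ((V × J) × (V × J))) (U : Finset (V × J)) (Q : Finset (Finset V))
    (C R : Finset V) : Prop where
  paired : ∀ p ∉ U, ∃ b ∈ M, p = b.1 ∨ p = b.2
  uniq : ∀ b ∈ M, ∀ b' ∈ M, ∀ p, (p = b.1 ∨ p = b.2) → (p = b'.1 ∨ p = b'.2) → b = b'
  ne : ∀ b ∈ M, b.1 ≠ b.2
  used : ∀ b ∈ M, b.1 ∉ U ∧ b.2 ∉ U
  unvisited : ∀ p : V × J, p.1 ∈ R → p ∈ U
  mem_or : ∀ p ∈ U, p.1 ∈ C ∨ p.1 ∈ R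
  cover : ∀ v, v ∈ R ∨ v ∈ C ∨ ∃ D ∈ Q, v ∈ D
  disjCR : Disjoint C R
  disjQ : ∀ D ∈ Q, Disjoint D C ∧ Disjoint D R
  pairwiseQ : ∀ D ∈ Q, ∀ D' ∈ Q, D ≠ D' → Disjoint D D'
  inside : ∀ b ∈ M, (b.1.1 ∈ C ∧ b.2.1 ∈ C) ∨ ∃ D ∈ Q, b.1.1 ∈ D ∧ b.2.1 ∈ D
  conn : PairConn M C
  connQ : ∀ D ∈ Q, PairConn M D
  two_le : ∀ D ∈ Q, 2 ≤ D.card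

variable {M : Finset ((V × J) × (V × J))} {U : Finset (V × J)} {Q : Finset (Finset V)}
  {C R : Finset V}

/-- The unpaired legs are those of the current component together with all legs of the unvisited
rows. -/
theorem Explored.card_eq (h : Explored M U Q C R) :
    U.card = (U.filter fun p => p.1 ∈ C).card + R.card * Fintype.card J := by
  rw [← Finset.card_filter_add_card_filter_not (s := U) (fun p => p.1 ∈ C)]
  congr 1
  rw [← Finset.card_univ, ← Finset.card_product]
  congr 1
  ext p
  simp only [Finset.mem_filter, Finset.mem_product, Finset.mem_univ, and_true]
  constructor
  · rintro ⟨h1, h2⟩; exact (h.mem_or p h1).resolve_left h2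
  · intro hp
    exact ⟨h.unvisited p hp, fun hC => Finset.disjoint_left.mp h.disjCR hC hp⟩

theorem Explored.close (h : Explored M U Q C R) (h2 : 2 ≤ C.card) (hC : ∀ p ∈ U, p.1 ∉ C) :
    Explored M U (insert C Q) ∅ R where
  paired := h.paired
  uniq := h.uniq
  ne := h.ne
  used := h.used
  unvisited := h.unvisited
  mem_or p hp := Or.inr ((h.mem_or p hp).resolve_left (hC p hp))
  cover v := by
    rcases h.cover v with h' | h' | ⟨D, hD, hv⟩
    · exact Or.inl h'
    · exact Or.inr (Or.inr ⟨C, Finset.mem_insert_self _ _, h'⟩)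
    · exact Or.inr (Or.inr ⟨D, Finset.mem_insert_of_mem hD, hv⟩)
  disjCR := Finset.disjoint_empty_left _
  disjQ D hD := by
    refine ⟨Finset.disjoint_empty_right _, ?_⟩
    rcases Finset.mem_insert.mp hD with rfl | hD
    · exact h.disjCR
    · exact (h.disjQ D hD).2
  pairwiseQ D hD D' hD' hne := by
    rcases Finset.mem_insert.mp hD with rfl | hD <;> rcases Finset.mem_insert.mp hD' with rfl | hD'
    · exact absurd rfl hne
    · exact (h.disjQ D' hD').1.symm
    · exact (h.disjQ D ‹_›).1
    · exact h.pairwiseQ D hD D' hD' hne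
  inside b hb := by
    rcases h.inside b hb with h' | ⟨D, hD, h'⟩
    · exact Or.inr ⟨C, Finset.mem_insert_self _ _, h'⟩
    · exact Or.inr ⟨D, Finset.mem_insert_of_mem hD, h'⟩
  conn A hA hn _ := absurd (Finset.subset_empty.mp hA) hn.ne_empty
  connQ D hD := by
    rcases Finset.mem_insert.mp hD with rfl | hD
    · exact h.conn
    · exact h.connQ D hD
  two_le D hD := by
    rcases Finset.mem_insert.mp hD with rfl | hD
    · exact h2
    · exact h.two_le D hD

theorem Explored.start (h : Explored M U Q ∅ R) {r : V} (hr : r ∈ R) :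
    Explored M U Q {r} (R.erase r) where
  paired := h.paired
  uniq := h.uniq
  ne := h.ne
  used := h.used
  unvisited p hp := h.unvisited p (Finset.mem_of_mem_erase hp)
  mem_or p hp := by
    have := (h.mem_or p hp).resolve_left (by simp)
    simp only [Finset.mem_singleton, Finset.mem_erase]; tauto
  cover v := by
    have := h.cover v
    simp only [Finset.mem_singleton, Finset.mem_erase, Finset.notMem_empty, false_or] at this ⊢
    tauto
  disjCR := by simp
  disjQ D hD := by
    refine ⟨?_, Finset.disjoint_of_subset_right (Finset.erase_subset _ _) (h.disjQ D hD).2⟩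
    rw [Finset.disjoint_singleton_right]
    exact fun h' => Finset.disjoint_left.mp (h.disjQ D hD).2 h' hr
  pairwiseQ := h.pairwiseQ
  inside b hb := Or.inr ((h.inside b hb).resolve_left (by simp))
  conn := pairConn_singleton M r
  connQ := h.connQ
  two_le := h.two_le

/-- A step of the exploration: the leg `p` of the current component is paired with `q`. -/
theorem Explored.pair (h : Explored M U Q C R) {p q : V × J} (hp : p ∈ U) (hpC : p.1 ∈ C)
    (hq : q ∈ U.erase p) {C' R' : Finset V} (hC' : C' = insert q.1 C) (hR' : R' = R.erase q.1) :
    Explored (insert (p, q) M) ((U.erase p).erase q) Q C' R' where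
  paired s hs := by
    by_cases hsU : s ∈ U
    · refine ⟨(p, q), Finset.mem_insert_self _ _, ?_⟩
      simp only [Finset.mem_erase] at hs
      tauto
    · obtain ⟨b, hb, h'⟩ := h.paired s hsU
      exact ⟨b, Finset.mem_insert_of_mem hb, h'⟩
  uniq b hb b' hb' s hs hs' := by
    have hqU := Finset.mem_of_mem_erase hq
    rcases Finset.mem_insert.mp hb with rfl | hb <;> rcases Finset.mem_insert.mp hb' with rfl | hb'
    · rfl
    · have := h.used b' hb'
      rcases hs with rfl | rfl <;> rcases hs' with rfl | rfl <;> tauto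
    · have := h.used b hb
      rcases hs with rfl | rfl <;> rcases hs' with rfl | rfl <;> tauto
    · exact h.uniq b hb b' hb' s hs hs'
  ne b hb := by
    rcases Finset.mem_insert.mp hb with rfl | hb
    · exact (Finset.ne_of_mem_erase hq).symm
    · exact h.ne b hb
  used b hb := by
    rcases Finset.mem_insert.mp hb with rfl | hb
    · simp
    · have := h.used b hb
      simp only [Finset.mem_erase]; tauto
  unvisited s hs := by
    subst hR'
    obtain ⟨h1, h2⟩ := Finset.mem_erase.mp hs
    refine Finset.mem_erase.mpr ⟨?_, Finset.mem_erase.mpr ⟨?_, h.unvisited s h2⟩⟩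
    · rintro rfl; exact h1 rfl
    · rintro rfl; exact Finset.disjoint_left.mp h.disjCR hpC h2
  mem_or s hs := by
    subst hC' hR'
    have := h.mem_or s (Finset.mem_of_mem_erase (Finset.mem_of_mem_erase hs))
    simp only [Finset.mem_insert, Finset.mem_erase]; tauto
  cover v := by
    subst hC' hR'
    have := h.cover v
    simp only [Finset.mem_insert, Finset.mem_erase]; tauto
  disjCR := by
    subst hC' hR'
    rw [Finset.disjoint_left]
    intro x hx hx'
    rw [Finset.mem_erase] at hx'
    exact Finset.disjoint_left.mp h.disjCR ((Finset.mem_insert.mp hx).resolve_left hx'.1) hx'.2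
  disjQ D hD := by
    subst hC' hR'
    obtain ⟨h1, h2⟩ := h.disjQ D hD
    refine ⟨?_, Finset.disjoint_of_subset_right (Finset.erase_subset _ _) h2⟩
    rw [Finset.disjoint_insert_right]
    refine ⟨fun hqD => ?_, h1⟩
    rcases h.mem_or q (Finset.mem_of_mem_erase hq) with h' | h'
    · exact Finset.disjoint_left.mp h1 hqD h'
    · exact Finset.disjoint_left.mp h2 hqD h'
  pairwiseQ := h.pairwiseQ
  inside b hb := by
    subst hC'
    rcases Finset.mem_insert.mp hb with rfl | hb
    · exact Or.inl ⟨Finset.mem_insert_of_mem hpC, Finset.mem_insert_self _ _⟩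
    · have := h.inside b hb
      simp only [Finset.mem_insert]; tauto
  conn := by
    subst hC'
    by_cases hqC : q.1 ∈ C
    · rw [Finset.insert_eq_of_mem hqC]
      exact h.conn.mono (Finset.subset_insert _ _)
    · exact h.conn.insert hpC
  connQ D hD := (h.connQ D hD).mono (Finset.subset_insert _ _)
  two_le := h.two_le

/-- The value of a closed diagram. -/
theorem Explored.abs_diagSum_le {a : (J → K) → ℝ} (ha0 : ∀ i, ¬ Function.Injective i → a i = 0)
    {v α : ℝ} (ha : TensorBound a v α) (hv : 0 ≤ v) (hα : 0 < α)
    (h : Explored M (∅ : Finset (V × J)) Q ∅ ∅) :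
    |diagSum a M ∅| ≤ v ^ Fintype.card V * α ^ Fintype.card V * ((α ^ 2)⁻¹) ^ Q.card := by
  by_cases hloop : ∃ b ∈ M, b.1.1 = b.2.1
  · obtain ⟨b, hb, hrow⟩ := hloop
    rw [diagSum_eq_zero ha0 (p := b.1) (q := b.2) hb (h.ne b hb) hrow, abs_zero]
    positivity
  push Not at hloop
  have hex : ∀ p : V × J, ∃ b : M, p = b.1.1 ∨ p = b.1.2 := fun p =>
    let ⟨b, hb, h'⟩ := h.paired p (by simp)
    ⟨⟨b, hb⟩, h'⟩
  choose ε hε using hex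
  have hεu : ∀ (p : V × J) (b : M), (p = b.1.1 ∨ p = b.1.2) → ε p = b := fun p b hb =>
    Subtype.ext (h.uniq _ (ε p).2 _ b.2 p (hε p) hb)
  -- The network of the diagram: its edges are the pairs, and each leg is sent to the pair
  -- containing it. The absence of pairs within a row makes `e u` injective.
  set e : V → J → M := fun u j => ε (u, j) with he
  have hmem : ∀ u (b : M), b ∈ Finset.univ.image (e u) ↔ u = b.1.1.1 ∨ u = b.1.2.1 := by
    intro u b
    simp only [Finset.mem_image, Finset.mem_univ, true_and, he]
    constructor
    · rintro ⟨j, rfl⟩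
      exact (hε (u, j)).imp (fun h => by rw [← h]) (fun h => by rw [← h])
    · rintro (rfl | rfl)
      · exact ⟨b.1.1.2, hεu _ b (Or.inl rfl)⟩
      · exact ⟨b.1.2.2, hεu _ b (Or.inr rfl)⟩
  have hnet : IsNetwork e :=
    { inj := by
        intro u j j' hjj
        have h1 := hε (u, j)
        have h2 := hε (u, j')
        simp only [he] at hjj
        rw [← hjj] at h2
        have h3 := hloop _ (ε (u, j)).2
        rcases h1 with h1 | h1 <;> rcases h2 with h2 | h2
        · exact congrArg Prod.snd (h1.trans h2.symm)
        · exact absurd (by rw [← h1, ← h2]) h3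
        · exact absurd (by rw [← h1, ← h2]) h3
        · exact congrArg Prod.snd (h1.trans h2.symm)
      ends := fun b => ⟨b.1.1.1, b.1.2.1, hloop _ b.2, fun u => hmem u b⟩ }
  have hsum : diagSum a M ∅ = ∑ y : M → K, ∏ w, a (y ∘ e w) := by
    simp only [diagSum, wick_empty, mul_one, mul_ite, mul_zero]
    rw [← Finset.sum_filter]
    -- Assignments of indices to legs that agree on every pair correspond to assignments of indices
    -- to edges.
    refine Finset.sum_bij' (fun x _ b => x b.1.1) (fun y _ p => y (ε p)) ?_ ?_ ?_ ?_ ?_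
    · intro x _; simp
    · intro y _
      simp only [Finset.mem_filter, Finset.mem_univ, true_and]
      intro b hb
      rw [hεu b.1 ⟨b, hb⟩ (Or.inl rfl), hεu b.2 ⟨b, hb⟩ (Or.inr rfl)]
    · intro x hx
      simp only [Finset.mem_filter, Finset.mem_univ, true_and] at hx
      ext p
      change x (ε p).1.1 = x p
      rcases hε p with h1 | h1
      · rw [← h1]
      · rw [hx _ (ε p).2, ← h1]
    · intro y _
      ext b
      exact congrArg y (hεu b.1.1 b (Or.inl rfl))
    · intro x hx
      simp only [Finset.mem_filter, Finset.mem_univ, true_and] at hx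
      refine Finset.prod_congr rfl fun w _ => congrArg a ?_
      ext j
      simp only [Function.comp, he]
      rcases hε (w, j) with h1 | h1
      · rw [← h1]
      · rw [hx _ (ε (w, j)).2, ← h1]
  rw [hsum]
  refine abs_sum_prod_le hnet ha hv hα (P := Q) ⟨?_, ?_, h.pairwiseQ, ?_, ?_⟩ h.two_le
  · exact fun D hD => Finset.card_pos.mp (lt_of_lt_of_le two_pos (h.two_le D hD))
  · intro D hD A hA hn hne
    obtain ⟨b, hb, h'⟩ := h.connQ D hD A hA hn hne
    refine Finset.not_disjoint_iff.mpr ⟨⟨b, hb⟩, ?_, ?_⟩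
    · rcases h' with h' | h'
      · exact mem_legs.mpr ⟨_, h'.1, (hmem _ _).mpr (Or.inl rfl)⟩
      · exact mem_legs.mpr ⟨_, h'.1, (hmem _ _).mpr (Or.inr rfl)⟩
    · rcases h' with h' | h'
      · exact mem_legs.mpr ⟨_, h'.2, (hmem _ _).mpr (Or.inr rfl)⟩
      · exact mem_legs.mpr ⟨_, h'.2, (hmem _ _).mpr (Or.inl rfl)⟩
  · intro D hD D' hD' hne
    rw [Finset.disjoint_left]
    intro b hb hb'
    obtain ⟨u, hu, hbu⟩ := mem_legs.mp hb
    obtain ⟨u', hu', hbu'⟩ := mem_legs.mp hb'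
    rw [hmem] at hbu hbu'
    obtain ⟨B, hB, h1, h2⟩ := (h.inside b.1 b.2).resolve_left (by simp)
    have huB : u ∈ B := by rcases hbu with rfl | rfl <;> assumption
    have huB' : u' ∈ B := by rcases hbu' with rfl | rfl <;> assumption
    have e1 : D = B := by
      by_contra hn; exact Finset.disjoint_left.mp (h.pairwiseQ D hD B hB hn) hu huB
    have e2 : D' = B := by
      by_contra hn; exact Finset.disjoint_left.mp (h.pairwiseQ D' hD' B hB hn) hu' huB'
    exact hne (e1.trans e2.symm)
  · rw [Finset.eq_univ_iff_forall]
    intro u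
    have := h.cover u
    simp only [Finset.notMem_empty, false_or] at this
    simpa using this

end Diagrams

end WienerIto

/-! ### Weighted counting of the pairings. -/

namespace WienerIto

section Exploration

set_option linter.unusedSectionVars false

variable {V J K : Type*} [Fintype V] [DecidableEq V] [Fintype J] [DecidableEq J] [Fintype K]
  [DecidableEq K] {M : Finset ((V × J) × (V × J))} {U : Finset (V × J)} {Q : Finset (Finset V)}
  {C R : Finset V}

theorem Explored.card_filter_not_mem (h : Explored M U Q C R) (p : V × J) :
    ((U.erase p).filter fun q => q.1 ∉ C).card ≤ R.card * Fintype.card J := by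
  rw [← Finset.card_univ, ← Finset.card_product]
  refine Finset.card_le_card fun q hq => ?_
  obtain ⟨h1, h2⟩ := Finset.mem_filter.mp hq
  exact Finset.mem_product.mpr
    ⟨(h.mem_or q (Finset.mem_of_mem_erase h1)).resolve_left h2, Finset.mem_univ _⟩

theorem Explored.mem_of_not_mem (h : Explored M U Q C R) {p q : V × J} (hq : q ∈ U.erase p)
    (hqC : q.1 ∉ C) : q.1 ∈ R :=
  (h.mem_or q (Finset.mem_of_mem_erase hq)).resolve_left hqC

theorem card_erase_erase {p q : V × J} (hp : p ∈ U) (hq : q ∈ U.erase p) :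
    ((U.erase p).erase q).card + 2 = U.card := by
  rw [← Finset.card_erase_add_one hp, ← Finset.card_erase_add_one hq]

theorem abs_sum_filter_le {L : Type*} (S : Finset L) (p : L → Prop) [DecidablePred p] (f : L → ℝ)
    {n : ℕ} {b : ℝ} (hb : 0 ≤ b) (hn : (S.filter p).card ≤ n)
    (hf : ∀ q ∈ S, p q → |f q| ≤ b) : |∑ q ∈ S.filter p, f q| ≤ n * b := by
  calc |∑ q ∈ S.filter p, f q| ≤ ∑ q ∈ S.filter p, |f q| := Finset.abs_sum_le_sum_abs _ _
    _ ≤ (S.filter p).card • b := Finset.sum_le_card_nsmul _ _ _ fun q hq =>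
        hf q (Finset.mem_filter.mp hq).1 (Finset.mem_filter.mp hq).2
    _ ≤ n * b := by rw [nsmul_eq_mul]; gcongr

/-- The number of pairings, weighted by a factor `(α ^ 2)⁻¹` for each component, is controlled by
a function `B` of the number `u` of open legs in the current component and the number `m` of
unvisited rows. -/
theorem abs_diagSum_univ_le [Nonempty J] {a : (J → K) → ℝ}
    (ha0 : ∀ i, ¬ Function.Injective i → a i = 0)
    {v α : ℝ} (ha : TensorBound a v α) (hv : 0 ≤ v) (hα : 0 < α) (B : ℕ → ℕ → ℝ)
    (hB : ∀ u m, 0 ≤ B u m)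
    (hstep : ∀ u m, 1 ≤ u → u + m * Fintype.card J ≤ Fintype.card V * Fintype.card J →
      ((u - 1 : ℕ) : ℝ) * B (u - 2) m +
        ((m * Fintype.card J : ℕ) : ℝ) * B (u + Fintype.card J - 2) (m - 1) ≤ B u m)
    (hzero : (α ^ 2)⁻¹ ≤ B 0 0)
    (hrestart : ∀ m, 1 ≤ m → m ≤ Fintype.card V →
      (α ^ 2)⁻¹ * ((((m - 1) * Fintype.card J : ℕ) : ℝ) * B (2 * Fintype.card J - 2) (m - 2)) ≤
        B 0 m)
    (hV : 1 ≤ Fintype.card V) :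
    |diagSum a (∅ : Finset ((V × J) × (V × J))) Finset.univ| ≤
      v ^ Fintype.card V * α ^ Fintype.card V *
      ((((Fintype.card V - 1) * Fintype.card J : ℕ) : ℝ) *
        B (2 * Fintype.card J - 2) (Fintype.card V - 2)) := by
  set k := Fintype.card J with hk
  have hk1 : 1 ≤ k := Fintype.card_pos
  set X := v ^ Fintype.card V * α ^ Fintype.card V with hX
  have hX0 : 0 ≤ X := by positivity
  set θ := (α ^ 2)⁻¹ with hθ
  have hθ0 : 0 ≤ θ := by positivity
  -- The bound between two components, with `m` unvisited rows. A new component starts with a leg of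
  -- a fresh row; its partner is one of the (m-1)k legs of the other rows, and then two rows with 2k
  -- - 2 open legs are current.
  set Z : ℕ → ℝ := fun m => if m = 0 then 1 else
    (((m - 1) * k : ℕ) : ℝ) * B (2 * k - 2) (m - 2) with hZ
  have hcardle : ∀ U : Finset (V × J), U.card ≤ Fintype.card V * k := fun U => by
    rw [hk, ← Fintype.card_prod]; exact Finset.card_le_univ U
  -- Strong induction on the number of unpaired legs, simultaneously for the states between
  -- components and for those inside a component with at least two rows.
  have main : ∀ n : ℕ,
      (∀ (M : Finset ((V × J) × (V × J))) (U : Finset (V × J)) (Q : Finset (Finset V))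
        (R : Finset V), Explored M U Q ∅ R → U.card = n →
          |diagSum a M U| ≤ X * θ ^ Q.card * Z R.card) ∧
      (∀ (M : Finset ((V × J) × (V × J))) (U : Finset (V × J)) (Q : Finset (Finset V))
        (C R : Finset V) (u : ℕ), Explored M U Q C R → 2 ≤ C.card → U.card = n →
          U.card = u + R.card * k → |diagSum a M U| ≤ X * θ ^ Q.card * B u R.card) := by
    intro n
    induction n using Nat.strong_induction_on with
    | _ n ih =>
    have hA : ∀ (M : Finset ((V × J) × (V × J))) (U : Finset (V × J)) (Q : Finset (Finset V))
        (R : Finset V), Explored M U Q ∅ R → U.card = n →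
          |diagSum a M U| ≤ X * θ ^ Q.card * Z R.card := by
      intro M U Q R h hU
      have hcard := h.card_eq
      simp only [Finset.notMem_empty, Finset.filter_false, Finset.card_empty, zero_add] at hcard
      rcases R.eq_empty_or_nonempty with rfl | ⟨r, hr⟩
      · have : U = ∅ := by simpa using hcard
        subst this
        simpa only [hZ, Finset.card_empty, if_true, mul_one] using h.abs_diagSum_le ha0 ha hv hα
      · have hs := h.start hr
        have hm : 1 ≤ R.card := Finset.card_pos.mpr ⟨r, hr⟩
        let p : V × J := (r, Classical.arbitrary J)
        have hpC : p.1 ∈ ({r} : Finset V) := Finset.mem_singleton_self r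
        have hp : p ∈ U := h.unvisited p hr
        have hRc : (R.erase r).card = R.card - 1 := Finset.card_erase_of_mem hr
        rw [diagSum_eq_sum a M hp,
          ← Finset.sum_filter_add_sum_filter_not (U.erase p) (fun q => q.1 ∉ ({r} : Finset V))]
        have hz : ∑ q ∈ (U.erase p).filter (fun q => ¬ q.1 ∉ ({r} : Finset V)),
            diagSum a (insert (p, q) M) ((U.erase p).erase q) = 0 := by
          refine Finset.sum_eq_zero fun q hq => ?_
          obtain ⟨h1, h2⟩ := Finset.mem_filter.mp hq
          rw [not_not, Finset.mem_singleton] at h2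
          exact diagSum_eq_zero ha0 (p := p) (q := q) (Finset.mem_insert_self _ _)
            (Finset.ne_of_mem_erase h1).symm h2.symm
        rw [hz, add_zero]
        have hb := abs_sum_filter_le (U.erase p) (fun q => q.1 ∉ ({r} : Finset V))
          (fun q => diagSum a (insert (p, q) M) ((U.erase p).erase q))
          (n := (R.card - 1) * k) (b := X * θ ^ Q.card * B (2 * k - 2) (R.card - 2))
          (by have := hB (2 * k - 2) (R.card - 2); positivity)
          ((hs.card_filter_not_mem p).trans_eq (by rw [hRc])) ?_
        · refine hb.trans_eq ?_
          simp only [hZ]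
          rw [if_neg (by omega)]
          ring
        · intro q hq hqC
          have hqR := hs.mem_of_not_mem hq hqC
          have hst := hs.pair hp hpC hq rfl rfl
          have hcu := card_erase_erase hp hq
          have hR2 : ((R.erase r).erase q.1).card = R.card - 2 := by
            rw [Finset.card_erase_of_mem hqR, hRc]; omega
          have hR2' : 2 ≤ R.card := by
            have := Finset.card_pos.mpr ⟨_, hqR⟩
            omega
          have := (ih _ (by omega)).2 _ _ _ _ _ (2 * k - 2) hst
            (by rw [Finset.card_insert_of_notMem hqC, Finset.card_singleton]) rfl ?_
          · rwa [hR2] at this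
          · rw [hR2]
            obtain ⟨m, hm'⟩ := Nat.exists_eq_add_of_le hR2'
            rw [hm'] at hcard ⊢
            rw [Nat.add_sub_cancel_left]
            rw [← hk] at hcard
            have : (2 + m) * k = 2 * k + m * k := by ring
            omega
    refine ⟨hA, ?_⟩
    intro M U Q C R u h hC2 hU hu
    have hcard := h.card_eq
    have hfu : (U.filter fun p => p.1 ∈ C).card = u := by
      rw [← hk] at hcard; omega
    rcases Nat.eq_zero_or_pos u with rfl | hupos
    · have hno : ∀ p ∈ U, p.1 ∉ C := by
        intro p hp hpC
        rw [Finset.card_eq_zero] at hfu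
        exact Finset.notMem_empty p (hfu ▸ Finset.mem_filter.mpr ⟨hp, hpC⟩)
      have hCQ : C ∉ Q := by
        intro hCQ
        have := (h.disjQ C hCQ).1
        rw [disjoint_self] at this
        rw [this] at hC2
        simp at hC2
      -- No open leg is left, so the component is closed: `Q` gains one element at the cost of a
      -- factor θ, and no leg is consumed.
      have := hA _ _ _ _ (h.close hC2 hno) hU
      rw [Finset.card_insert_of_notMem hCQ, pow_succ] at this
      refine this.trans ?_
      rw [← mul_assoc, mul_assoc _ θ]
      refine mul_le_mul_of_nonneg_left ?_ (by positivity)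
      rcases Nat.eq_zero_or_pos R.card with h0 | h0
      · simpa [hZ, h0] using hzero
      · simp only [hZ]
        rw [if_neg (by omega)]
        exact hrestart R.card h0 (Finset.card_le_univ R)
    · obtain ⟨p, hpf⟩ := Finset.card_pos.mp (hfu ▸ hupos)
      obtain ⟨hp, hpC⟩ := Finset.mem_filter.mp hpf
      have hst := hstep u R.card hupos (hu ▸ hcardle U)
      -- The partner of the open leg `p` is either one of the u - 1 other open legs, leaving u - 2,
      -- or one of the m k legs of unvisited rows, whose row then contributes its other k - 1 legs,
      -- giving u + k - 2.
      rw [diagSum_eq_sum a M hp,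
        ← Finset.sum_filter_add_sum_filter_not (U.erase p) (fun q => q.1 ∈ C)]
      have hb1 := abs_sum_filter_le (U.erase p) (fun q => q.1 ∈ C)
        (fun q => diagSum a (insert (p, q) M) ((U.erase p).erase q))
        (n := u - 1) (b := X * θ ^ Q.card * B (u - 2) R.card)
        (by have := hB (u - 2) R.card; positivity)
        (by rw [Finset.filter_erase, Finset.card_erase_of_mem hpf, hfu]) (by
          intro q hq hqC
          have hcu := card_erase_erase hp hq
          have hu2 : 2 ≤ u := by
            rw [← hfu]
            have : ({p, q} : Finset (V × J)) ⊆ U.filter fun p => p.1 ∈ C := by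
              intro s hs
              rcases Finset.mem_insert.mp hs with rfl | hs
              · exact hpf
              · rw [Finset.mem_singleton] at hs
                subst hs
                exact Finset.mem_filter.mpr ⟨Finset.mem_of_mem_erase hq, hqC⟩
            refine le_trans ?_ (Finset.card_le_card this)
            rw [Finset.card_pair (Finset.ne_of_mem_erase hq).symm]
          refine (ih _ (by omega)).2 _ _ _ C R _ (h.pair hp hpC hq
            (Finset.insert_eq_of_mem hqC).symm (Finset.erase_eq_of_notMem ?_).symm) hC2 rfl
            (by omega)
          exact fun h' => Finset.disjoint_left.mp h.disjCR hqC h')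
      have hb2 := abs_sum_filter_le (U.erase p) (fun q => q.1 ∉ C)
        (fun q => diagSum a (insert (p, q) M) ((U.erase p).erase q))
        (n := R.card * k) (b := X * θ ^ Q.card * B (u + k - 2) (R.card - 1))
        (by have := hB (u + k - 2) (R.card - 1); positivity)
        (h.card_filter_not_mem p) (by
          intro q hq hqC
          have hcu := card_erase_erase hp hq
          have hqR := h.mem_of_not_mem hq hqC
          have hR1 := Finset.card_erase_of_mem hqR
          have hR0 := Finset.card_pos.mpr ⟨_, hqR⟩
          have := (ih _ (by omega)).2 _ _ _ _ _ (u + k - 2) (h.pair hp hpC hq rfl rfl)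
            (by rw [Finset.card_insert_of_notMem hqC]; omega) rfl ?_
          · rwa [hR1] at this
          · rw [hR1]
            obtain ⟨m, hm'⟩ := Nat.exists_eq_add_of_le hR0
            rw [hm'] at hu ⊢
            rw [Nat.add_sub_cancel_left]
            have : (0 + 1 + m) * k = k + m * k := by ring
            have h' : (Nat.succ 0 + m) * k = k + m * k := this
            omega)
      calc _ ≤ _ := abs_add_le _ _
        _ ≤ _ := add_le_add hb1 hb2
        _ = X * θ ^ Q.card * (((u - 1 : ℕ) : ℝ) * B (u - 2) R.card +
            ((R.card * k : ℕ) : ℝ) * B (u + k - 2) (R.card - 1)) := by ring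
        _ ≤ _ := mul_le_mul_of_nonneg_left hst (by positivity)
  have hinit : Explored (∅ : Finset ((V × J) × (V × J))) Finset.univ ∅ ∅ Finset.univ :=
    { paired := by simp
      uniq := by simp
      ne := by simp
      used := by simp
      unvisited := by simp
      mem_or := by simp
      cover := by simp
      disjCR := by simp
      disjQ := by simp
      pairwiseQ := by simp
      inside := by simp
      conn := fun A hA hn _ => absurd (Finset.subset_empty.mp hA) hn.ne_empty
      connQ := by simp
      two_le := by simp }
  have := (main _).1 _ _ _ _ hinit rfl
  simp only [hZ, Finset.card_empty, pow_zero, mul_one, Finset.card_univ] at this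
  rwa [if_neg (by omega)] at this

end Exploration

/-! ### A weight that solves the recursive inequalities. -/

noncomputable section Weights

/-- The number `t ^ (2 (k - 1) + k m) c ^ m 2 ^ u √(u!)`. -/
def weight (k : ℕ) (t c : ℝ) (u m : ℕ) : ℝ :=
  t ^ (2 * (k - 1) + k * m) * c ^ m * (2 ^ u * √(u ! : ℝ))

theorem weight_nonneg (k : ℕ) {t c : ℝ} (ht : 0 ≤ t) (hc : 0 ≤ c) (u m : ℕ) :
    0 ≤ weight k t c u m := by unfold weight; positivity

theorem sqrt_factorial_add_le {u n N : ℕ} (h : u + n ≤ N) :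
    √((u + n)! : ℝ) ≤ √(u ! : ℝ) * √(N : ℝ) ^ n := by
  have h1 : (u + n)! ≤ u ! * N ^ n := by
    rw [← Nat.factorial_mul_ascFactorial]
    exact Nat.mul_le_mul_left _ ((Nat.ascFactorial_le_pow_add u n).trans
      (Nat.pow_le_pow_left h n))
  calc √((u + n)! : ℝ) ≤ √((u ! : ℝ) * (N : ℝ) ^ n) := Real.sqrt_le_sqrt (by exact_mod_cast h1)
    _ = √(u ! : ℝ) * √(N : ℝ) ^ n := by
      rw [Real.sqrt_mul (by positivity)]
      congr 1
      rw [Real.sqrt_eq_iff_mul_self_eq (by positivity) (by positivity), ← mul_pow,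
        Real.mul_self_sqrt (by positivity)]

variable {k T : ℕ}

/-- The factor √(u!) absorbs the number of partners, since (n+1) √(n!) ≤ √((n+2)!), and 2^u supplies
the factor 1/2 that leaves room for the other kind of step. -/
theorem weight_pair_le {t c : ℝ} (ht : 0 ≤ t) (hc : 0 ≤ c) (u m : ℕ) :
    ((u - 1 : ℕ) : ℝ) * weight k t c (u - 2) m ≤ weight k t c u m / 2 := by
  have h0 := weight_nonneg k ht hc u m
  match u with
  | 0 => simpa using div_nonneg h0 zero_le_two
  | 1 => simpa using div_nonneg h0 zero_le_two
  | n + 2 =>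
    have h1 : ((n : ℝ) + 1) * √(n ! : ℝ) ≤ √((n + 2)! : ℝ) := by
      refine Real.le_sqrt_of_sq_le ?_
      rw [mul_pow, Real.sq_sqrt (by positivity), Nat.factorial_succ, Nat.factorial_succ]
      push_cast
      have : (0 : ℝ) ≤ n ! := by positivity
      nlinarith [mul_nonneg (by positivity : (0 : ℝ) ≤ n + 1) this]
    simp only [weight, Nat.add_sub_cancel, show n + 2 - 1 = n + 1 by omega]
    push_cast
    have h2 : (0 : ℝ) ≤ t ^ (2 * (k - 1) + k * m) * c ^ m * 2 ^ n := by positivity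
    calc ((n : ℝ) + 1) * (t ^ (2 * (k - 1) + k * m) * c ^ m * (2 ^ n * √(n ! : ℝ)))
        = t ^ (2 * (k - 1) + k * m) * c ^ m * 2 ^ n * ((n + 1) * √(n ! : ℝ)) := by ring
      _ ≤ t ^ (2 * (k - 1) + k * m) * c ^ m * 2 ^ n * √((n + 2)! : ℝ) := by gcongr
      _ ≤ t ^ (2 * (k - 1) + k * m) * c ^ m * 2 ^ n * √((n + 2)! : ℝ) * 2 := by
        have : 0 ≤ √((n + 2)! : ℝ) := Real.sqrt_nonneg _
        nlinarith [mul_nonneg h2 this]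
      _ = _ := by ring

theorem sqrt_mul_le (hk : 1 ≤ k) : √((T * k : ℕ) : ℝ) ≤ √(T : ℝ) * k := by
  push_cast
  rw [Real.sqrt_mul (by positivity)]
  gcongr
  rw [Real.sqrt_le_left (by positivity)]
  have : (1 : ℝ) ≤ k := by exact_mod_cast hk
  nlinarith

/-- Visiting a row costs m ≤ T = t² for the choice of the row and about t^(k-2) for the growth of
√(u!). This is the factor t^k that the weight provides per unvisited row; constants depending on k
go into c. -/
theorem weight_grow_le (hk : 2 ≤ k) {u m : ℕ} (h : u + m * k ≤ T * k) :
    ((m * k : ℕ) : ℝ) * weight k √(T : ℝ) ((4 * k) ^ (2 * k)) (u + k - 2) (m - 1) ≤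
      weight k √(T : ℝ) ((4 * k) ^ (2 * k)) u m / 2 := by
  set t := √(T : ℝ) with ht
  set c : ℝ := (4 * k) ^ (2 * k) with hc
  have ht0 : 0 ≤ t := Real.sqrt_nonneg _
  have hc0 : 0 ≤ c := by positivity
  have hk1 : (1 : ℝ) ≤ k := by exact_mod_cast (by omega : 1 ≤ k)
  obtain ⟨j, rfl⟩ := Nat.exists_eq_add_of_le hk
  match m with
  | 0 => simpa using div_nonneg (weight_nonneg (2 + j) ht0 hc0 u 0) zero_le_two
  | m + 1 =>
    have hmT : m + 1 ≤ T := by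
      by_contra hlt
      have : (T + 1) * (2 + j) ≤ (m + 1) * (2 + j) := Nat.mul_le_mul_right _ (by omega)
      have : (T + 1) * (2 + j) = T * (2 + j) + (2 + j) := by ring
      omega
    have huj : u + j ≤ T * (2 + j) := by
      have : (m + 1) * (2 + j) = m * (2 + j) + (2 + j) := by ring
      have := Nat.zero_le (m * (2 + j))
      omega
    have h1 : √((u + j)! : ℝ) ≤ √(u ! : ℝ) * (t * ((2 + j : ℕ) : ℝ)) ^ j :=
      (sqrt_factorial_add_le huj).trans (by
        gcongr
        exact sqrt_mul_le (by omega))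
    have h2 : ((m + 1 : ℕ) : ℝ) ≤ t ^ 2 := by
      rw [ht, Real.sq_sqrt (by positivity)]; exact_mod_cast hmT
    have h3 : (2 * ((2 + j : ℕ) : ℝ)) ^ (j + 1) ≤ c := by
      rw [hc]
      calc (2 * ((2 + j : ℕ) : ℝ)) ^ (j + 1) ≤ (4 * ((2 + j : ℕ) : ℝ)) ^ (j + 1) := by
            gcongr; norm_num
        _ ≤ _ := pow_le_pow_right₀ (by linarith) (by omega)
    simp only [weight, Nat.add_sub_cancel, show u + (2 + j) - 2 = u + j by omega]
    set k' : ℝ := ((2 + j : ℕ) : ℝ) with hk'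
    set e := 2 * (2 + j - 1) + (2 + j) * m with he
    have he' : 2 * (2 + j - 1) + (2 + j) * (m + 1) = e + (2 + j) := by rw [he]; ring
    rw [he', Nat.cast_mul, ← hk']
    calc ((m + 1 : ℕ) : ℝ) * k' * (t ^ e * c ^ m * (2 ^ (u + j) * √((u + j)! : ℝ)))
        ≤ t ^ 2 * k' * (t ^ e * c ^ m * (2 ^ (u + j) * (√(u ! : ℝ) * (t * k') ^ j))) := by
          gcongr
      _ = t ^ (e + (2 + j)) * c ^ m * (2 ^ u * √(u ! : ℝ)) * (2 * k') ^ (j + 1) / 2 := by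
          rw [mul_pow, mul_pow]; ring
      _ ≤ t ^ (e + (2 + j)) * c ^ m * (2 ^ u * √(u ! : ℝ)) * c / 2 := by gcongr
      _ = _ := by ring

/-- Starting a component turns t² · t^(2(k-1)) into t^(2k), the share of the two rows that have
become current. The term t^(2(k-1)) in the weight is what later pays for closing the component. -/
theorem weight_restart_le (hk : 2 ≤ k) {m : ℕ} (h : m + 1 ≤ T) :
    (((m + 1) * k : ℕ) : ℝ) * weight k √(T : ℝ) ((4 * k) ^ (2 * k)) (2 * k - 2) m ≤
      √(T : ℝ) ^ (k * (m + 2)) * ((4 * k) ^ (2 * k)) ^ (m + 2) := by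
  set t := √(T : ℝ) with ht
  set c : ℝ := (4 * k) ^ (2 * k) with hc
  have ht0 : 0 ≤ t := Real.sqrt_nonneg _
  have hc0 : 0 ≤ c := by positivity
  have hk1 : (1 : ℝ) ≤ k := by exact_mod_cast (by omega : 1 ≤ k)
  have h2 : ((m + 1 : ℕ) : ℝ) ≤ t ^ 2 := by
    rw [ht, Real.sq_sqrt (by positivity)]; exact_mod_cast h
  have h1 : √((2 * k - 2)! : ℝ) ≤ (2 * (k : ℝ)) ^ (2 * k - 2) := by
    have := sqrt_factorial_add_le (u := 0) (n := 2 * k - 2) (N := 1 * (2 * k)) (by omega)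
    rw [zero_add, Nat.factorial_zero, Nat.cast_one, Real.sqrt_one, one_mul] at this
    refine this.trans ?_
    gcongr
    refine (sqrt_mul_le (by omega)).trans ?_
    simp
  have h3 : (k : ℝ) * (2 ^ (2 * k - 2) * (2 * (k : ℝ)) ^ (2 * k - 2)) ≤ c ^ 2 := by
    rw [← mul_pow, hc, ← pow_mul]
    calc (k : ℝ) * (2 * (2 * (k : ℝ))) ^ (2 * k - 2)
        ≤ (4 * k) * (4 * (k : ℝ)) ^ (2 * k - 2) := by
          rw [show 2 * (2 * (k : ℝ)) = 4 * k by ring]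
          gcongr
          linarith
      _ = (4 * (k : ℝ)) ^ (2 * k - 2 + 1) := by rw [pow_succ']
      _ ≤ _ := pow_le_pow_right₀ (by linarith) (by omega)
  unfold weight
  rw [Nat.cast_mul]
  have he : k * (m + 2) = 2 + (2 * (k - 1) + k * m) := by
    have : 2 + 2 * (k - 1) = 2 * k := by omega
    rw [← add_assoc, this]; ring
  calc ((m + 1 : ℕ) : ℝ) * k *
        (t ^ (2 * (k - 1) + k * m) * c ^ m * (2 ^ (2 * k - 2) * √((2 * k - 2)! : ℝ)))
      ≤ t ^ 2 * k * (t ^ (2 * (k - 1) + k * m) * c ^ m *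
        (2 ^ (2 * k - 2) * (2 * (k : ℝ)) ^ (2 * k - 2))) := by gcongr
    _ = t ^ 2 * t ^ (2 * (k - 1) + k * m) * c ^ m *
        (k * (2 ^ (2 * k - 2) * (2 * (k : ℝ)) ^ (2 * k - 2))) := by ring
    _ ≤ t ^ 2 * t ^ (2 * (k - 1) + k * m) * c ^ m * c ^ 2 := by gcongr
    _ = _ := by rw [he]; ring

theorem abs_diagSum_le {V J K : Type*} [Fintype V] [DecidableEq V] [Fintype J] [DecidableEq J]
    [Fintype K] [DecidableEq K] (hk : 2 ≤ Fintype.card J) (hT : 2 ≤ Fintype.card V)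
    {a : (J → K) → ℝ} (ha0 : ∀ i, ¬ Function.Injective i → a i = 0)
    {v α : ℝ} (ha : TensorBound a v α) (hv : 0 ≤ v) (hα : 0 < α)
    (hαT : (α ^ 2)⁻¹ ≤ (Fintype.card V : ℝ) ^ (Fintype.card J - 1)) :
    |diagSum a (∅ : Finset ((V × J) × (V × J))) Finset.univ| ≤
      (v * α * (4 * Fintype.card J) ^ (2 * Fintype.card J) *
        √(Fintype.card V : ℝ) ^ Fintype.card J) ^ Fintype.card V := by
  have : Nonempty J := Fintype.card_pos_iff.mp (by omega)
  set k := Fintype.card J with hkd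
  set T := Fintype.card V with hTd
  set t := √(T : ℝ) with ht
  set c : ℝ := (4 * k) ^ (2 * k) with hc
  have ht0 : 0 ≤ t := Real.sqrt_nonneg _
  have hc0 : 0 ≤ c := by positivity
  have hαt : (α ^ 2)⁻¹ ≤ t ^ (2 * (k - 1)) := by
    rwa [pow_mul, ht, Real.sq_sqrt (by positivity)]
  have key := abs_diagSum_univ_le (V := V) ha0 ha hv hα (weight k t c)
    (weight_nonneg k ht0 hc0) ?_ ?_ ?_ (by omega)
  · refine key.trans ?_
    obtain ⟨m, hm⟩ := Nat.exists_eq_add_of_le hT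
    have := weight_restart_le (T := T) (m := m) hk (by omega)
    have e1 : Fintype.card V - 1 = m + 1 := by omega
    have e2 : Fintype.card V - 2 = m := by omega
    rw [e1, e2, ← hkd, ← hTd]
    calc _ ≤ v ^ T * α ^ T * (t ^ (k * (m + 2)) * c ^ (m + 2)) :=
          mul_le_mul_of_nonneg_left this (by positivity)
      _ = _ := by
          rw [show m + 2 = T by omega, mul_pow, mul_pow, mul_pow, ← pow_mul t]; ring
  · intro u m hu hum
    have h1 := weight_pair_le (k := k) ht0 hc0 u m
    have h2 := weight_grow_le hk hum
    linarith
  · refine hαt.trans_eq ?_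
    simp [weight]
  · intro m hm hmT
    obtain ⟨m, rfl | rfl⟩ : ∃ n, m = 1 ∨ m = n + 2 := ⟨m - 2, by omega⟩
    · simpa using weight_nonneg k ht0 hc0 0 1
    · have := weight_restart_le (T := T) (m := m) hk (by omega)
      rw [show m + 2 - 1 = m + 1 by omega, show m + 2 - 2 = m by omega]
      -- The assumption α^(-2) ≤ T^(k-1) = t^(2(k-1)) is used here: closing a component and starting
      -- the next one restores the initial factor of the weight.
      refine (mul_le_mul hαt this (mul_nonneg (by positivity) (weight_nonneg k ht0 hc0 _ _))
        (by positivity)).trans_eq ?_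
      simp only [weight, pow_zero, Nat.factorial_zero, Nat.cast_one, Real.sqrt_one, mul_one]
      rw [← mul_assoc, ← pow_add]

end Weights

end WienerIto

/-! ### Moments of normal variables and of products of a white noise. -/

namespace WienerIto

section GaussianMoments

/-- Differentiates f' = v t f repeatedly, by Leibniz's rule. At t = 0 this becomes the recursion
that defines `gaussMoment`; for n = 0 the truncated index n - 1 carries the factor 0. -/
theorem iteratedDeriv_exp_sq (v : ℝ) (n : ℕ) (t : ℝ) :
    iteratedDeriv (n + 1) (fun t : ℝ => Real.exp (v * t ^ 2 / 2)) t =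
      v * (t * iteratedDeriv n (fun t : ℝ => Real.exp (v * t ^ 2 / 2)) t +
        n * iteratedDeriv (n - 1) (fun t : ℝ => Real.exp (v * t ^ 2 / 2)) t) := by
  set f : ℝ → ℝ := fun t => Real.exp (v * t ^ 2 / 2) with hf
  have hsm : ContDiff ℝ ⊤ f := by fun_prop
  have hd : ∀ n t, HasDerivAt (iteratedDeriv n f) (iteratedDeriv (n + 1) f t) t := by
    intro n t
    rw [iteratedDeriv_succ]
    exact (hsm.differentiable_iteratedDeriv n (by exact_mod_cast WithTop.coe_lt_top _) t).hasDerivAt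
  induction n generalizing t with
  | zero =>
    have h1 : HasDerivAt f (Real.exp (v * t ^ 2 / 2) * (v * (2 * t) / 2)) t := by
      have := (((hasDerivAt_pow 2 t).const_mul v).div_const 2).exp
      simpa using this
    rw [zero_add, iteratedDeriv_one, h1.deriv]
    simp [hf]
    ring
  | succ n ih =>
    rw [iteratedDeriv_succ]
    have hfun : iteratedDeriv (n + 1) f = fun t => v * (t * iteratedDeriv n f t +
        n * iteratedDeriv (n - 1) f t) := funext ih
    rw [hfun]
    have h2 := (((hasDerivAt_id t).mul (hd n t)).add
      ((hd (n - 1) t).const_mul (n : ℝ))).const_mul v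
    refine (h2.deriv.trans ?_ : deriv (fun t => v * (t * iteratedDeriv n f t +
        n * iteratedDeriv (n - 1) f t)) t = _)
    rw [← hfun, Nat.add_sub_cancel]
    rcases n with _ | n
    · simp; left; ring
    · rw [Nat.add_sub_cancel]
      simp only [id]
      push_cast
      ring

theorem integral_pow_gaussianReal (v : NNReal) (n : ℕ) :
    ∫ x, x ^ n ∂(gaussianReal 0 v) = √(v : ℝ) ^ n * gaussMoment n := by
  have hm : ∀ n : ℕ, ∫ x, x ^ n ∂(gaussianReal 0 v) =
      iteratedDeriv n (fun t : ℝ => Real.exp (v * t ^ 2 / 2)) 0 := by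
    intro n
    have h := iteratedDeriv_mgf_zero (X := fun x : ℝ => x) (μ := gaussianReal 0 v) (by simp) n
    rw [mgf_fun_id_gaussianReal] at h
    simp only [zero_mul, zero_add] at h
    rw [h]
    rfl
  have hrec : ∀ n, ∫ x, x ^ n ∂(gaussianReal 0 v) = √(v : ℝ) ^ n * gaussMoment n ∧
      ∫ x, x ^ (n + 1) ∂(gaussianReal 0 v) = √(v : ℝ) ^ (n + 1) * gaussMoment (n + 1) := by
    intro n
    induction n with
    | zero =>
      refine ⟨by simp [gaussMoment], ?_⟩
      simp [gaussMoment]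
    | succ n ih =>
      refine ⟨ih.2, ?_⟩
      rw [hm, iteratedDeriv_exp_sq, Nat.add_sub_cancel, ← hm n, ih.1]
      have h2 : √(v : ℝ) ^ 2 = v := Real.sq_sqrt v.2
      have : √(v : ℝ) ^ (n + 1 + 1) = √(v : ℝ) ^ n * v := by
        rw [add_assoc, pow_add, one_add_one_eq_two, h2]
      rw [this]
      simp only [gaussMoment]
      push_cast
      ring
  exact (hrec n).1

end GaussianMoments

section WhiteNoise

variable {X Ω : Type*} [MeasurableSpace X] [MeasurableSpace Ω] {μ : Measure X}
    {P : Measure Ω} {W : FinMeasSet μ → Ω → ℝ}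

theorem IsWhiteNoise.hasGaussianLaw (hW : IsWhiteNoise μ P W) (A : FinMeasSet μ) :
    HasGaussianLaw (W A) P := hW.isGaussianProcess.hasGaussianLaw_eval A

theorem IsWhiteNoise.cov_eq (hW : IsWhiteNoise μ P W) (A B : FinMeasSet μ) :
    cov[W A, W B; P] = μ.real (A.1 ∩ B.1) := by
  have := hW.isGaussianProcess.isProbabilityMeasure
  rw [covariance_eq_sub (hW.hasGaussianLaw A).memLp_two (hW.hasGaussianLaw B).memLp_two,
    hW.mean_eq_zero, zero_mul, sub_zero]
  exact hW.covariance A B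

theorem IsWhiteNoise.map_eq (hW : IsWhiteNoise μ P W) (A : FinMeasSet μ) :
    P.map (W A) = gaussianReal 0 (μ.real A.1).toNNReal := by
  rw [(hW.hasGaussianLaw A).map_eq_gaussianReal, hW.mean_eq_zero,
    ← covariance_self (hW.hasGaussianLaw A).aemeasurable, hW.cov_eq, Set.inter_self]

theorem IsWhiteNoise.integral_pow (hW : IsWhiteNoise μ P W) (A : FinMeasSet μ) (n : ℕ) :
    ∫ ω, W A ω ^ n ∂P = √(μ.real A.1) ^ n * gaussMoment n := by
  have h := integral_map (hW.hasGaussianLaw A).aemeasurable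
    (f := fun x : ℝ => x ^ n) (by fun_prop)
  rw [← h, hW.map_eq, integral_pow_gaussianReal, Real.coe_toNNReal _ measureReal_nonneg]

theorem IsWhiteNoise.iIndepFun (hW : IsWhiteNoise μ P W) {K : Type*} [Fintype K]
    (B : K → FinMeasSet μ) (hB : Pairwise fun i j => Disjoint (B i).1 (B j).1) :
    iIndepFun (fun i => W (B i)) P := by
  refine HasGaussianLaw.iIndepFun_of_covariance_eq_zero ?_ fun i j hij => ?_
  · have h := hW.isGaussianProcess.comp_right B
    have h1 := h.hasGaussianLaw Finset.univ
    have h2 := h1.map_fun (L := ContinuousLinearMap.pi fun i : K =>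
      (ContinuousLinearMap.proj ⟨i, Finset.mem_univ i⟩ :
        ({i // i ∈ (Finset.univ : Finset K)} → ℝ) →L[ℝ] ℝ))
    exact h2
  · rw [hW.cov_eq, (hB hij).inter_eq]; simp

theorem IsWhiteNoise.memLp_prod (hW : IsWhiteNoise μ P W) {L : Type*} (s : Finset L)
    (A : L → FinMeasSet μ) {p : ENNReal} (hp : p ≠ ⊤) :
    MemLp (fun ω => ∏ l ∈ s, W (A l) ω) p P := by
  have := hW.isGaussianProcess.isProbabilityMeasure
  have h : ∀ q : NNReal, 0 < q → MemLp (fun ω => ∏ l ∈ s, W (A l) ω) q P := by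
    intro q hq
    rcases s.eq_empty_or_nonempty with rfl | hs
    · simpa using memLp_const 1
    have hc : (0 : NNReal) < s.card := by exact_mod_cast hs.card_pos
    have := MemLp.prod' (μ := P) (s := s) (f := fun l => W (A l))
      (p := fun _ => ((q * s.card : NNReal) : ENNReal))
      (fun l _ => (hW.hasGaussianLaw (A l)).memLp ENNReal.coe_ne_top)
    rw [Finset.sum_const, nsmul_eq_mul] at this
    convert this using 1
    have hne : q * s.card ≠ 0 := (mul_pos hq hc).ne'
    rw [← ENNReal.coe_inv hne, ← ENNReal.coe_natCast, ← ENNReal.coe_mul, ← ENNReal.coe_inv]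
    · congr 1
      field_simp
    · positivity
  lift p to NNReal using hp
  exact (h (p + 1) (by positivity)).mono_exponent (by exact_mod_cast le_self_add)

/-- Equal factors are collected into powers. The variables of disjoint sets are jointly Gaussian and
uncorrelated, hence independent, and the expectation factors. -/
theorem IsWhiteNoise.integral_prod (hW : IsWhiteNoise μ P W) {K L : Type*} [Fintype K]
    [DecidableEq K] [Fintype L] (B : K → FinMeasSet μ)
    (hB : Pairwise fun i j => Disjoint (B i).1 (B j).1) (x : L → K) :
    ∫ ω, ∏ p, W (B (x p)) ω ∂P = (∏ p, √(μ.real (B (x p)).1)) * wick Finset.univ x := by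
  have h1 : ∀ F : K → ℝ, ∏ p, F (x p) = ∏ i, F i ^ (Finset.univ.filter fun p => x p = i).card := by
    intro F
    rw [← Finset.prod_fiberwise' Finset.univ x F]
    simp
  have h2 : ∀ ω, ∏ p, W (B (x p)) ω =
      ∏ i, W (B i) ω ^ (Finset.univ.filter fun p => x p = i).card := fun ω => h1 fun i => W (B i) ω
  simp only [h2]
  rw [h1 fun i => √(μ.real (B i).1), wick, ← Finset.prod_mul_distrib,
    (hW.iIndepFun B hB).integral_fun_prod_comp
      (fun i => (hW.hasGaussianLaw (B i)).aemeasurable)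
      (f := fun i y => y ^ (Finset.univ.filter fun p => x p = i).card) (fun i => by fun_prop)]
  exact Finset.prod_congr rfl fun i _ => hW.integral_pow _ _

/-- The stochastic integral of the step function with the coefficients `a` on the products of the
sets `B i`. -/
def stepIntegral {J K : Type*} [Fintype J] [Fintype K] [DecidableEq J] (W : FinMeasSet μ → Ω → ℝ)
    (B : K → FinMeasSet μ) (a : (J → K) → ℝ) (ω : Ω) : ℝ :=
  ∑ i : J → K, a i * ∏ j, W (B (i j)) ω

theorem IsWhiteNoise.memLp_stepIntegral (hW : IsWhiteNoise μ P W) {J K : Type*} [Fintype J]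
    [Fintype K] [DecidableEq J] (B : K → FinMeasSet μ) (a : (J → K) → ℝ) {p : ENNReal}
    (hp : p ≠ ⊤) : MemLp (stepIntegral W B a) p P :=
  memLp_finsetSum _ fun i _ => (hW.memLp_prod Finset.univ (fun j => B (i j)) hp).const_mul (a i)

/-- The diagram formula before any pair is chosen. The square roots of the measures normalize the
Gaussian variables and enter the tensor, which makes sums of squares correspond to L² norms of step
functions. -/
theorem IsWhiteNoise.integral_stepIntegral_pow (hW : IsWhiteNoise μ P W) {J K : Type*} [Fintype J]
    [Fintype K] [DecidableEq J] [DecidableEq K] (B : K → FinMeasSet μ)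
    (hB : Pairwise fun i j => Disjoint (B i).1 (B j).1) (a : (J → K) → ℝ) (T : ℕ) :
    ∫ ω, stepIntegral W B a ω ^ T ∂P =
      diagSum (V := Fin T) (fun i => a i * ∏ j, √(μ.real (B (i j)).1)) ∅ Finset.univ := by
  have h1 : ∀ ω, stepIntegral W B a ω ^ T =
      ∑ x : Fin T × J → K, (∏ v, a fun j => x (v, j)) * ∏ p, W (B (x p)) ω := by
    intro ω
    have : stepIntegral W B a ω ^ T =
        ∏ v : Fin T, ∑ i : J → K, a i * ∏ j, W (B (i j)) ω := by
      simp [stepIntegral]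
    rw [this, Finset.prod_univ_sum, Fintype.piFinset_univ]
    refine (Fintype.sum_equiv (Equiv.curry (Fin T) J K) _ _ fun x => ?_).symm
    rw [Finset.prod_mul_distrib, Fintype.prod_prod_type]
    rfl
  simp only [h1]
  rw [integral_finsetSum]
  · simp only [diagSum, Finset.notMem_empty, false_imp_iff, implies_true, if_true, one_mul]
    refine Finset.sum_congr rfl fun x _ => ?_
    rw [integral_const_mul, hW.integral_prod B hB, Finset.prod_mul_distrib,
      Fintype.prod_prod_type, mul_assoc]
  · intro x _
    exact (memLp_one_iff_integrable.mp
      (hW.memLp_prod Finset.univ (fun p => B (x p)) ENNReal.one_ne_top)).const_mul _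

end WhiteNoise

end WienerIto

/-! ### Elementary functions as step functions on disjoint sets. -/

namespace WienerIto

noncomputable section Elementary

set_option linter.unusedSectionVars false

variable {X Ω : Type*} [MeasurableSpace X] [MeasurableSpace Ω] {μ : Measure X}
    {P : Measure Ω} {W : FinMeasSet μ → Ω → ℝ}

/-- A white noise is finitely additive. -/
theorem IsWhiteNoise.ae_eq_sum (hW : IsWhiteNoise μ P W) {ι : Type*} (S : Finset ι)
    (B : ι → FinMeasSet μ) (hB : (S : Set ι).PairwiseDisjoint fun s => (B s).1)
    (A : FinMeasSet μ) (hA : A.1 = ⋃ s ∈ S, (B s).1) :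
    ∀ᵐ ω ∂P, W A ω = ∑ s ∈ S, W (B s) ω := by
  have hL2 : ∀ C, MemLp (W C) 2 P := fun C => (hW.hasGaussianLaw C).memLp_two
  have hS2 : MemLp (fun ω => ∑ s ∈ S, W (B s) ω) 2 P := memLp_finsetSum _ fun s _ => hL2 (B s)
  -- By additivity of the measure the difference `Y` is orthogonal to every variable of the white
  -- noise, hence to itself.
  set Y : Ω → ℝ := fun ω => W A ω - ∑ s ∈ S, W (B s) ω with hY
  have hY2 : MemLp Y 2 P := (hL2 A).sub hS2
  have hint : ∀ C, Integrable (fun ω => Y ω * W C ω) P := fun C => hY2.integrable_mul (hL2 C)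
  have h0 : ∀ C, ∫ ω, Y ω * W C ω ∂P = 0 := by
    intro C
    have h1 : ∀ ω, Y ω * W C ω = W A ω * W C ω - ∑ s ∈ S, W (B s) ω * W C ω := by
      intro ω; rw [hY, sub_mul, Finset.sum_mul]
    simp only [h1]
    have hi : ∀ D, Integrable (fun ω => W D ω * W C ω) P := fun D => (hL2 D).integrable_mul (hL2 C)
    rw [integral_sub (hi A) (integrable_finsetSum _ fun s _ => hi (B s)),
      integral_finsetSum _ fun s _ => hi (B s), hW.covariance,
      Finset.sum_congr rfl fun s _ => hW.covariance (B s) C, sub_eq_zero, hA,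
      Set.iUnion₂_inter, measureReal_biUnion_finset (h := fun s _ =>
        ((measure_mono Set.inter_subset_left).trans_lt (B s).2.2).ne)]
    · exact fun s hs t ht hst => (hB hs ht hst).mono Set.inter_subset_left Set.inter_subset_left
    · exact fun s _ => (B s).2.1.inter C.2.1
  have h2 : ∫ ω, Y ω ^ 2 ∂P = 0 := by
    have h1 : ∀ ω, Y ω ^ 2 = Y ω * W A ω - ∑ s ∈ S, Y ω * W (B s) ω := by
      intro ω; rw [← Finset.mul_sum, ← mul_sub, sq]
    simp only [h1]
    rw [integral_sub (hint A) (integrable_finsetSum _ fun s _ => hint (B s)),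
      integral_finsetSum _ fun s _ => hint (B s), h0]
    simp [h0]
  rw [integral_eq_zero_iff_of_nonneg (fun ω => sq_nonneg (Y ω)) hY2.integrable_sq] at h2
  filter_upwards [h2] with ω hω
  have : Y ω = 0 := by simpa using hω
  exact sub_eq_zero.mp this

/-- The set of the points which lie in `A l` for `l ∈ s` only; empty for `s = ∅`. -/
def atom {L : Type*} [Fintype L] (A : L → FinMeasSet μ) (s : Finset L) : FinMeasSet μ :=
  ⟨{x | s.Nonempty ∧ ∀ l, x ∈ (A l).1 ↔ l ∈ s}, by
    constructor
    · have : {x | s.Nonempty ∧ ∀ l, x ∈ (A l).1 ↔ l ∈ s} =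
          {_x | s.Nonempty} ∩ ⋂ l, {x | x ∈ (A l).1 ↔ l ∈ s} := by ext x; simp
      rw [this]
      refine (MeasurableSet.const _).inter (MeasurableSet.iInter fun l => ?_)
      exact (A l).2.1.iff (MeasurableSet.const _)
    · rcases s.eq_empty_or_nonempty with rfl | ⟨l, hl⟩
      · simp
      · exact (measure_mono fun x hx => (hx.2 l).mpr hl).trans_lt (A l).2.2⟩

theorem disjoint_atom {L : Type*} [Fintype L] (A : L → FinMeasSet μ) :
    Pairwise fun s t => Disjoint (atom A s).1 (atom A t).1 := by
  intro s t hst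
  rw [Set.disjoint_left]
  rintro x ⟨_, h1⟩ ⟨_, h2⟩
  exact hst (Finset.ext fun l => (h1 l).symm.trans (h2 l))

theorem eq_biUnion_atom {L : Type*} [Fintype L] [DecidableEq L] (A : L → FinMeasSet μ) (l : L) :
    (A l).1 = ⋃ s ∈ Finset.univ.filter (fun s : Finset L => l ∈ s), (atom A s).1 := by
  classical
  ext x
  simp only [Finset.mem_filter, Finset.mem_univ, true_and, Set.mem_iUnion, exists_prop]
  constructor
  · intro hx
    exact ⟨Finset.univ.filter fun l => x ∈ (A l).1, by simpa, ⟨l, by simpa⟩, by simp⟩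
  · rintro ⟨s, hl, _, h⟩
    exact (h l).mpr hl

/-- Used with indicators for `Ψ` and with the white noise for `Ψ`, so that a function and its
integral are expanded with the same coefficients. Terms with a repeated atom vanish: such an atom
would lie in two disjoint sets and is empty. -/
theorem prod_eq_sum_atom {L J : Type*} [Fintype L] [DecidableEq L] [Fintype J] [DecidableEq J]
    (A : L → FinMeasSet μ) (l : J → L) (hl : Pairwise fun i j => Disjoint (A (l i)).1 (A (l j)).1)
    (Ψ : J → FinMeasSet μ → ℝ) (h0 : ∀ j s, (atom A s).1 = ∅ → Ψ j (atom A s) = 0)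
    (hadd : ∀ j l, Ψ j (A l) = ∑ s with l ∈ s, Ψ j (atom A s)) :
    ∏ j, Ψ j (A (l j)) = ∑ i : J → Finset L,
      (if Function.Injective i ∧ ∀ j, l j ∈ i j then 1 else 0) * ∏ j, Ψ j (atom A (i j)) := by
  simp only [hadd, Finset.sum_filter]
  rw [Finset.prod_univ_sum, Fintype.piFinset_univ]
  refine Finset.sum_congr rfl fun i _ => ?_
  by_cases h1 : ∀ j, l j ∈ i j
  · by_cases h2 : Function.Injective i
    · simp [h1, h2]
    · simp only [h1, h2, if_true, false_and, if_false, zero_mul]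
      obtain ⟨j, j', hjj, hne⟩ := Function.not_injective_iff.mp h2
      refine Finset.prod_eq_zero (Finset.mem_univ j) (h0 j _ ?_)
      rw [Set.eq_empty_iff_forall_notMem]
      rintro x ⟨_, hx⟩
      refine Set.disjoint_left.mp (hl hne) ((hx _).mpr (h1 j)) ((hx _).mpr ?_)
      rw [hjj]; exact h1 j'
  · have h2 : ¬ (Function.Injective i ∧ ∀ j, l j ∈ i j) := fun h => h1 h.2
    rw [if_neg h2, zero_mul]
    push Not at h1
    obtain ⟨j, hj⟩ := h1
    exact Finset.prod_eq_zero (Finset.mem_univ j) (if_neg hj)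

/-- The step function with the coefficients `a` on the products of the sets `B i`. -/
def stepFun {J K : Type*} [Fintype J] [Fintype K] [DecidableEq J] (B : K → FinMeasSet μ)
    (a : (J → K) → ℝ) (x : J → X) : ℝ :=
  ∑ i : J → K, a i * ∏ j, (B (i j)).1.indicator (fun _ => (1 : ℝ)) (x j)

theorem indicator_pi {J : Type*} [Fintype J] (A : J → Set X) (x : J → X) :
    Set.indicator (Set.univ.pi A) (fun _ => (1 : ℝ)) x =
      ∏ j, (A j).indicator (fun _ => (1 : ℝ)) (x j) := by
  classical
  by_cases h : x ∈ Set.univ.pi A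
  · rw [Set.indicator_of_mem h, Finset.prod_eq_one]
    exact fun j _ => Set.indicator_of_mem (h j trivial) _
  · rw [Set.indicator_of_notMem h]
    simp only [Set.mem_pi, Set.mem_univ, true_imp_iff, not_forall] at h
    obtain ⟨j, hj⟩ := h
    exact (Finset.prod_eq_zero (Finset.mem_univ j) (Set.indicator_of_notMem hj _)).symm

/-- An elementary function is a step function on the products of disjoint sets, without diagonal
terms. -/
theorem IsWhiteNoise.exists_step (hW : IsWhiteNoise μ P W) {k : ℕ}
    {p : ((Fin k → X) → ℝ) × (Ω → ℝ)} (hp : p ∈ elementaryIntegrals W k) :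
    ∃ (K : Type) (_ : Fintype K) (_ : DecidableEq K) (B : K → FinMeasSet μ)
      (a : (Fin k → K) → ℝ), (Pairwise fun i j => Disjoint (B i).1 (B j).1) ∧
      (∀ i, ¬ Function.Injective i → a i = 0) ∧ p.1 = stepFun B a ∧
      p.2 =ᵐ[P] stepIntegral W B a := by
  obtain ⟨n, c, g, rfl⟩ := Submodule.mem_span_set'.mp hp
  have hg := fun m => (g m).2
  choose A hA hgA using hg
  set A' : Fin n × Fin k → FinMeasSet μ := fun l => A l.1 l.2 with hA'
  set a : Fin n → (Fin k → Finset (Fin n × Fin k)) → ℝ := fun m i =>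
    if Function.Injective i ∧ ∀ j, (m, j) ∈ i j then 1 else 0 with ha
  refine ⟨Finset (Fin n × Fin k), inferInstance, inferInstance, atom A', fun i => ∑ m, c m * a m i,
    disjoint_atom A', ?_, ?_, ?_⟩
  · intro i hi
    exact Finset.sum_eq_zero fun m _ => by simp [ha, hi]
  · ext x
    rw [Prod.fst_sum, Finset.sum_apply]
    simp only [stepFun, Finset.sum_mul]
    rw [Finset.sum_comm]
    refine Finset.sum_congr rfl fun m _ => ?_
    rw [hgA m]
    simp only [Prod.smul_mk, Pi.smul_apply, smul_eq_mul, mul_assoc]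
    rw [← Finset.mul_sum, indicator_pi]
    congr 1
    convert prod_eq_sum_atom A' (fun j => (m, j)) (hA m)
      (fun j C => C.1.indicator (fun _ => (1 : ℝ)) (x j)) ?_ ?_
    · intro j s hs; simp only [hs, Set.indicator_empty]
    · intro j l
      rw [eq_biUnion_atom A' l, Finset.indicator_biUnion_apply]
      exact fun s _ t _ hst => disjoint_atom A' hst
  · have h1 : ∀ᵐ ω ∂P, ∀ l, W (A' l) ω = ∑ s with l ∈ s, W (atom A' s) ω := by
      rw [ae_all_iff]
      exact fun l => hW.ae_eq_sum _ _ (fun s _ t _ hst => disjoint_atom A' hst) _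
        (eq_biUnion_atom A' l)
    have h2 : ∀ᵐ ω ∂P, ∀ s, (atom A' s).1 = ∅ → W (atom A' s) ω = 0 := by
      rw [ae_all_iff]
      intro s
      by_cases hs : (atom A' s).1 = ∅
      · have := hW.ae_eq_sum ∅ (atom A') (by simp) (atom A' s) (by simp [hs])
        filter_upwards [this] with ω hω _
        simpa using hω
      · exact Filter.Eventually.of_forall fun ω h => absurd h hs
    filter_upwards [h1, h2] with ω hω1 hω2
    rw [Prod.snd_sum, Finset.sum_apply]
    simp only [stepIntegral, Finset.sum_mul]
    rw [Finset.sum_comm]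
    refine Finset.sum_congr rfl fun m _ => ?_
    rw [hgA m]
    simp only [Prod.smul_mk, Pi.smul_apply, smul_eq_mul, mul_assoc]
    rw [← Finset.mul_sum]
    congr 1
    convert prod_eq_sum_atom A' (fun j => (m, j)) (hA m) (fun _ C => W C ω)
      (fun _ s hs => hω2 s hs) (fun _ l => hω1 l)

section StepFunctions

variable {J K : Type*} [Fintype J] [Fintype K] [DecidableEq J] {B : K → FinMeasSet μ}
  (hB : Pairwise fun i j => Disjoint (B i).1 (B j).1)

theorem stepFun_of_mem (hB : Pairwise fun i j => Disjoint (B i).1 (B j).1) (a : (J → K) → ℝ)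
    {x : J → X} {i : J → K} (hx : ∀ j, x j ∈ (B (i j)).1) : stepFun B a x = a i := by
  rw [stepFun, Finset.sum_eq_single i]
  · rw [Finset.prod_eq_one, mul_one]
    exact fun j _ => Set.indicator_of_mem (hx j) _
  · intro i' _ hne
    obtain ⟨j, hj⟩ := Function.ne_iff.mp hne
    rw [Finset.prod_eq_zero (Finset.mem_univ j), mul_zero]
    exact Set.indicator_of_notMem (Set.disjoint_left.mp (hB hj.symm) (hx j)) _
  · simp

theorem stepFun_of_notMem (a : (J → K) → ℝ) {x : J → X} {j : J} (hx : ∀ c, x j ∉ (B c).1) :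
    stepFun B a x = 0 := by
  refine Finset.sum_eq_zero fun i _ => ?_
  rw [Finset.prod_eq_zero (Finset.mem_univ j), mul_zero]
  exact Set.indicator_of_notMem (hx _) _

theorem stepFun_mul (hB : Pairwise fun i j => Disjoint (B i).1 (B j).1) (a b : (J → K) → ℝ)
    (x : J → X) : stepFun B a x * stepFun B b x = stepFun B (fun i => a i * b i) x := by
  by_cases h : ∀ j, ∃ c, x j ∈ (B c).1
  · choose i hi using h
    simp only [stepFun_of_mem hB _ hi]
  · push Not at h
    obtain ⟨j, hj⟩ := h
    simp only [stepFun_of_notMem _ hj, zero_mul]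

theorem integrable_indicator_pi [SigmaFinite μ] (A : J → FinMeasSet μ) :
    Integrable (fun x : J → X => ∏ j, (A j).1.indicator (fun _ => (1 : ℝ)) (x j))
      (Measure.pi fun _ => μ) :=
  Integrable.fintype_prod fun j => (integrable_indicator_iff (A j).2.1).mpr
    (integrableOn_const (A j).2.2.ne)

theorem integrable_stepFun [SigmaFinite μ] (B : K → FinMeasSet μ) (a : (J → K) → ℝ) :
    Integrable (stepFun B a) (Measure.pi fun _ : J => μ) :=
  integrable_finsetSum _ fun i _ => (integrable_indicator_pi fun j => B (i j)).const_mul (a i)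

theorem integral_stepFun [SigmaFinite μ] (B : K → FinMeasSet μ) (a : (J → K) → ℝ) :
    ∫ x, stepFun B a x ∂(Measure.pi fun _ : J => μ) = ∑ i, a i * ∏ j, μ.real (B (i j)).1 := by
  unfold stepFun
  rw [integral_finsetSum _ fun i _ =>
    (integrable_indicator_pi fun j => B (i j)).const_mul (a i)]
  refine Finset.sum_congr rfl fun i _ => ?_
  rw [integral_const_mul, integral_fintype_prod_eq_prod (𝕜 := ℝ)
    (f := fun j y => (B (i j)).1.indicator (fun _ => (1 : ℝ)) y)]
  congr 1
  refine Finset.prod_congr rfl fun j _ => ?_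
  rw [integral_indicator_const _ (B (i j)).2.1]
  simp

theorem memLp_stepFun [SigmaFinite μ] (hB : Pairwise fun i j => Disjoint (B i).1 (B j).1)
    (a : (J → K) → ℝ) : MemLp (stepFun B a) 2 (Measure.pi fun _ : J => μ) := by
  rw [memLp_two_iff_integrable_sq (integrable_stepFun B a).aestronglyMeasurable]
  simp only [sq, stepFun_mul hB]
  exact integrable_stepFun B _

end StepFunctions

end Elementary

end WienerIto

namespace WienerIto

/-! ### The norms of partitions. -/

section Partitions

set_option linter.unusedSectionVars false

variable {X J : Type*} [MeasurableSpace X] [Fintype J] [DecidableEq J] {μ : Measure X}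
  [SigmaFinite μ]

theorem lmarginal_prod_blocks (P : Finset (Finset J))
    (hP : (P : Set (Finset J)).PairwiseDisjoint id) (G : (A : Finset J) → (A → X) → ENNReal)
    (hG : ∀ A, Measurable (G A)) (x : J → X) :
    lmarginal (fun _ : J => μ) (P.biUnion id) (fun x => ∏ A ∈ P, G A fun j => x j) x =
      ∏ A ∈ P, ∫⁻ y, G A y ∂(Measure.pi fun _ : A => μ) := by
  have hm : ∀ A : Finset J, Measurable fun x : J → X => G A fun j => x j := fun A =>
    (hG A).comp (measurable_pi_lambda _ fun j => measurable_pi_apply _)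
  induction P using Finset.induction_on generalizing x with
  | empty => simp
  | insert A P hA ih =>
    have hP' : (P : Set (Finset J)).PairwiseDisjoint id :=
      hP.subset (by simp)
    have hd : Disjoint A (P.biUnion id) := by
      rw [Finset.disjoint_biUnion_right]
      intro A' hA'
      exact hP (by simp) (by simp [hA']) fun h => hA (h ▸ hA')
    have hmP : Measurable fun x : J → X => ∏ A ∈ P, G A fun j => x j :=
      Finset.measurable_fun_prod _ fun A _ => hm A
    simp only [Finset.prod_insert hA]
    rw [Finset.biUnion_insert, id, lmarginal_union (fun _ : J => μ)
      (fun x => G A (fun j => x j) * ∏ A ∈ P, G A fun j => x j) ((hm A).mul hmP) hd]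
    have h1 : lmarginal (fun _ : J => μ) (P.biUnion id)
        (fun x => G A (fun j => x j) * ∏ A ∈ P, G A fun j => x j) =
        fun x => G A (fun j => x j) *
          ∏ A ∈ P, ∫⁻ y, G A y ∂(Measure.pi fun _ : A => μ) := by
      ext z
      rw [← ih hP' z, lmarginal, lmarginal, ← lintegral_const_mul]
      · refine lintegral_congr fun y => ?_
        congr 2
        ext j
        exact dif_neg (Finset.disjoint_left.mp hd j.2)
      · exact hmP.comp measurable_updateFinset
    rw [h1, lmarginal, lintegral_mul_const]
    · congr 1
      refine lintegral_congr fun y => ?_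
      congr 1
      ext j
      exact dif_pos j.2
    · exact (hm A).comp measurable_updateFinset

theorem quasiMeasurePreserving_restrict (A : Finset J) :
    Measure.QuasiMeasurePreserving (fun (x : J → X) (j : A) => x j)
      (Measure.pi fun _ => μ) (Measure.pi fun _ : A => μ) := by
  have h := Measure.quasiMeasurePreserving_fst.comp
    (measurePreserving_piEquivPiSubtypeProd (fun _ : J => μ) (· ∈ A)).quasiMeasurePreserving
  convert h
  rfl

variable {Q : Finpartition (Finset.univ : Finset J)} {g : (A : Finset J) → (A → X) → ℝ}

/-- The norm of a product over disjoint blocks is the product of the norms. By Cauchy–Schwarz this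
makes the supremum defining `VPart` finite and at most `V₁`. -/
theorem memLp_prod_blocks (hg : g ∈ unitFamilies μ Q) :
    MemLp (fun x : J → X => ∏ A ∈ Q.parts, g A fun j => x j) 2 (Measure.pi fun _ => μ) ∧
      ∫ x, (∏ A ∈ Q.parts, g A fun j => x j) ^ 2 ∂(Measure.pi fun _ : J => μ) ≤ 1 := by
  have hae : AEStronglyMeasurable (fun x : J → X => ∏ A ∈ Q.parts, g A fun j => x j)
      (Measure.pi fun _ => μ) :=
    Finset.aestronglyMeasurable_fun_prod _ fun A hA =>
      (hg A hA).1.1.comp_quasiMeasurePreserving (quasiMeasurePreserving_restrict A)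
  -- Measurable versions are needed because iterated marginals are sensitive to changes on null
  -- sets.
  have hex : ∀ A : Finset J, ∃ G : (A → X) → ENNReal, Measurable G ∧ (A ∈ Q.parts →
      (fun y => ‖g A y‖ₑ ^ 2) =ᵐ[Measure.pi fun _ : A => μ] G) := by
    intro A
    by_cases hA : A ∈ Q.parts
    · have := ((hg A hA).1.1.enorm.pow_const 2)
      exact ⟨this.mk _, this.measurable_mk, fun _ => this.ae_eq_mk⟩
    · exact ⟨0, measurable_zero, fun h => absurd h hA⟩
  choose G hGm hG using hex
  have hlin : ∀ A ∈ Q.parts, ∫⁻ y, G A y ∂(Measure.pi fun _ : A => μ) ≤ 1 := by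
    intro A hA
    rw [← lintegral_congr_ae (hG A hA)]
    have h1 : ∀ y, ‖g A y‖ₑ ^ 2 = ENNReal.ofReal (g A y ^ 2) := fun y => by
      rw [← enorm_pow, Real.enorm_of_nonneg (sq_nonneg _)]
    simp only [h1]
    rw [← ofReal_integral_eq_lintegral_ofReal (hg A hA).1.integrable_sq
      (Filter.Eventually.of_forall fun _ => sq_nonneg _)]
    exact ENNReal.ofReal_le_one.mpr (hg A hA).2
  have key : ∫⁻ x, ‖∏ A ∈ Q.parts, g A fun j => x j‖ₑ ^ 2 ∂(Measure.pi fun _ : J => μ) ≤ 1 := by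
    have h2 : (fun x : J → X => ‖∏ A ∈ Q.parts, g A fun j => x j‖ₑ ^ 2)
        =ᵐ[Measure.pi fun _ => μ] fun x => ∏ A ∈ Q.parts, G A fun j => x j := by
      have : ∀ᵐ x ∂(Measure.pi fun _ : J => μ), ∀ A ∈ Q.parts,
          ‖g A fun j => x j‖ₑ ^ 2 = G A fun j => x j := by
        rw [Filter.eventually_all_finset]
        exact fun A hA => (quasiMeasurePreserving_restrict A).ae (hG A hA)
      filter_upwards [this] with x hx
      rw [← Finset.prod_congr rfl hx, Finset.prod_pow]
      congr 1
      exact map_prod ({ toFun := fun r : ℝ => ‖r‖ₑ, map_one' := by simp, map_mul' := enorm_mul } :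
        ℝ →* ENNReal) _ _
    rw [lintegral_congr_ae h2]
    rcases isEmpty_or_nonempty (J → X) with hJ | ⟨⟨x⟩⟩
    · rw [Measure.eq_zero_of_isEmpty (Measure.pi fun _ : J => μ)]; simp
    have h3 := lmarginal_prod_blocks (μ := μ) Q.parts Q.disjoint G hGm x
    rw [show Q.parts.biUnion id = Finset.univ from Q.biUnion_parts] at h3
    rw [lintegral_eq_lmarginal_univ x, h3]
    exact Finset.prod_le_one' hlin
  have hmem : MemLp (fun x : J → X => ∏ A ∈ Q.parts, g A fun j => x j) 2
      (Measure.pi fun _ => μ) := by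
    refine ⟨hae, ?_⟩
    rw [eLpNorm_lt_top_iff_lintegral_rpow_enorm_lt_top two_ne_zero ENNReal.ofNat_ne_top]
    simp only [ENNReal.toReal_ofNat, ENNReal.rpow_ofNat]
    exact key.trans_lt ENNReal.one_lt_top
  refine ⟨hmem, ?_⟩
  rw [integral_eq_lintegral_of_nonneg_ae (Filter.Eventually.of_forall fun _ => sq_nonneg _)
    (hae.pow 2)]
  refine ENNReal.toReal_le_of_le_ofReal zero_le_one ?_
  rw [ENNReal.ofReal_one]
  refine le_of_eq_of_le (lintegral_congr fun x => ?_) key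
  rw [← enorm_pow, Real.enorm_of_nonneg (sq_nonneg _)]

theorem V₁_nonneg (f : (J → X) → ℝ) : 0 ≤ V₁ μ f := Real.sqrt_nonneg _

theorem abs_integral_mul_le {α : Type*} [MeasurableSpace α] {ν : Measure α} {f g : α → ℝ}
    (hf : MemLp f 2 ν) (hg : MemLp g 2 ν) :
    |∫ x, f x * g x ∂ν| ≤ √(∫ x, f x ^ 2 ∂ν) * √(∫ x, g x ^ 2 ∂ν) := by
  have h := integral_mul_norm_le_Lp_mul_Lq (μ := ν) (f := f) (g := g) Real.HolderConjugate.two_two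
    (by simpa using hf) (by simpa using hg)
  simp only [Real.norm_eq_abs, Real.rpow_ofNat, sq_abs] at h
  rw [Real.sqrt_eq_rpow, Real.sqrt_eq_rpow]
  refine le_trans ?_ h
  refine (abs_integral_le_integral_abs).trans_eq ?_
  simp only [abs_mul]

theorem abs_integral_mul_prod_le {f : (J → X) → ℝ} (hf : MemLp f 2 (Measure.pi fun _ => μ))
    (hg : g ∈ unitFamilies μ Q) :
    |∫ x, f x * ∏ A ∈ Q.parts, g A (fun j => x j) ∂(Measure.pi fun _ : J => μ)| ≤ V₁ μ f := by
  obtain ⟨h1, h2⟩ := memLp_prod_blocks hg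
  refine (abs_integral_mul_le hf h1).trans (mul_le_of_le_one_right (V₁_nonneg f) ?_)
  rw [Real.sqrt_le_one]
  exact h2

theorem le_VPart {f : (J → X) → ℝ} (hf : MemLp f 2 (Measure.pi fun _ => μ))
    (hg : g ∈ unitFamilies μ Q) :
    ∫ x, f x * ∏ A ∈ Q.parts, g A (fun j => x j) ∂(Measure.pi fun _ : J => μ) ≤ VPart μ f Q := by
  refine le_csSup ⟨V₁ μ f, ?_⟩ ⟨g, hg, rfl⟩
  rintro _ ⟨g', hg', rfl⟩
  exact (le_abs_self _).trans (abs_integral_mul_prod_le hf hg')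

theorem zero_mem_unitFamilies : (fun _ _ => 0) ∈ unitFamilies μ Q := by
  intro A _
  simp

theorem VPart_le {f : (J → X) → ℝ} {c : ℝ} (h : ∀ g ∈ unitFamilies μ Q,
    ∫ x, f x * ∏ A ∈ Q.parts, g A (fun j => x j) ∂(Measure.pi fun _ : J => μ) ≤ c) :
    VPart μ f Q ≤ c := by
  refine csSup_le (Set.Nonempty.image _ ⟨_, zero_mem_unitFamilies⟩) ?_
  rintro _ ⟨g, hg, rfl⟩
  exact h g hg

theorem VPart_le_V₁ {f : (J → X) → ℝ} (hf : MemLp f 2 (Measure.pi fun _ => μ)) :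
    VPart μ f Q ≤ V₁ μ f :=
  VPart_le fun _ hg => (le_abs_self _).trans (abs_integral_mul_prod_le hf hg)

theorem VPart_nonneg [Nonempty J] {f : (J → X) → ℝ} (hf : MemLp f 2 (Measure.pi fun _ => μ)) :
    0 ≤ VPart μ f Q := by
  refine le_trans (le_of_eq ?_) (le_VPart hf zero_mem_unitFamilies)
  obtain ⟨A, hA⟩ := Q.parts_nonempty (Finset.univ_nonempty (α := J)).ne_empty
  simp [Finset.prod_eq_zero hA]

/-- As a supremum of linear functionals of norm at most one, `VPart` is Lipschitz in L²; hypotheses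
on f therefore pass to its approximations. -/
theorem VPart_le_add {f f' : (J → X) → ℝ} (hf : MemLp f 2 (Measure.pi fun _ => μ))
    (hf' : MemLp f' 2 (Measure.pi fun _ => μ)) :
    VPart μ f' Q ≤ VPart μ f Q + V₁ μ (f' - f) := by
  refine VPart_le fun g hg => ?_
  have h1 := le_VPart hf hg
  have h2 := (le_abs_self _).trans (abs_integral_mul_prod_le (hf'.sub hf) hg)
  obtain ⟨h3, _⟩ := memLp_prod_blocks hg
  have h4 : ∫ x, f' x * ∏ A ∈ Q.parts, g A (fun j => x j) ∂(Measure.pi fun _ : J => μ) =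
      ∫ x, f x * ∏ A ∈ Q.parts, g A (fun j => x j) ∂(Measure.pi fun _ : J => μ) +
      ∫ x, (f' - f) x * ∏ A ∈ Q.parts, g A (fun j => x j) ∂(Measure.pi fun _ : J => μ) := by
    rw [← integral_add]
    · refine integral_congr_ae (Filter.Eventually.of_forall fun x => ?_)
      simp only [Pi.sub_apply]; ring
    · exact hf.integrable_mul h3
    · exact (hf'.sub hf).integrable_mul h3
  rw [h4]
  exact add_le_add h1 h2

theorem VPart_le_V (f : (J → X) → ℝ) : VPart μ f Q ≤ V μ Q.parts.card f :=
  le_csSup ((Set.toFinite _).image _).bddAbove ⟨Q, rfl, rfl⟩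

theorem V_nonneg [Nonempty J] {f : (J → X) → ℝ} (hf : MemLp f 2 (Measure.pi fun _ => μ)) (s : ℕ) :
    0 ≤ V μ s f := by
  refine Real.sSup_nonneg ?_
  rintro _ ⟨Q, _, rfl⟩
  exact VPart_nonneg hf

end Partitions

/-! ### From partition norms of step functions to tensor bounds. -/

section StepBound

variable {X J K : Type*} [MeasurableSpace X] [Fintype J] [DecidableEq J] [Fintype K]
  [DecidableEq K] {μ : Measure X} [SigmaFinite μ]

theorem sum_extend_eq_marg (A : Finset J) (F : (J → K) → ℝ) (y : J → K) :
    ∑ i : A → K, F (Function.extend Subtype.val i y) = marg A F y := by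
  have h : (Finset.univ : Finset A).image Subtype.val = A := by
    rw [Finset.univ_eq_attach, Finset.attach_image_val]
  conv_rhs => rw [← h]
  rw [marg_map Subtype.val_injective, marg_univ]

/-- Each test tensor becomes a step function, its entries being divided by square roots of measures
and by its norm `N A`. This is admissible in `VPart`, and the integral is the tensor sum divided by
the norms. -/
theorem tensorBound_of_VPart [Nonempty J] {B : K → FinMeasSet μ}
    (hB : Pairwise fun i j => Disjoint (B i).1 (B j).1) (a : (J → K) → ℝ) {v α : ℝ}
    (h : ∀ Q, VPart μ (stepFun B a) Q ≤ v * α ^ (Q.parts.card - 1)) :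
    TensorBound (fun i => a i * ∏ j, √(μ.real (B (i j)).1)) v α := by
  have main : ∀ (Q : Finpartition (Finset.univ : Finset J)) (g : Finset J → (J → K) → ℝ),
      (∀ A ∈ Q.parts, Dep (g A) A) → ∀ y : J → K,
        ∑ i, a i * (∏ j, √(μ.real (B (i j)).1)) * ∏ A ∈ Q.parts, g A i ≤
          v * α ^ (Q.parts.card - 1) * ∏ A ∈ Q.parts, √(marg A (fun i => g A i ^ 2) y) := by
    intro Q g hg y
    set N : Finset J → ℝ := fun A => √(marg A (fun i => g A i ^ 2) y) with hN
    have hN2 : ∀ A, N A ^ 2 = marg A (fun i => g A i ^ 2) y := fun A =>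
      Real.sq_sqrt (marg_nonneg (fun _ => sq_nonneg _) y)
    by_cases h0 : ∃ A ∈ Q.parts, N A = 0
    · obtain ⟨A, hA, hNA⟩ := h0
      have hz : ∀ i, g A i = 0 := by
        intro i
        have h1 : marg A (fun i => g A i ^ 2) y = 0 := by rw [← hN2, hNA]; simp
        rw [← sum_extend_eq_marg, Finset.sum_eq_zero_iff_of_nonneg fun _ _ => sq_nonneg _] at h1
        have h2 := h1 (fun j => i j) (Finset.mem_univ _)
        rw [hg A hA i (Function.extend Subtype.val (fun j : A => i j) y)]
        · simpa using h2
        · intro j hj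
          exact (Subtype.val_injective.extend_apply (fun j : A => i j) y ⟨j, hj⟩).symm
      rw [Finset.prod_eq_zero hA hNA, mul_zero]
      refine le_of_eq (Finset.sum_eq_zero fun i _ => ?_)
      rw [Finset.prod_eq_zero hA (hz i), mul_zero]
    · push Not at h0
      -- For a set of measure zero the inverse is read as 0. The norm can only decrease by this, and
      -- the sum is unaffected because the tensor has the factor 0 there.
      set b : (A : Finset J) → (A → K) → ℝ := fun A i =>
        g A (Function.extend Subtype.val i y) * ∏ j, (√(μ.real (B (i j)).1))⁻¹ with hb
      set f : (A : Finset J) → (A → X) → ℝ := fun A z => (N A)⁻¹ * stepFun B (b A) z with hf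
      have hfu : f ∈ unitFamilies μ Q := by
        intro A hA
        refine ⟨(memLp_stepFun hB _).const_mul _, ?_⟩
        have h1 : ∀ z, f A z ^ 2 = (N A ^ 2)⁻¹ * stepFun B (fun i => b A i * b A i) z := by
          intro z
          rw [hf, ← stepFun_mul hB, mul_pow, inv_pow, sq (stepFun B _ _)]
        simp only [h1]
        rw [integral_const_mul, integral_stepFun]
        have hpos : 0 < N A ^ 2 := by
          have := h0 A hA
          positivity
        rw [inv_mul_le_iff₀ hpos, mul_one, hN2, ← sum_extend_eq_marg]
        refine Finset.sum_le_sum fun i _ => ?_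
        have h2 : b A i * b A i * ∏ j, μ.real (B (i j)).1 =
            g A (Function.extend Subtype.val i y) ^ 2 *
              ∏ j, ((√(μ.real (B (i j)).1))⁻¹ * (√(μ.real (B (i j)).1))⁻¹ *
                μ.real (B (i j)).1) := by
          rw [Finset.prod_mul_distrib, Finset.prod_mul_distrib, hb]; ring
        rw [h2]
        refine mul_le_of_le_one_right (sq_nonneg _) (Finset.prod_le_one (fun j _ => ?_)
          fun j _ => ?_)
        · have : 0 ≤ μ.real (B (i j)).1 := measureReal_nonneg
          positivity
        · have h3 : 0 ≤ μ.real (B (i j)).1 := measureReal_nonneg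
          rw [← mul_inv, Real.mul_self_sqrt h3]
          exact inv_mul_le_one
      have h4 := (le_VPart (memLp_stepFun hB a) hfu).trans (h Q)
      have h5 : ∀ x : J → X, stepFun B a x * ∏ A ∈ Q.parts, f A (fun j => x j) =
          (∏ A ∈ Q.parts, (N A)⁻¹) *
            stepFun B (fun i => a i * ∏ A ∈ Q.parts, b A fun j => i j) x := by
        intro x
        simp only [hf, Finset.prod_mul_distrib]
        by_cases hx : ∀ j, ∃ c, x j ∈ (B c).1
        · choose i hi using hx
          rw [stepFun_of_mem hB _ hi, stepFun_of_mem hB _ hi,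
            Finset.prod_congr rfl fun A _ =>
              stepFun_of_mem hB (b A) (x := fun j => x j) (i := fun j => i j) fun j => hi j]
          ring
        · push Not at hx
          obtain ⟨j, hj⟩ := hx
          rw [stepFun_of_notMem _ hj, stepFun_of_notMem _ hj]
          ring
      simp only [h5] at h4
      rw [integral_const_mul, integral_stepFun, Finset.prod_inv_distrib] at h4
      have hNpos : 0 < ∏ A ∈ Q.parts, N A := Finset.prod_pos fun A hA =>
        lt_of_le_of_ne (Real.sqrt_nonneg _) (h0 A hA).symm
      rw [inv_mul_le_iff₀ hNpos] at h4
      refine le_of_eq_of_le (Finset.sum_congr rfl fun i _ => ?_) (h4.trans_eq (mul_comm _ _))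
      have h6 : ∏ A ∈ Q.parts, b A (fun j => i j) =
          (∏ A ∈ Q.parts, g A i) * ∏ j, (√(μ.real (B (i j)).1))⁻¹ := by
        simp only [hb, Finset.prod_mul_distrib]
        congr 1
        · refine Finset.prod_congr rfl fun A hA => ?_
          refine hg A hA _ _ fun j hj => ?_
          exact Subtype.val_injective.extend_apply _ _ (⟨j, hj⟩ : A)
        · have h8 := Finset.prod_biUnion (f := fun j => (√(μ.real (B (i j)).1))⁻¹) Q.disjoint
          rw [show Q.parts.biUnion id = Finset.univ from Q.biUnion_parts] at h8
          rw [h8]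
          refine Finset.prod_congr rfl fun A _ => ?_
          exact Finset.prod_coe_sort A fun j => (√(μ.real (B (i j)).1))⁻¹
      have h7 : ∏ j, √(μ.real (B (i j)).1) =
          (∏ j, (√(μ.real (B (i j)).1))⁻¹) * ∏ j, μ.real (B (i j)).1 := by
        rw [← Finset.prod_mul_distrib]
        refine Finset.prod_congr rfl fun j _ => ?_
        rw [inv_mul_eq_div, Real.div_sqrt]
      rw [h6, h7]
      ring
  intro Q g hg y
  rw [abs_le']
  refine ⟨main Q g hg y, ?_⟩
  -- Changing the sign of the test function on a single block reverses the sign of the sum and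
  -- preserves all norms, which gives the lower bound.
  obtain ⟨A₀, hA₀⟩ := Q.parts_nonempty (Finset.univ_nonempty (α := J)).ne_empty
  have h1 := main Q (fun A => if A = A₀ then fun i => - g A i else g A) (by
    intro A hA
    by_cases hAA : A = A₀
    · simp only [hAA, if_true]
      exact fun x z hxz => congrArg Neg.neg (hg A₀ hA₀ x z hxz)
    · simp only [hAA, if_false]; exact hg A hA) y
  have h2 : ∀ A, (fun i => (if A = A₀ then fun i => - g A i else g A) i ^ 2) =
      fun i => g A i ^ 2 := by
    intro A; ext i; split_ifs <;> simp
  simp only [h2] at h1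
  refine le_of_eq_of_le ?_ h1
  rw [← Finset.sum_neg_distrib]
  refine Finset.sum_congr rfl fun i _ => ?_
  rw [← Finset.mul_prod_erase _ _ hA₀, ← Finset.mul_prod_erase Q.parts (fun A =>
    (if A = A₀ then fun i => - g A i else g A) i) hA₀, if_pos rfl]
  have h3 : ∏ A ∈ Q.parts.erase A₀, (if A = A₀ then fun i => - g A i else g A) i =
      ∏ A ∈ Q.parts.erase A₀, g A i :=
    Finset.prod_congr rfl fun A hA => by rw [if_neg (Finset.ne_of_mem_erase hA)]
  rw [h3]
  ring

end StepBound

end WienerIto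

/-! ### Splitting sets under a non-atomic measure. -/

namespace WienerIto

section Nonatomic

variable {X : Type*} [MeasurableSpace X] {μ : Measure X}

theorem IsNonatomic.exists_subset_le_half (hμ : IsNonatomic μ) {A : Set X} (hA : MeasurableSet A)
    (h0 : 0 < μ A) : ∃ B ⊆ A, MeasurableSet B ∧ 0 < μ B ∧ μ B ≤ μ A / 2 := by
  obtain ⟨B, hBA, hB, hB0, hBlt⟩ := hμ A hA h0
  have hadd : μ B + μ (A \ B) = μ A := by
    rw [← measure_inter_add_sdiff A hB, Set.inter_eq_right.mpr hBA]
  by_cases h : μ B ≤ μ A / 2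
  · exact ⟨B, hBA, hB, hB0, h⟩
  refine ⟨A \ B, Set.sdiff_subset, hA.diff hB, ?_, ?_⟩
  · rw [pos_iff_ne_zero]
    intro h1
    rw [h1, add_zero] at hadd
    exact hBlt.ne hadd
  · by_contra h1
    push Not at h h1
    have := ENNReal.add_lt_add h h1
    rw [hadd, ENNReal.add_halves] at this
    exact lt_irrefl _ this

theorem IsNonatomic.exists_subset_le (hμ : IsNonatomic μ) {A : Set X} (hA : MeasurableSet A)
    (h0 : 0 < μ A) (hfin : μ A ≠ ⊤) {ε : ENNReal} (hε : 0 < ε) :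
    ∃ B ⊆ A, MeasurableSet B ∧ 0 < μ B ∧ μ B ≤ ε := by
  have h1 : ∀ n : ℕ, ∃ B ⊆ A, MeasurableSet B ∧ 0 < μ B ∧ μ B ≤ μ A * 2⁻¹ ^ n := by
    intro n
    induction n with
    | zero => exact ⟨A, subset_rfl, hA, h0, by simp⟩
    | succ n ih =>
      obtain ⟨B, hBA, hB, hB0, hBle⟩ := ih
      obtain ⟨C, hCB, hC, hC0, hCle⟩ :=
        hμ.exists_subset_le_half hB hB0
      refine ⟨C, hCB.trans hBA, hC, hC0, hCle.trans ?_⟩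
      rw [pow_succ, ← mul_assoc, div_eq_mul_inv]
      gcongr
  have h2 : Tendsto (fun n : ℕ => μ A * 2⁻¹ ^ n) atTop (𝓝 0) := by
    have := ENNReal.Tendsto.const_mul (a := μ A)
      (ENNReal.tendsto_pow_atTop_nhds_zero_of_lt_one (r := 2⁻¹) (by simp)) (Or.inr hfin)
    simpa using this
  obtain ⟨n, hn⟩ := (h2.eventually_lt_const hε).exists
  obtain ⟨B, hBA, hB, hB0, hBle⟩ := h1 n
  exact ⟨B, hBA, hB, hB0, hBle.trans hn.le⟩

/-- Even and odd values keep the pieces of the two sets apart. -/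
theorem exists_simpleFunc_union {G G' : Set X} (hG : MeasurableSet G) {ε : ENNReal}
    (h : ∃ τ : SimpleFunc X ℕ, ∀ c, μ (G ∩ τ ⁻¹' {c}) ≤ ε)
    (h' : ∃ τ : SimpleFunc X ℕ, ∀ c, μ (G' ∩ τ ⁻¹' {c}) ≤ ε) :
    ∃ τ : SimpleFunc X ℕ, ∀ c, μ ((G ∪ G') ∩ τ ⁻¹' {c}) ≤ ε := by
  obtain ⟨τ, hτ⟩ := h
  obtain ⟨τ', hτ'⟩ := h'
  refine ⟨SimpleFunc.piecewise G hG (τ.map fun c => 2 * c) (τ'.map fun c => 2 * c + 1),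
    fun c => ?_⟩
  rcases Nat.even_or_odd' c with ⟨d, rfl | rfl⟩
  · refine (measure_mono ?_).trans (hτ d)
    rintro x ⟨hx, hxc⟩
    by_cases hxG : x ∈ G
    · have : τ x = d := by simpa [hxG] using hxc
      exact ⟨hxG, this⟩
    · exfalso
      have : 2 * τ' x + 1 = 2 * d := by simpa [hxG] using hxc
      omega
  · refine (measure_mono ?_).trans (hτ' d)
    rintro x ⟨hx, hxc⟩
    by_cases hxG : x ∈ G
    · exfalso
      have : 2 * τ x = 2 * d + 1 := by simpa [hxG] using hxc
      omega
    · have : τ' x = d := by simpa [hxG] using hxc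
      exact ⟨hx.resolve_left hxG, this⟩

/-- A set of finite measure is split into finitely many sets of small measure. -/
theorem IsNonatomic.exists_simpleFunc (hμ : IsNonatomic μ) {A : Set X} (hA : MeasurableSet A)
    (hfin : μ A ≠ ⊤) {ε : ENNReal} (hε : 0 < ε) :
    ∃ τ : SimpleFunc X ℕ, ∀ c, μ (A ∩ τ ⁻¹' {c}) ≤ ε := by
  have hsmall : ∀ C, μ C ≤ ε → ∃ τ : SimpleFunc X ℕ, ∀ c, μ (C ∩ τ ⁻¹' {c}) ≤ ε := fun C hC =>
    ⟨SimpleFunc.const X 0, fun c => (measure_mono Set.inter_subset_left).trans hC⟩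
  -- Exhaustion: `S` collects the measures of the subsets that can be split into small pieces.
  -- Countably many such sets nearly attaining the supremum cover `A` up to a null set, since
  -- otherwise a small subset of the remainder could be added. After finitely many of them the
  -- remainder is itself a small piece.
  set S : Set ENNReal := μ '' {G | G ⊆ A ∧ MeasurableSet G ∧
    ∃ τ : SimpleFunc X ℕ, ∀ c, μ (G ∩ τ ⁻¹' {c}) ≤ ε} with hS
  have hSne : S.Nonempty := ⟨_, ∅, ⟨by simp, by simp, hsmall ∅ (by simp)⟩, rfl⟩
  obtain ⟨u, -, hu, huS⟩ := exists_seq_tendsto_sSup hSne (OrderTop.bddAbove S)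
  choose G hG hGu using huS
  have hacc : ∀ n, Set.accumulate G n ⊆ A ∧ MeasurableSet (Set.accumulate G n) ∧
      ∃ τ : SimpleFunc X ℕ, ∀ c, μ (Set.accumulate G n ∩ τ ⁻¹' {c}) ≤ ε := by
    intro n
    induction n with
    | zero => simpa [Set.accumulate_zero_nat] using hG 0
    | succ n ih =>
      rw [Set.accumulate_succ]
      exact ⟨Set.union_subset ih.1 (hG _).1, ih.2.1.union (hG _).2.1,
        exists_simpleFunc_union ih.2.1 ih.2.2 (hG _).2.2⟩
  have hlim : Tendsto (fun n => μ (Set.accumulate G n)) atTop (𝓝 (μ (⋃ n, G n))) :=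
    tendsto_measure_iUnion_accumulate
  have hUA : ⋃ n, G n ⊆ A := Set.iUnion_subset fun n => (hG n).1
  have hUm : MeasurableSet (⋃ n, G n) := MeasurableSet.iUnion fun n => (hG n).2.1
  have hsup : sSup S ≤ μ (⋃ n, G n) :=
    le_of_tendsto' hu fun n => (hGu n).symm.le.trans (measure_mono (Set.subset_iUnion G n))
  have hzero : μ (A \ ⋃ n, G n) = 0 := by
    by_contra hne
    obtain ⟨C, hCA, hC, hC0, hCε⟩ := hμ.exists_subset_le (hA.diff hUm) (pos_iff_ne_zero.mpr hne)
      (measure_ne_top_of_subset Set.sdiff_subset hfin) hε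
    have h1 : ∀ n, μ (Set.accumulate G n) + μ C ≤ sSup S := by
      intro n
      rw [← measure_union _ hC]
      · exact le_sSup ⟨_, ⟨Set.union_subset (hacc n).1 (hCA.trans Set.sdiff_subset),
          (hacc n).2.1.union hC, exists_simpleFunc_union (hacc n).2.1 (hacc n).2.2
            (hsmall C hCε)⟩, rfl⟩
      · exact (Set.disjoint_left.mpr fun x hx hxC => (hCA hxC).2
          (Set.accumulate_subset_iUnion n hx))
    have h2 := (le_of_tendsto' (hlim.add_const (μ C)) h1).trans hsup
    have h3 : μ (⋃ n, G n) ≠ ⊤ := measure_ne_top_of_subset hUA hfin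
    exact (ENNReal.lt_add_right h3 hC0.ne').not_ge h2
  have hdiff : Tendsto (fun n => μ (A \ Set.accumulate G n)) atTop (𝓝 0) := by
    have h1 : ∀ n, μ (A \ Set.accumulate G n) = μ A - μ (Set.accumulate G n) := fun n =>
      measure_sdiff (hacc n).1 (hacc n).2.1.nullMeasurableSet
        (measure_ne_top_of_subset (hacc n).1 hfin)
    have h2 : μ A - μ (⋃ n, G n) = 0 := by
      rw [← measure_sdiff hUA hUm.nullMeasurableSet (measure_ne_top_of_subset hUA hfin), hzero]
    simp only [h1]
    rw [← h2]
    exact ENNReal.Tendsto.sub tendsto_const_nhds hlim (Or.inl hfin)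
  obtain ⟨n, hn⟩ := (hdiff.eventually_lt_const hε).exists
  have := exists_simpleFunc_union (hacc n).2.1 (hacc n).2.2 (hsmall _ hn.le)
  rwa [Set.union_sdiff_cancel (hacc n).1] at this

end Nonatomic

/-! ### Density of the elementary functions. -/

section Density

set_option linter.unusedSectionVars false

variable {X Ω : Type*} [MeasurableSpace X] {μ : Measure X} [SigmaFinite μ]
  {W : FinMeasSet μ → Ω → ℝ} {k : ℕ}

theorem aestronglyMeasurable_fst {p : ((Fin k → X) → ℝ) × (Ω → ℝ)}
    (hp : p ∈ elementaryIntegrals W k) :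
    AEStronglyMeasurable p.1 (Measure.pi fun _ : Fin k => μ) := by
  induction hp using Submodule.span_induction with
  | mem p hp =>
    obtain ⟨A, _, rfl⟩ := hp
    exact aestronglyMeasurable_const.indicator (MeasurableSet.univ_pi fun j => (A j).2.1)
  | zero => exact aestronglyMeasurable_zero
  | add p q _ _ h1 h2 => exact h1.add h2
  | smul c p _ h => exact h.const_smul c

/-- `F` is a limit in `L²(μ^k)` of elementary functions. -/
def IsElementaryLimit (W : FinMeasSet μ → Ω → ℝ) (F : (Fin k → X) → ℝ) : Prop :=
  ∀ ε : ENNReal, ε ≠ 0 → ∃ p ∈ elementaryIntegrals W k,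
    eLpNorm (p.1 - F) 2 (Measure.pi fun _ : Fin k => μ) ≤ ε

variable {F F' : (Fin k → X) → ℝ}

theorem isElementaryLimit_of_approx (hF : AEStronglyMeasurable F (Measure.pi fun _ => μ))
    (h : ∀ ε : ENNReal, ε ≠ 0 → ∃ F', AEStronglyMeasurable F' (Measure.pi fun _ => μ) ∧
      IsElementaryLimit W F' ∧ eLpNorm (F' - F) 2 (Measure.pi fun _ => μ) ≤ ε) :
    IsElementaryLimit W F := by
  intro ε hε
  obtain ⟨F', hF', hF'W, hle⟩ := h (ε / 2) (ENNReal.half_pos hε).ne'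
  obtain ⟨p, hp, hpF⟩ := hF'W (ε / 2) (ENNReal.half_pos hε).ne'
  refine ⟨p, hp, ?_⟩
  rw [← sub_add_sub_cancel p.1 F' F]
  refine (eLpNorm_add_le ((aestronglyMeasurable_fst hp).sub hF') (hF'.sub hF)
    (by norm_num)).trans ((add_le_add hpF hle).trans_eq (ENNReal.add_halves ε))

theorem IsElementaryLimit.add (hF : AEStronglyMeasurable F (Measure.pi fun _ => μ))
    (hF' : AEStronglyMeasurable F' (Measure.pi fun _ => μ)) (h : IsElementaryLimit W F)
    (h' : IsElementaryLimit W F') : IsElementaryLimit W (F + F') := by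
  intro ε hε
  obtain ⟨p, hp, hpF⟩ := h (ε / 2) (ENNReal.half_pos hε).ne'
  obtain ⟨q, hq, hqF⟩ := h' (ε / 2) (ENNReal.half_pos hε).ne'
  refine ⟨p + q, Submodule.add_mem _ hp hq, ?_⟩
  rw [Prod.fst_add, add_sub_add_comm]
  exact (eLpNorm_add_le ((aestronglyMeasurable_fst hp).sub hF)
    ((aestronglyMeasurable_fst hq).sub hF') (by norm_num)).trans
      ((add_le_add hpF hqF).trans_eq (ENNReal.add_halves ε))

theorem IsElementaryLimit.const_smul (c : ℝ) (h : IsElementaryLimit W F) :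
    IsElementaryLimit W (c • F) := by
  intro ε hε
  by_cases hc : c = 0
  · exact ⟨0, Submodule.zero_mem _, by simp [hc]⟩
  obtain ⟨p, hp, hpF⟩ := h (ε / ‖c‖ₑ) (by simp [hε])
  refine ⟨c • p, Submodule.smul_mem _ c hp, ?_⟩
  rw [Prod.smul_fst, ← smul_sub, eLpNorm_const_smul]
  refine (mul_le_mul_right hpF _).trans ENNReal.mul_div_le

theorem isElementaryLimit_indicator {S : Set (Fin k → X)} (hS : MeasurableSet S)
    (h : ∀ ε : ENNReal, ε ≠ 0 → ∃ T ⊆ S, MeasurableSet T ∧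
      IsElementaryLimit W (T.indicator fun _ => (1 : ℝ)) ∧
      Measure.pi (fun _ : Fin k => μ) (S \ T) ≤ ε) :
    IsElementaryLimit W (S.indicator fun _ => (1 : ℝ)) := by
  refine isElementaryLimit_of_approx (aestronglyMeasurable_const.indicator hS) fun ε hε => ?_
  obtain ⟨T, hTS, hT, hTW, hle⟩ := h (ε ^ 2) (pow_ne_zero _ hε)
  refine ⟨_, aestronglyMeasurable_const.indicator hT, hTW, ?_⟩
  rw [eLpNorm_sub_comm, ← Set.indicator_sdiff hTS,
    eLpNorm_indicator_const (hS.diff hT) two_ne_zero ENNReal.ofNat_ne_top]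
  rw [enorm_one, one_mul]
  refine (ENNReal.rpow_le_rpow hle (by positivity)).trans_eq ?_
  rw [← ENNReal.rpow_natCast, ← ENNReal.rpow_mul]
  norm_num

/-- This is where non-atomicity enters. The sides are divided into pieces of measure at most δ; the
products of distinct pieces form an elementary function, and the points with two coordinates in the
same piece have small total measure. -/
theorem isElementaryLimit_box (hμ : IsNonatomic μ) (A : Fin k → FinMeasSet μ) :
    IsElementaryLimit W ((Set.univ.pi fun j => (A j).1).indicator fun _ => (1 : ℝ)) := by
  set ν := Measure.pi fun _ : Fin k => μ with hν
  have hAm : MeasurableSet (Set.univ.pi fun j => (A j).1) :=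
    MeasurableSet.univ_pi fun j => (A j).2.1
  refine isElementaryLimit_indicator hAm fun ε hε => ?_
  set U : Set X := ⋃ j, (A j).1 with hU
  have hUm : MeasurableSet U := MeasurableSet.iUnion fun j => (A j).2.1
  have hUfin : μ U ≠ ⊤ := by
    refine ((measure_iUnion_le _).trans_lt ?_).ne
    rw [tsum_fintype]
    exact ENNReal.sum_lt_top.mpr fun j _ => (A j).2.2
  -- For each of at most k² pairs of coordinates the two lie in a common piece on a set of measure
  -- at most δ μ(U) μ(U)^(k-2): one coordinate costs δ, and the other sums to μ(U) over the pieces.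
  obtain ⟨δ, hδ, hδε⟩ : ∃ δ : ENNReal, 0 < δ ∧
      (k * k : ℕ) * (δ * (μ U * μ U ^ (k - 2))) ≤ ε := by
    refine ⟨ε / ((k * k : ℕ) * (μ U * μ U ^ (k - 2))), ENNReal.div_pos hε ?_, ?_⟩
    · exact ENNReal.mul_ne_top (ENNReal.natCast_ne_top _)
        (ENNReal.mul_ne_top hUfin (ENNReal.pow_ne_top hUfin))
    · rw [mul_left_comm, mul_comm]
      exact ENNReal.mul_div_le
  obtain ⟨τ, hτ⟩ := hμ.exists_simpleFunc hUm hUfin hδ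
  have hτm : ∀ c, MeasurableSet (τ ⁻¹' {c}) := fun c => τ.measurableSet_preimage _
  have hinjm : MeasurableSet {x : Fin k → X | Function.Injective fun j => τ (x j)} := by
    have : {x : Fin k → X | Function.Injective fun j => τ (x j)} =
        (fun (x : Fin k → X) j => τ (x j)) ⁻¹' {c | Function.Injective c} := rfl
    rw [this]
    exact (measurable_pi_lambda _ fun j => τ.measurable.comp (measurable_pi_apply j))
      (Set.to_countable _).measurableSet
  refine ⟨(Set.univ.pi fun j => (A j).1) ∩ {x | Function.Injective fun j => τ (x j)},
    Set.inter_subset_left, hAm.inter hinjm, ?_, ?_⟩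
  · classical
    set D : (Fin k → ℕ) → Fin k → FinMeasSet μ := fun c j =>
      ⟨(A j).1 ∩ τ ⁻¹' {c j}, (A j).2.1.inter (hτm _),
        (measure_mono Set.inter_subset_left).trans_lt (A j).2.2⟩ with hD
    set I : Finset (Fin k → ℕ) :=
      (Fintype.piFinset fun _ => τ.range).filter Function.Injective with hI
    intro ε' _
    refine ⟨∑ c ∈ I, (Set.indicator (Set.univ.pi fun j => (D c j).1) (fun _ => (1 : ℝ)),
        fun ω => ∏ j, W (D c j) ω), Submodule.sum_mem _ fun c hc => ?_, ?_⟩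
    · refine Submodule.subset_span ⟨D c, ?_, rfl⟩
      intro i j hij
      refine Set.disjoint_left.mpr ?_
      rintro x ⟨_, hx⟩ ⟨_, hx'⟩
      exact hij ((Finset.mem_filter.mp hc).2 (Eq.trans (Eq.symm hx) hx'))
    · refine le_of_eq_of_le ?_ zero_le
      convert eLpNorm_zero (p := 2) (μ := ν) (ε := ℝ)
      rw [sub_eq_zero, Prod.fst_sum]
      ext x
      simp only [Finset.sum_apply]
      by_cases hx : x ∈ (Set.univ.pi fun j => (A j).1) ∩ {x | Function.Injective fun j => τ (x j)}
      · rw [Set.indicator_of_mem hx, Finset.sum_eq_single fun j => τ (x j)]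
        · rw [Set.indicator_of_mem]
          exact fun j _ => ⟨hx.1 j trivial, rfl⟩
        · intro c _ hc
          refine Set.indicator_of_notMem (fun h => hc ?_) _
          ext j
          exact (h j trivial).2.symm
        · intro h
          refine absurd ?_ h
          simp only [hI, Finset.mem_filter, Fintype.mem_piFinset]
          exact ⟨fun j => τ.mem_range_self _, hx.2⟩
      · rw [Set.indicator_of_notMem hx]
        refine Finset.sum_eq_zero fun c hc => Set.indicator_of_notMem (fun h => hx ?_) _
        refine ⟨fun j _ => (h j trivial).1, ?_⟩
        have : (fun j => τ (x j)) = c := by ext j; exact (h j trivial).2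
        show Function.Injective fun j => τ (x j)
        rw [this]
        exact (Finset.mem_filter.mp hc).2
  · classical
    set E : Fin k → Fin k → ℕ → Fin k → Set X := fun i j c l =>
      if l = i ∨ l = j then U ∩ τ ⁻¹' {c} else U with hE
    have hcover : (Set.univ.pi fun j => (A j).1) \
        ((Set.univ.pi fun j => (A j).1) ∩ {x | Function.Injective fun j => τ (x j)}) ⊆
        ⋃ q ∈ Finset.univ.filter (fun q : Fin k × Fin k => q.1 ≠ q.2), ⋃ c ∈ τ.range,
          Set.univ.pi (E q.1 q.2 c) := by
      rintro x ⟨hx, hx'⟩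
      have hninj : ¬ Function.Injective fun j => τ (x j) := fun h => hx' ⟨hx, h⟩
      rw [Function.Injective] at hninj
      push Not at hninj
      obtain ⟨i, j, hij, hne⟩ := hninj
      have hxU : ∀ l, x l ∈ U := fun l => Set.mem_iUnion.mpr ⟨l, hx l trivial⟩
      simp only [Set.mem_iUnion]
      refine ⟨(i, j), by simpa using hne, τ (x i), τ.mem_range_self _, fun l _ => ?_⟩
      simp only [hE]
      split_ifs with hl
      · rcases hl with rfl | rfl
        · exact ⟨hxU _, rfl⟩
        · exact ⟨hxU _, hij.symm⟩
      · exact hxU l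
    refine (measure_mono hcover).trans ((measure_biUnion_finset_le _ _).trans ?_)
    have hq : ∀ q ∈ Finset.univ.filter (fun q : Fin k × Fin k => q.1 ≠ q.2),
        ν (⋃ c ∈ τ.range, Set.univ.pi (E q.1 q.2 c)) ≤ δ * (μ U * μ U ^ (k - 2)) := by
      intro q hq
      have hne : q.1 ≠ q.2 := (Finset.mem_filter.mp hq).2
      have h1 : ∀ c, ν (Set.univ.pi (E q.1 q.2 c)) ≤
          δ * (μ (U ∩ τ ⁻¹' {c}) * μ U ^ (k - 2)) := by
        intro c
        rw [hν, Measure.pi_pi, ← Finset.mul_prod_erase _ _ (Finset.mem_univ q.1),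
          ← Finset.mul_prod_erase _ _ (Finset.mem_erase.mpr ⟨hne.symm, Finset.mem_univ q.2⟩)]
        have h2 : ∏ l ∈ (Finset.univ.erase q.1).erase q.2, μ (E q.1 q.2 c l) =
            μ U ^ (k - 2) := by
          rw [Finset.prod_congr rfl (g := fun _ => μ U), Finset.prod_const,
            Finset.card_erase_of_mem (by simp [hne.symm]), Finset.card_erase_of_mem (by simp),
            Finset.card_univ, Fintype.card_fin, Nat.sub_sub]
          intro l hl
          simp only [Finset.mem_erase] at hl
          simp [hE, hl.1, hl.2.1]
        rw [h2]
        simp only [hE, true_or, or_true, if_true]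
        gcongr
        exact hτ c
      refine (measure_biUnion_finset_le _ _).trans ((Finset.sum_le_sum fun c _ => h1 c).trans ?_)
      rw [← Finset.mul_sum, ← Finset.sum_mul]
      gcongr
      rw [← measure_biUnion_finset]
      · exact measure_mono (Set.iUnion₂_subset fun c _ => Set.inter_subset_left)
      · intro c _ d _ hcd
        refine Set.disjoint_left.mpr ?_
        rintro x ⟨_, hx⟩ ⟨_, hx'⟩
        exact hcd (Eq.trans (Eq.symm hx) hx')
      · exact fun c _ => hUm.inter (hτm c)
    refine (Finset.sum_le_sum hq).trans (le_trans ?_ hδε)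
    rw [Finset.sum_const, nsmul_eq_mul]
    gcongr
    refine (Finset.card_filter_le _ _).trans ?_
    simp

/-- The elementary functions are dense in `L²(μ^k)`. -/
theorem isElementaryLimit_of_memLp (hμ : IsNonatomic μ)
    (hF : MemLp F 2 (Measure.pi fun _ : Fin k => μ)) : IsElementaryLimit W F := by
  set ν := Measure.pi fun _ : Fin k => μ with hν
  set R : ℕ → Set (Fin k → X) := fun n => Set.univ.pi fun _ => spanningSets μ n with hR
  have hRm : ∀ n, MeasurableSet (R n) := fun n =>
    MeasurableSet.univ_pi fun _ => measurableSet_spanningSets μ n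
  have hRfin : ∀ n, ν (R n) ≠ ⊤ := by
    intro n
    rw [hν, Measure.pi_pi]
    exact (ENNReal.prod_lt_top fun _ _ => measure_spanningSets_lt_top μ n).ne
  -- A π-λ argument inside a cube of finite measure, so that complements can be taken.
  have hbox : ∀ (n : ℕ) (S : Set (Fin k → X)), MeasurableSet S →
      IsElementaryLimit W ((S ∩ R n).indicator fun _ => (1 : ℝ)) := by
    intro n
    refine MeasurableSpace.induction_on_inter generateFrom_pi.symm isPiSystem_pi ?_ ?_ ?_ ?_
    · simp only [Set.empty_inter, Set.indicator_empty]
      exact fun ε _ => ⟨0, Submodule.zero_mem _, by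
        simp [show (fun _ : Fin k → X => (0 : ℝ)) = 0 from rfl]⟩
    · rintro _ ⟨A, hA, rfl⟩
      have hA' : ∀ j, MeasurableSet (A j) := fun j => hA j trivial
      rw [hR, ← Set.pi_inter_distrib]
      exact isElementaryLimit_box hμ fun j => ⟨A j ∩ spanningSets μ n,
        (hA' j).inter (measurableSet_spanningSets μ n),
        (measure_mono Set.inter_subset_right).trans_lt (measure_spanningSets_lt_top μ n)⟩
    · intro S hS hSW
      have h1 : (Sᶜ ∩ R n).indicator (fun _ => (1 : ℝ)) =
          (R n).indicator (fun _ => (1 : ℝ)) + (-1 : ℝ) • (S ∩ R n).indicator fun _ => (1 : ℝ) := by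
        ext x
        by_cases hx : x ∈ R n <;> by_cases hxS : x ∈ S <;> simp [hx, hxS]
      rw [h1]
      refine IsElementaryLimit.add (aestronglyMeasurable_const.indicator (hRm n))
        ((aestronglyMeasurable_const.indicator (hS.inter (hRm n))).const_smul _) ?_
        (hSW.const_smul _)
      exact isElementaryLimit_box hμ fun j => ⟨spanningSets μ n,
        measurableSet_spanningSets μ n, measure_spanningSets_lt_top μ n⟩
    · intro S hd hS hSW
      refine isElementaryLimit_indicator ((MeasurableSet.iUnion hS).inter (hRm n)) fun ε hε => ?_
      have hm' : ∀ m, MeasurableSet (Set.accumulate (fun i => S i ∩ R n) m) := fun m =>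
        MeasurableSet.biUnion (Set.to_countable _) fun i _ => (hS i).inter (hRm n)
      have hlim : Tendsto (fun m => ν ((⋃ i, S i ∩ R n) \ Set.accumulate (fun i => S i ∩ R n) m))
          atTop (𝓝 0) := by
        have hfin : ν (⋃ i, S i ∩ R n) ≠ ⊤ :=
          measure_ne_top_of_subset (Set.iUnion_subset fun i => Set.inter_subset_right) (hRfin n)
        have h1 : ∀ m, ν ((⋃ i, S i ∩ R n) \ Set.accumulate (fun i => S i ∩ R n) m) =
            ν (⋃ i, S i ∩ R n) - ν (Set.accumulate (fun i => S i ∩ R n) m) := fun m =>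
          measure_sdiff (Set.accumulate_subset_iUnion m)
            (hm' m).nullMeasurableSet
            (measure_ne_top_of_subset (Set.accumulate_subset_iUnion m) hfin)
        simp only [h1]
        rw [← tsub_self (ν (⋃ i, S i ∩ R n))]
        exact ENNReal.Tendsto.sub tendsto_const_nhds tendsto_measure_iUnion_accumulate
          (Or.inl hfin)
      obtain ⟨m, hm⟩ := (hlim.eventually_lt_const (pos_iff_ne_zero.mpr hε)).exists
      have hacc : ∀ m, IsElementaryLimit W
          ((Set.accumulate (fun i => S i ∩ R n) m).indicator fun _ => (1 : ℝ)) := by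
        intro m
        induction m with
        | zero => simpa [Set.accumulate_zero_nat] using hSW 0
        | succ m ih =>
          rw [Set.accumulate_succ, Set.indicator_union_of_disjoint]
          · exact ih.add (aestronglyMeasurable_const.indicator (hm' m))
              (aestronglyMeasurable_const.indicator ((hS _).inter (hRm n))) (hSW _)
          · exact Set.disjoint_accumulate (hd.mono fun i j h =>
              h.mono Set.inter_subset_left Set.inter_subset_left) m.lt_succ_self
      rw [Set.iUnion_inter]
      refine ⟨Set.accumulate (fun i => S i ∩ R n) m, Set.accumulate_subset_iUnion m,
        hm' m, hacc m, hm.le⟩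
  have hset : ∀ S : Set (Fin k → X), MeasurableSet S → ν S < ⊤ →
      IsElementaryLimit W (S.indicator fun _ => (1 : ℝ)) := by
    intro S hS hfin
    refine isElementaryLimit_indicator hS fun ε hε => ?_
    have hRU : ⋂ n, S \ R n = ∅ := by
      rw [Set.eq_empty_iff_forall_notMem]
      intro x hx
      refine (Set.mem_iInter.mp hx (Finset.univ.sup fun j => spanningSetsIndex μ (x j))).2
        fun j _ => ?_
      exact monotone_spanningSets μ (Finset.le_sup (f := fun j => spanningSetsIndex μ (x j))
        (Finset.mem_univ j)) (mem_spanningSetsIndex μ (x j))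
    have hlim : Tendsto (ν ∘ fun n => S \ R n) atTop (𝓝 (ν (⋂ n, S \ R n))) := by
      refine tendsto_measure_iInter_atTop (fun n => (hS.diff (hRm n)).nullMeasurableSet) ?_
        ⟨0, measure_ne_top_of_subset Set.sdiff_subset hfin.ne⟩
      intro m n hmn x hx
      exact ⟨hx.1, fun h => hx.2 fun j _ => monotone_spanningSets μ hmn (h j trivial)⟩
    rw [hRU, measure_empty] at hlim
    obtain ⟨n, hn⟩ := (hlim.eventually_lt_const (pos_iff_ne_zero.mpr hε)).exists
    refine ⟨S ∩ R n, Set.inter_subset_left, hS.inter (hRm n), hbox n S hS, ?_⟩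
    rw [Set.sdiff_self_inter]
    exact hn.le
  intro ε hε
  obtain ⟨G, hG, p, hp, rfl⟩ := hF.induction_dense ENNReal.ofNat_ne_top
    (fun G => ∃ p ∈ elementaryIntegrals W k, p.1 = G) (fun c S hS hfin ε hε => by
      obtain ⟨p, hp, hpS⟩ := (hset S hS hfin).const_smul c ε hε
      refine ⟨_, ?_, p, hp, rfl⟩
      convert hpS using 2
      ext x
      by_cases hx : x ∈ S <;> simp [hx])
    (by
      rintro _ _ ⟨p, hp, rfl⟩ ⟨q, hq, rfl⟩
      exact ⟨p + q, Submodule.add_mem _ hp hq, rfl⟩)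
    (by
      rintro _ ⟨p, hp, rfl⟩
      exact aestronglyMeasurable_fst hp) hε
  exact ⟨p, hp, by rwa [eLpNorm_sub_comm]⟩

end Density

end WienerIto

/-! ### Moments of elementary integrals. -/

namespace WienerIto

section LpNorm

variable {α : Type*} [MeasurableSpace α] {ν : Measure α} {F : α → ℝ}

theorem eLpNorm_natCast_le_iff {T : ℕ} (hT : T ≠ 0) {c : ENNReal} :
    eLpNorm F T ν ≤ c ↔ ∫⁻ x, ‖F x‖ₑ ^ T ∂ν ≤ c ^ T := by
  have h0 : (0 : ℝ) < T := by positivity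
  rw [eLpNorm_eq_lintegral_rpow_enorm_toReal (by simpa using hT) (ENNReal.natCast_ne_top T)]
  simp only [ENNReal.toReal_natCast, ENNReal.rpow_natCast, one_div]
  rw [ENNReal.rpow_inv_le_iff h0, ENNReal.rpow_natCast]

theorem lintegral_enorm_pow {T : ℕ} (hT : Even T) (hF : AEStronglyMeasurable F ν) :
    ENNReal.toReal (∫⁻ x, ‖F x‖ₑ ^ T ∂ν) = ∫ x, F x ^ T ∂ν := by
  rw [integral_eq_lintegral_of_nonneg_ae (Eventually.of_forall fun x => hT.pow_nonneg _)
    (hF.pow T)]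
  congr 1
  refine lintegral_congr fun x => ?_
  rw [← enorm_pow, Real.enorm_of_nonneg (hT.pow_nonneg _)]

theorem eLpNorm_le_of_integral_pow_le {T : ℕ} (hT : Even T) (hT0 : T ≠ 0) (hF : MemLp F T ν)
    {b : ℝ} (hb : 0 ≤ b) (h : ∫ x, F x ^ T ∂ν ≤ b ^ T) : eLpNorm F T ν ≤ ENNReal.ofReal b := by
  rw [eLpNorm_natCast_le_iff hT0, ← ENNReal.ofReal_pow hb]
  rw [← lintegral_enorm_pow hT hF.1] at h
  refine (ENNReal.le_ofReal_iff_toReal_le ?_ (by positivity)).mpr h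
  have h1 := (eLpNorm_natCast_le_iff (F := F) (ν := ν) hT0).mp le_rfl
  exact (h1.trans_lt (ENNReal.pow_lt_top hF.2)).ne

theorem integral_pow_le_of_eLpNorm_le {T : ℕ} (hT : Even T) (hT0 : T ≠ 0)
    (hF : AEStronglyMeasurable F ν) {b : ℝ} (hb : 0 ≤ b) (h : eLpNorm F T ν ≤ ENNReal.ofReal b) :
    Integrable (fun x => F x ^ T) ν ∧ ∫ x, F x ^ T ∂ν ≤ b ^ T := by
  rw [eLpNorm_natCast_le_iff hT0, ← ENNReal.ofReal_pow hb] at h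
  refine ⟨⟨hF.pow T, ?_⟩, ?_⟩
  · rw [hasFiniteIntegral_iff_enorm]
    simp only [enorm_pow]
    exact h.trans_lt ENNReal.ofReal_lt_top
  · rw [← lintegral_enorm_pow hT hF]
    exact ENNReal.toReal_le_of_le_ofReal (by positivity) h

end LpNorm

section Elementary

set_option linter.unusedSectionVars false

variable {X Ω : Type*} [MeasurableSpace X] [MeasurableSpace Ω] {μ : Measure X} [SigmaFinite μ]
    {P : Measure Ω} {W : FinMeasSet μ → Ω → ℝ} {k : ℕ} {p : ((Fin k → X) → ℝ) × (Ω → ℝ)}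

theorem eLpNorm_eq_V₁ {f : (Fin k → X) → ℝ} (hf : MemLp f 2 (Measure.pi fun _ => μ)) :
    eLpNorm f 2 (Measure.pi fun _ => μ) = ENNReal.ofReal (V₁ μ f) := by
  have h1 : eLpNorm f (2 : ℕ) (Measure.pi fun _ => μ) ≤ ENNReal.ofReal (V₁ μ f) := by
    refine eLpNorm_le_of_integral_pow_le even_two two_ne_zero (by simpa using hf) (V₁_nonneg f) ?_
    rw [V₁, Real.sq_sqrt (integral_nonneg fun _ => sq_nonneg _)]
  refine le_antisymm (by simpa using h1) ?_
  set c := eLpNorm f 2 (Measure.pi fun _ => μ) with hc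
  have hct : c ≠ ⊤ := hf.2.ne
  have h2 : eLpNorm f (2 : ℕ) (Measure.pi fun _ => μ) ≤ ENNReal.ofReal c.toReal := by
    rw [ENNReal.ofReal_toReal hct]; simp [hc]
  have h3 := (integral_pow_le_of_eLpNorm_le even_two two_ne_zero hf.1 ENNReal.toReal_nonneg h2).2
  refine (ENNReal.ofReal_le_ofReal ?_).trans_eq (ENNReal.ofReal_toReal hct)
  rw [V₁]
  exact (Real.sqrt_le_sqrt h3).trans_eq (Real.sqrt_sq ENNReal.toReal_nonneg)

theorem memLp_fst (hW : IsWhiteNoise μ P W) (hp : p ∈ elementaryIntegrals W k) :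
    MemLp p.1 2 (Measure.pi fun _ : Fin k => μ) := by
  obtain ⟨K, _, _, B, a, hB, -, h1, -⟩ := hW.exists_step hp
  rw [h1]
  exact memLp_stepFun hB a

theorem memLp_snd (hW : IsWhiteNoise μ P W) (hp : p ∈ elementaryIntegrals W k) {q : ENNReal}
    (hq : q ≠ ⊤) : MemLp p.2 q P := by
  obtain ⟨K, _, _, B, a, hB, -, -, h2⟩ := hW.exists_step hp
  exact (memLp_congr_ae h2).mpr (hW.memLp_stepIntegral B a hq)

/-- The constant in the bound of the moments. -/
noncomputable def momentConst (k : ℕ) : ℝ := (4 * k) ^ (2 * k)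

theorem one_le_momentConst (hk : 2 ≤ k) : 1 ≤ momentConst k := by
  have : (2 : ℝ) ≤ k := by exact_mod_cast hk
  exact one_le_pow₀ (by linarith)

theorem eLpNorm_snd_le (hW : IsWhiteNoise μ P W) (hk : 2 ≤ k)
    (hp : p ∈ elementaryIntegrals W k) {T : ℕ} (hT : Even T) (hT2 : 2 ≤ T) {v α : ℝ}
    (hv : 0 ≤ v) (hα : 0 < α) (hαT : (α ^ 2)⁻¹ ≤ (T : ℝ) ^ (k - 1))
    (h : ∀ Q, VPart μ p.1 Q ≤ v * α ^ (Q.parts.card - 1)) :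
    eLpNorm p.2 T P ≤ ENNReal.ofReal (v * α * momentConst k * √(T : ℝ) ^ k) := by
  have : Nonempty (Fin k) := ⟨⟨0, by omega⟩⟩
  have hc := one_le_momentConst hk
  refine eLpNorm_le_of_integral_pow_le hT (by omega) (memLp_snd hW hp (ENNReal.natCast_ne_top T))
    (by positivity) ?_
  obtain ⟨K, _, _, B, a, hB, ha, h1, h2⟩ := hW.exists_step hp
  rw [h1] at h
  have h3 : ∫ ω, p.2 ω ^ T ∂P = ∫ ω, stepIntegral W B a ω ^ T ∂P :=
    integral_congr_ae (h2.mono fun ω hω => by simp only [hω])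
  rw [h3, hW.integral_stepIntegral_pow B hB]
  refine (le_abs_self _).trans ?_
  have h4 := abs_diagSum_le (V := Fin T) (J := Fin k) (by simpa using hk) (by simpa using hT2)
    (a := fun i => a i * ∏ j, √(μ.real (B (i j)).1)) (fun i hi => by simp [ha i hi])
    (tensorBound_of_VPart hB a h) hv hα (by simpa using hαT)
  simpa [momentConst] using h4

/-- The choice T = 2, α = 1 requires only V_Q ≤ V₁. The constant is not the sharp one of the
isometry, but continuity in L² is all that is needed. -/
theorem eLpNorm_two_snd_le (hW : IsWhiteNoise μ P W) (hk : 2 ≤ k)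
    (hp : p ∈ elementaryIntegrals W k) :
    eLpNorm p.2 2 P ≤ ENNReal.ofReal (momentConst k * √2 ^ k) *
      eLpNorm p.1 2 (Measure.pi fun _ => μ) := by
  have h := eLpNorm_snd_le hW hk hp even_two le_rfl (V₁_nonneg (μ := μ) p.1) one_pos
    (by simpa using one_le_pow₀ (one_le_two)) (fun Q => by
      simpa using VPart_le_V₁ (memLp_fst hW hp))
  rw [eLpNorm_eq_V₁ (memLp_fst hW hp), mul_comm, ← ENNReal.ofReal_mul (V₁_nonneg _)]
  simpa [mul_assoc] using h

end Elementary

/-! ### Existence of the integral and passage to the limit. -/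

section Integral

variable {X Ω : Type*} [MeasurableSpace X] [MeasurableSpace Ω] {μ : Measure X} [SigmaFinite μ]
    {P : Measure Ω} {W : FinMeasSet μ → Ω → ℝ} {k : ℕ} {f : (Fin k → X) → ℝ}

theorem IsWhiteNoise.exists_isMultipleIntegral (hW : IsWhiteNoise μ P W) (hμ : IsNonatomic μ)
    (hk : 2 ≤ k) (hf : MemLp f 2 (Measure.pi fun _ : Fin k => μ)) :
    ∃ J, IsMultipleIntegral P W f J := by
  set D : ENNReal := ENNReal.ofReal (momentConst k * √2 ^ k) with hD
  -- Two approximations of index at least N differ by at most 2 ε N, hence their integrals by at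
  -- most half of 2^(-N); the summand 1 keeps the denominator positive, and halving gives the strict
  -- inequality required of the Cauchy sequence.
  set ε : ℕ → ENNReal := fun n => 2⁻¹ ^ n / (4 * (D + 1)) with hε
  have hD1 : 4 * (D + 1) ≠ ⊤ := by
    rw [hD]; finiteness
  have hε0 : ∀ n, ε n ≠ 0 := fun n => ENNReal.div_ne_zero.mpr ⟨by simp, hD1⟩
  choose p hp hpf using fun n => isElementaryLimit_of_memLp (W := W) hμ hf (ε n) (hε0 n)
  have hanti : Antitone ε := fun m n hmn =>
    ENNReal.div_le_div_right (pow_le_pow_right_of_le_one' (by simp) hmn) _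
  obtain ⟨J, hJ, hJt⟩ := Lp.cauchy_complete_eLpNorm (p := 2) (f := fun n => (p n).2)
    (B := fun n => 2⁻¹ ^ n) (μ := P) (by norm_num)
    (fun n => memLp_snd hW (hp n) ENNReal.ofNat_ne_top) (by
      rw [ENNReal.tsum_geometric, ENNReal.one_sub_inv_two, inv_inv]; finiteness) (by
      intro N n m hn hm
      have hsub := Submodule.sub_mem _ (hp n) (hp m)
      have h1 := eLpNorm_two_snd_le hW hk hsub
      rw [Prod.fst_sub, Prod.snd_sub] at h1
      have h2 : eLpNorm ((p n).1 - (p m).1) 2 (Measure.pi fun _ => μ) ≤ ε N + ε N := by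
        rw [← sub_sub_sub_cancel_right _ _ f]
        refine (eLpNorm_sub_le ((memLp_fst hW (hp n)).1.sub hf.1)
          ((memLp_fst hW (hp m)).1.sub hf.1) (by norm_num)).trans ?_
        exact add_le_add ((hpf n).trans (hanti hn)) ((hpf m).trans (hanti hm))
      have hN0 : (2⁻¹ : ENNReal) ^ N ≠ 0 := by simp
      have hNt : (2⁻¹ : ENNReal) ^ N ≠ ⊤ := by finiteness
      have h3 : D * (ε N + ε N) ≤ 2⁻¹ ^ N / 2 := by
        have h4 : (D + 1) * ε N = 2⁻¹ ^ N / 4 := by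
          have hd0 : D + 1 ≠ 0 := by simp
          have hdt : D + 1 ≠ ⊤ := by rw [hD]; finiteness
          rw [hε, mul_comm (4 : ENNReal)]
          simp only []
          rw [div_eq_mul_inv, ENNReal.mul_inv (Or.inl hd0) (Or.inl hdt), mul_left_comm,
            ← mul_assoc (D + 1), ENNReal.mul_inv_cancel hd0 hdt, one_mul, div_eq_mul_inv]
        calc D * (ε N + ε N) ≤ (D + 1) * (ε N + ε N) := by gcongr; exact le_self_add
          _ = 2⁻¹ ^ N / 4 + 2⁻¹ ^ N / 4 := by rw [mul_add, h4]
          _ = 2⁻¹ ^ N / 2 := by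
            rw [div_eq_mul_inv, div_eq_mul_inv, ← mul_add]
            congr 1
            rw [show (4 : ENNReal) = 2 * 2 by norm_num,
              ENNReal.mul_inv (by simp) (by simp), ← mul_add, ENNReal.inv_two_add_inv_two, mul_one]
      refine (h1.trans ((mul_le_mul_right h2 D).trans h3)).trans_lt ?_
      exact ENNReal.half_lt_self hN0 hNt)
  refine ⟨J, hJ.1, p, hp, ?_, hJt⟩
  refine tendsto_of_tendsto_of_tendsto_of_le_of_le tendsto_const_nhds ?_ (fun _ => zero_le) hpf
  have h1 : Tendsto (fun n : ℕ => (2⁻¹ : ENNReal) ^ n / (4 * (D + 1))) atTop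
      (𝓝 (0 / (4 * (D + 1)))) :=
    ENNReal.Tendsto.div_const (ENNReal.tendsto_pow_atTop_nhds_zero_of_lt_one (by simp))
      (Or.inr (by simp))
  simpa using h1

/-- The approximating elementary functions eventually satisfy the hypothesis with v + δ. Fatou's
lemma along an almost surely convergent subsequence gives the bound with v + δ, and then δ tends to
0. -/
theorem IsMultipleIntegral.eLpNorm_le {J : Ω → ℝ} (hJ : IsMultipleIntegral P W f J)
    (hW : IsWhiteNoise μ P W) (hk : 2 ≤ k) (hf : MemLp f 2 (Measure.pi fun _ : Fin k => μ))
    {T : ℕ} (hT : Even T) (hT2 : 2 ≤ T) {v α : ℝ} (hv : 0 ≤ v) (hα : 0 < α)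
    (hαT : (α ^ 2)⁻¹ ≤ (T : ℝ) ^ (k - 1))
    (h : ∀ Q, VPart μ f Q ≤ v * α ^ (Q.parts.card - 1)) :
    eLpNorm J T P ≤ ENNReal.ofReal (v * α * momentConst k * √(T : ℝ) ^ k) := by
  obtain ⟨hJm, p, hp, hpf, hpJ⟩ := hJ
  have hp2 : ∀ n, AEStronglyMeasurable (p n).2 P := fun n =>
    (memLp_snd hW (hp n) (q := 2) ENNReal.ofNat_ne_top).1
  have hV : Tendsto (fun n => V₁ μ ((p n).1 - f)) atTop (𝓝 0) := by
    have h1 : ∀ n, V₁ μ ((p n).1 - f) =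
        (eLpNorm ((p n).1 - f) 2 (Measure.pi fun _ => μ)).toReal := fun n => by
      rw [eLpNorm_eq_V₁ ((memLp_fst hW (hp n)).sub hf), ENNReal.toReal_ofReal (V₁_nonneg _)]
    simp only [h1]
    exact ENNReal.toReal_zero ▸ (ENNReal.tendsto_toReal ENNReal.zero_ne_top).comp hpf
  obtain ⟨ns, hns, hae⟩ := (tendstoInMeasure_of_tendsto_eLpNorm two_ne_zero hp2 hJm
    hpJ).exists_seq_tendsto_ae
  have key : ∀ δ : ℝ, 0 < δ →
      eLpNorm J T P ≤ ENNReal.ofReal ((v + δ) * α * momentConst k * √(T : ℝ) ^ k) := by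
    intro δ hδ
    have hev : ∀ᶠ n in atTop, ∀ Q : Finpartition (Finset.univ : Finset (Fin k)),
        VPart μ (p n).1 Q ≤ (v + δ) * α ^ (Q.parts.card - 1) := by
      rw [eventually_all]
      intro Q
      have hpos : 0 < δ * α ^ (Q.parts.card - 1) := by positivity
      filter_upwards [hV.eventually_lt_const hpos] with n hn
      rw [add_mul]
      exact (VPart_le_add hf (memLp_fst hW (hp n))).trans (add_le_add (h Q) hn.le)
    refine (Lp.eLpNorm_lim_le_liminf_eLpNorm (fun n => hp2 (ns n)) J hae).trans ?_
    refine liminf_le_of_le (by isBoundedDefault) fun b hb => ?_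
    obtain ⟨n, hn1, hn2⟩ := (hb.and (hns.tendsto_atTop.eventually hev)).exists
    exact hn1.trans (eLpNorm_snd_le hW hk (hp _) hT hT2 (by positivity) hα hαT hn2)
  have hlim : Tendsto (fun δ : ℝ => ENNReal.ofReal ((v + δ) * α * momentConst k * √(T : ℝ) ^ k))
      (𝓝[>] 0) (𝓝 (ENNReal.ofReal ((v + 0) * α * momentConst k * √(T : ℝ) ^ k))) := by
    refine (Continuous.tendsto ?_ 0).mono_left nhdsWithin_le_nhds
    exact ENNReal.continuous_ofReal.comp (by fun_prop)
  rw [add_zero] at hlim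
  exact ge_of_tendsto hlim (eventually_mem_nhdsWithin.mono fun δ hδ => key δ hδ)

end Integral

end WienerIto

/-! ### The moment bound for general kernels. -/

namespace WienerIto

section Moments

variable {X Ω : Type*} [MeasurableSpace X] [MeasurableSpace Ω] {μ : Measure X} [SigmaFinite μ]
    {P : Measure Ω} {W : FinMeasSet μ → Ω → ℝ} {k : ℕ} {f : (Fin k → X) → ℝ}

/-- `max_{2 ≤ s ≤ k} (V_s / V₁) ^ (2 / (s - 1))` for given `V₁ = v` and `V_s = w s`. -/
noncomputable def maxRatio (k : ℕ) (hk : 2 ≤ k) (v : ℝ) (w : ℕ → ℝ) : ℝ :=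
  (Finset.Icc 2 k).sup' (Finset.nonempty_Icc.mpr hk) fun s => (w s / v) ^ (2 / ((s : ℝ) - 1))

theorem div_rpow_le_maxRatio (hk : 2 ≤ k) (v : ℝ) (w : ℕ → ℝ) {s : ℕ} (hs : s ∈ Finset.Icc 2 k) :
    (w s / v) ^ (2 / ((s : ℝ) - 1)) ≤ maxRatio k hk v w :=
  Finset.le_sup' (fun s : ℕ => (w s / v) ^ (2 / ((s : ℝ) - 1))) hs

theorem le_mul_pow_of_maxRatio_le (hk : 2 ≤ k) {v α : ℝ} {w : ℕ → ℝ} (hv : 0 < v)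
    (hw : ∀ s, 0 ≤ w s) (hα : 0 < α) (h : maxRatio k hk v w ≤ α ^ 2) {s : ℕ}
    (hs : s ∈ Finset.Icc 2 k) : w s ≤ v * α ^ (s - 1) := by
  have hs2 : 2 ≤ s := (Finset.mem_Icc.mp hs).1
  have hs1 : (0 : ℝ) < (s : ℝ) - 1 := by
    have : (2 : ℝ) ≤ s := by exact_mod_cast hs2
    linarith
  have h1 := (div_rpow_le_maxRatio hk v w hs).trans h
  have h0 : 0 ≤ w s / v := div_nonneg (hw s) hv.le
  rw [← div_le_iff₀' hv]
  have h2 : w s / v = ((w s / v) ^ (2 / ((s : ℝ) - 1))) ^ (((s : ℝ) - 1) / 2) := by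
    rw [← Real.rpow_mul h0, div_mul_div_cancel₀ hs1.ne', div_self two_ne_zero, Real.rpow_one]
  rw [h2]
  refine (Real.rpow_le_rpow (Real.rpow_nonneg h0 _) h1 (by positivity)).trans_eq ?_
  rw [← Real.rpow_natCast α 2, ← Real.rpow_mul hα.le, Nat.cast_ofNat,
    mul_div_cancel₀ _ two_ne_zero, ← Real.rpow_natCast, Nat.cast_sub (by omega), Nat.cast_one]

theorem IsMultipleIntegral.integral_pow_le {J : Ω → ℝ} (hJ : IsMultipleIntegral P W f J)
    (hW : IsWhiteNoise μ P W) (hk : 2 ≤ k) (hf : MemLp f 2 (Measure.pi fun _ : Fin k => μ))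
    {M : ℕ} (hM : 1 ≤ M) :
    Integrable (fun ω => J ω ^ (2 * M)) P ∧ ∫ ω, J ω ^ (2 * M) ∂P ≤
      (momentConst k ^ 2 * 2 ^ k) ^ M * V₁ μ f ^ (2 * M) *
        max (M : ℝ) ((M : ℝ) ^ k * maxRatio k hk (V₁ μ f) fun s => V μ s f) ^ M := by
  have : Nonempty (Fin k) := ⟨⟨0, by omega⟩⟩
  have hM1 : (1 : ℝ) ≤ M := by exact_mod_cast hM
  have hc := one_le_momentConst hk
  set β := maxRatio k hk (V₁ μ f) fun s => V μ s f with hβ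
  set v := V₁ μ f with hv
  have hv0 : 0 ≤ v := V₁_nonneg f
  have hTpos : (0 : ℝ) < ((2 * M : ℕ) : ℝ) := by positivity
  -- This is α². The first term makes V_s ≤ V₁ α^(s-1) for all s, and the second is the smallest
  -- value allowed in the counting of pairings.
  set t : ℝ := max β (((2 * M : ℕ) : ℝ) ^ (k - 1))⁻¹ with ht
  have ht0 : 0 < t := lt_max_of_lt_right (by positivity)
  have hα2 : √t ^ 2 = t := Real.sq_sqrt ht0.le
  have hVs : ∀ Q : Finpartition (Finset.univ : Finset (Fin k)),
      VPart μ f Q ≤ v * √t ^ (Q.parts.card - 1) := by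
    intro Q
    -- If V₁ = 0 the quotients are read as 0 and say nothing about V_s, but then every V_Q is at
    -- most 0.
    rcases hv0.eq_or_lt with h0 | hpos
    · rw [← h0, zero_mul, h0]
      exact VPart_le_V₁ hf
    have hQk : Q.parts.card ≤ k := by
      simpa using Q.card_parts_le_card
    rcases le_or_gt 2 Q.parts.card with h2 | h2
    · exact (VPart_le_V f).trans (le_mul_pow_of_maxRatio_le hk hpos (V_nonneg hf)
        (Real.sqrt_pos.mpr ht0) ((le_max_left _ _).trans_eq hα2.symm) (Finset.mem_Icc.mpr ⟨h2, hQk⟩))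
    · rw [show Q.parts.card - 1 = 0 by omega, pow_zero, mul_one]
      exact VPart_le_V₁ hf
  have hle := hJ.eLpNorm_le hW hk hf (even_two_mul M) (by omega) hv0 (Real.sqrt_pos.mpr ht0)
    (by
      rw [hα2]
      exact inv_le_of_inv_le₀ (by positivity) (le_max_right _ _)) hVs
  obtain ⟨hint, hbound⟩ := integral_pow_le_of_eLpNorm_le (even_two_mul M) (by omega) hJ.1
    (by positivity) hle
  refine ⟨hint, hbound.trans ?_⟩
  rw [pow_mul, pow_mul v, ← mul_pow, ← mul_pow]
  refine pow_le_pow_left₀ (by positivity) ?_ M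
  have h1 : (v * √t * momentConst k * √((2 * M : ℕ) : ℝ) ^ k) ^ 2 =
      momentConst k ^ 2 * v ^ 2 * (((2 * M : ℕ) : ℝ) ^ k * t) := by
    rw [mul_pow, mul_pow, mul_pow, hα2, ← pow_mul, mul_comm k 2, pow_mul, Real.sq_sqrt hTpos.le]
    ring
  -- The two terms of `t` give (2M)^k β and (2M)^k (2M)^(-(k-1)) = 2M, the two terms of the maximum
  -- in the moment bound.
  have h2 : ((2 * M : ℕ) : ℝ) ^ k * t ≤ 2 ^ k * max (M : ℝ) ((M : ℝ) ^ k * β) := by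
    rw [ht, mul_max_of_nonneg _ _ (by positivity), mul_max_of_nonneg _ _ (by positivity)]
    refine max_le (le_max_of_le_right ?_) (le_max_of_le_left ?_)
    · rw [Nat.cast_mul, mul_pow, mul_assoc, Nat.cast_ofNat]
    · obtain ⟨l, rfl⟩ : ∃ l, k = l + 1 := ⟨k - 1, by omega⟩
      rw [Nat.add_sub_cancel, pow_succ, mul_right_comm, mul_inv_cancel₀ (by positivity), one_mul,
        Nat.cast_mul, Nat.cast_ofNat]
      gcongr
      exact le_self_pow₀ one_le_two (by omega)
  rw [h1, mul_right_comm _ (2 ^ k : ℝ), mul_assoc _ (2 ^ k : ℝ)]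
  gcongr

end Moments

/-! ### The tail bound. -/

section Tail

variable {Ω : Type*} [MeasurableSpace Ω] {P : Measure Ω} {k : ℕ}

theorem mul_pow_le_of_le_rpow (hk : 2 ≤ k) {v x y : ℝ} {w : ℕ → ℝ} (hv : 0 < v)
    (hx : 0 < x) (hy : 0 < y) {s : ℕ} (hs : s ∈ Finset.Icc 2 k) (hw : 0 ≤ w s)
    (h : y ≤ (x / (v ^ (((s : ℝ) - 2) / ((s : ℝ) - 1)) * w s ^ (1 / ((s : ℝ) - 1)))) ^
      (2 / (k : ℝ))) :
    v ^ 2 * (y ^ k * (w s / v) ^ (2 / ((s : ℝ) - 1))) ≤ x ^ 2 := by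
  have hk0 : (k : ℝ) ≠ 0 := by positivity
  have hs2 : (2 : ℝ) ≤ s := by exact_mod_cast (Finset.mem_Icc.mp hs).1
  have hs1 : (s : ℝ) - 1 ≠ 0 := by linarith
  -- If `w s = 0` the quotient in `h` is read as 0, which contradicts `0 < y`.
  have hw0 : 0 < w s := by
    refine lt_of_le_of_ne hw fun h0 => ?_
    rw [← h0, Real.zero_rpow (by positivity), mul_zero, div_zero,
      Real.zero_rpow (by positivity)] at h
    exact hy.not_ge h
  set d := v ^ (((s : ℝ) - 2) / ((s : ℝ) - 1)) * w s ^ (1 / ((s : ℝ) - 1)) with hd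
  have hd0 : 0 < d := by positivity
  have h1 : y ^ k ≤ (x / d) ^ 2 := by
    refine (pow_le_pow_left₀ hy.le h k).trans_eq ?_
    rw [← Real.rpow_natCast, ← Real.rpow_mul (by positivity), div_mul_cancel₀ _ hk0,
      Real.rpow_ofNat]
  have h2 : v ^ 2 * (w s / v) ^ (2 / ((s : ℝ) - 1)) = d ^ 2 := by
    rw [Real.div_rpow hw0.le hv.le, hd, mul_pow, ← Real.rpow_ofNat (_ ^ _),
      ← Real.rpow_ofNat (w s ^ _), ← Real.rpow_mul hv.le, ← Real.rpow_mul hw0.le,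
      ← Real.rpow_ofNat v, ← mul_div_assoc, mul_div_right_comm, ← Real.rpow_sub hv]
    congr 2
    · field_simp
      ring
    · ring
  calc v ^ 2 * (y ^ k * (w s / v) ^ (2 / ((s : ℝ) - 1))) = d ^ 2 * y ^ k := by
        rw [← h2]; ring
    _ ≤ d ^ 2 * (x / d) ^ 2 := by gcongr
    _ = x ^ 2 := by rw [div_pow, mul_div_cancel₀ _ (by positivity)]

theorem measureReal_le_exp_of_integral_pow_le [IsProbabilityMeasure P] (hk : 2 ≤ k) {J : Ω → ℝ}
    {C v : ℝ} {w : ℕ → ℝ} (hC : 1 ≤ C) (hv : 0 ≤ v) (hw : ∀ s, 0 ≤ w s)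
    (hJ : ∀ M : ℕ, 1 ≤ M → Integrable (fun ω => J ω ^ (2 * M)) P ∧
      ∫ ω, J ω ^ (2 * M) ∂P ≤ C ^ M * v ^ (2 * M) *
        max (M : ℝ) ((M : ℝ) ^ k * maxRatio k hk v w) ^ M) {x : ℝ} (hx : 0 < x) :
    P.real {ω | x < |J ω|} ≤ Real.exp 1 * Real.exp (-((C * Real.exp 1)⁻¹ *
      min (x ^ 2 / v ^ 2) ((Finset.Icc 2 k).inf' (Finset.nonempty_Icc.mpr hk) fun s =>
        (x / (v ^ (((s : ℝ) - 2) / ((s : ℝ) - 1)) * w s ^ (1 / ((s : ℝ) - 1)))) ^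
          (2 / (k : ℝ))))) := by
  set y := min (x ^ 2 / v ^ 2) ((Finset.Icc 2 k).inf' (Finset.nonempty_Icc.mpr hk) fun s =>
        (x / (v ^ (((s : ℝ) - 2) / ((s : ℝ) - 1)) * w s ^ (1 / ((s : ℝ) - 1)))) ^
          (2 / (k : ℝ))) with hy
  have he : 1 ≤ Real.exp 1 := Real.one_le_exp zero_le_one
  -- Chosen so that C δ = 1/e: with M ≤ δ y the moment of order 2M is then at most x^(2M) e^(-M).
  set δ := (C * Real.exp 1)⁻¹ with hδ
  have hδ0 : 0 < δ := by positivity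
  have hδ1 : δ ≤ 1 := inv_le_one_of_one_le₀ (one_le_mul_of_one_le_of_one_le hC he)
  rw [← Real.exp_add]
  -- For δ y < 1 no moment is available, but the right side is at least 1 thanks to the factor e.
  rcases lt_or_ge (δ * y) 1 with hlt | hge
  · refine (measureReal_le_one).trans (Real.one_le_exp ?_)
    linarith
  have hy0 : 0 < y := by
    by_contra hneg
    have := mul_nonpos_of_nonneg_of_nonpos hδ0.le (not_lt.mp hneg)
    linarith
  have hv0 : 0 < v := by
    refine lt_of_le_of_ne hv fun h0 => ?_
    have : y ≤ x ^ 2 / v ^ 2 := min_le_left _ _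
    rw [← h0] at this
    simp at this
    linarith
  -- Rounding down costs at most a factor e, since e^(-M) ≤ e^(1 - δ y).
  set M := ⌊δ * y⌋₊ with hM
  have hM1 : 1 ≤ M := Nat.le_floor (by simpa using hge)
  have hMle : (M : ℝ) ≤ δ * y := Nat.floor_le (by positivity)
  have hMgt : δ * y < M + 1 := Nat.lt_floor_add_one _
  have hmax : v ^ 2 * max (M : ℝ) ((M : ℝ) ^ k * maxRatio k hk v w) ≤ δ * x ^ 2 := by
    rw [mul_max_of_nonneg _ _ (by positivity)]
    refine max_le ?_ ?_
    · have h1 : y ≤ x ^ 2 / v ^ 2 := min_le_left _ _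
      rw [le_div_iff₀ (by positivity)] at h1
      calc v ^ 2 * M ≤ v ^ 2 * (δ * y) := by gcongr
        _ = δ * (y * v ^ 2) := by ring
        _ ≤ δ * x ^ 2 := by gcongr
    · obtain ⟨s, hs, hsm⟩ := Finset.exists_mem_eq_sup' (Finset.nonempty_Icc.mpr hk)
        fun s : ℕ => (w s / v) ^ (2 / ((s : ℝ) - 1))
      rw [maxRatio, hsm]
      have h1 := mul_pow_le_of_le_rpow hk hv0 hx hy0 hs (hw s)
        ((min_le_right _ _).trans (Finset.inf'_le _ hs))
      have h0 : 0 ≤ (w s / v) ^ (2 / ((s : ℝ) - 1)) := Real.rpow_nonneg (div_nonneg (hw s) hv) _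
      calc v ^ 2 * ((M : ℝ) ^ k * (w s / v) ^ (2 / ((s : ℝ) - 1)))
          ≤ v ^ 2 * ((δ * y) ^ k * (w s / v) ^ (2 / ((s : ℝ) - 1))) := by gcongr
        _ = δ ^ k * (v ^ 2 * (y ^ k * (w s / v) ^ (2 / ((s : ℝ) - 1)))) := by
            rw [mul_pow]; ring
        _ ≤ δ * x ^ 2 := by
            gcongr
            exact pow_le_of_le_one hδ0.le hδ1 (by omega)
  obtain ⟨hint, hbound⟩ := hJ M hM1
  have hmarkov := mul_meas_ge_le_integral_of_nonneg
    (Eventually.of_forall fun ω => (even_two_mul M).pow_nonneg (J ω)) hint (x ^ (2 * M))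
  have hsub : P.real {ω | x < |J ω|} ≤ P.real {ω | x ^ (2 * M) ≤ J ω ^ (2 * M)} := by
    refine measureReal_mono fun ω (hω : x < |J ω|) => ?_
    show x ^ (2 * M) ≤ J ω ^ (2 * M)
    rw [← (even_two_mul M).pow_abs (J ω)]
    exact pow_le_pow_left₀ hx.le hω.le _
  have hmul : x ^ (2 * M) * P.real {ω | x < |J ω|} ≤ x ^ (2 * M) * Real.exp (-M) := by
    calc x ^ (2 * M) * P.real {ω | x < |J ω|}
        ≤ x ^ (2 * M) * P.real {ω | x ^ (2 * M) ≤ J ω ^ (2 * M)} := by gcongr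
      _ ≤ C ^ M * v ^ (2 * M) * max (M : ℝ) ((M : ℝ) ^ k * maxRatio k hk v w) ^ M :=
          hmarkov.trans hbound
      _ = (C * (v ^ 2 * max (M : ℝ) ((M : ℝ) ^ k * maxRatio k hk v w))) ^ M := by
          rw [pow_mul, ← mul_pow, ← mul_pow, mul_assoc]
      _ ≤ (C * (δ * x ^ 2)) ^ M := by
          have : 0 ≤ max (M : ℝ) ((M : ℝ) ^ k * maxRatio k hk v w) := le_max_of_le_left (by simp)
          gcongr
      _ = x ^ (2 * M) * Real.exp (-M) := by
          have h1 : C * (δ * x ^ 2) = x ^ 2 * Real.exp (-1) := by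
            rw [hδ, mul_inv, Real.exp_neg]
            field_simp
          rw [h1, mul_pow, ← pow_mul, ← Real.exp_nat_mul, mul_neg_one]
  refine (le_of_mul_le_mul_left hmul (by positivity)).trans (Real.exp_le_exp.mpr ?_)
  linarith

end Tail

end WienerIto

/-! ### The theorem. -/

theorem mainTheorem1 (k : ℕ) (hk : 2 ≤ k) :
    ∃ C C₁ C₂ : ℝ, 0 < C ∧ 0 < C₁ ∧ 0 < C₂ ∧
      ∀ {X : Type*} [MeasurableSpace X] (μ : Measure X) [SigmaFinite μ]
        (_ : WienerIto.IsNonatomic μ)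
        {Ω : Type*} [MeasurableSpace Ω] (P : Measure Ω) [IsProbabilityMeasure P]
        (W : WienerIto.FinMeasSet μ → Ω → ℝ) (_ : WienerIto.IsWhiteNoise μ P W)
        (f : (Fin k → X) → ℝ) (_ : MemLp f 2 (Measure.pi fun _ : Fin k => μ)),
        (∃ I : Ω → ℝ, WienerIto.IsWienerItoIntegral P W f I) ∧
        ∀ I : Ω → ℝ, WienerIto.IsWienerItoIntegral P W f I →
          (∀ M : ℕ, 1 ≤ M →
            Integrable (fun ω => ((k ! : ℝ) * I ω) ^ (2 * M)) P ∧
            ∫ ω, ((k ! : ℝ) * I ω) ^ (2 * M) ∂P ≤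
              C ^ M * WienerIto.V₁ μ f ^ (2 * M) *
                max (M : ℝ) ((M : ℝ) ^ k *
                  (Finset.Icc 2 k).sup' (Finset.nonempty_Icc.mpr hk) (fun s =>
                    (WienerIto.V μ s f / WienerIto.V₁ μ f) ^ (2 / ((s : ℝ) - 1)))) ^ M) ∧
          (∀ x : ℝ, 0 < x →
            P.real {ω | x < |(k ! : ℝ) * I ω|} ≤
              C₁ * Real.exp (-(C₂ * min (x ^ 2 / WienerIto.V₁ μ f ^ 2)
                ((Finset.Icc 2 k).inf' (Finset.nonempty_Icc.mpr hk) (fun s =>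
                  (x / (WienerIto.V₁ μ f ^ (((s : ℝ) - 2) / ((s : ℝ) - 1)) *
                    WienerIto.V μ s f ^ (1 / ((s : ℝ) - 1)))) ^ (2 / (k : ℝ))))))) := by
  have hc := WienerIto.one_le_momentConst hk
  have hC : 1 ≤ WienerIto.momentConst k ^ 2 * 2 ^ k :=
    one_le_mul_of_one_le_of_one_le (one_le_pow₀ hc) (one_le_pow₀ one_le_two)
  refine ⟨WienerIto.momentConst k ^ 2 * 2 ^ k, Real.exp 1,
    (WienerIto.momentConst k ^ 2 * 2 ^ k * Real.exp 1)⁻¹, by positivity, by positivity,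
    by positivity, ?_⟩
  intro X _ μ _ hμ Ω _ P _ W hW f hf
  have : Nonempty (Fin k) := ⟨⟨0, by omega⟩⟩
  refine ⟨?_, fun I hI => ?_⟩
  · obtain ⟨J, hJ⟩ := hW.exists_isMultipleIntegral hμ hk hf
    refine ⟨fun ω => (k ! : ℝ)⁻¹ * J ω, ?_⟩
    have hk0 : (k ! : ℝ) ≠ 0 := by positivity
    simpa only [WienerIto.IsWienerItoIntegral, mul_inv_cancel_left₀ hk0] using hJ
  · have hmom := fun (M : ℕ) (hM : 1 ≤ M) =>
      WienerIto.IsMultipleIntegral.integral_pow_le hI hW hk hf hM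
    exact ⟨hmom, fun x hx => WienerIto.measureReal_le_exp_of_integral_pow_le hk hC
      (WienerIto.V₁_nonneg f) (WienerIto.V_nonneg hf) hmom hx⟩
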